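/- Write points of $\mathbb R\times\mathbb R^3$ as $(x,v)$ with $v=(v_1,\bar v)$, $\bar v\in\mathbb R^2$. Let $f_0$ be a plane symmetric steady state of the Vlasov–Poisson system, $$f_0(x,v)=\varphi(E,\bar v)=\alpha(E)\,\beta(\bar v),\qquad E=E(x,v_1)=\tfrac12v_1^2+U_0(x),$$ where either $\alpha(E)=(E_0-E)_+^k$ with $k>\frac12$ (with $t_+^k=t^k$ for $t>0$ and $t_+^k=0$ for $t\le0$) or $\alpha(E)=(e^{E_0-E}-1)_+$, for some $E_0\in\mathbb R$; $\beta\ge0$ is continuous with compact support and $\int_{\mathbb R^2}\beta=1$; $f_0(-x,-v_1,\bar v)=f_0(x,v_1,\bar v)$; and, with $\rho_0(x)=\int_{\mathbb R^3}f_0(x,v)\,dv$, $0<\int_{\mathbb R}\rho_0<\infty$ and $U_0(x)=2\pi\int_{\mathbb R}|x-y|\rho_0(y)\,dy$ (absolutely convergent) for all $x$. Let $\Omega_0=\{f_0\ne0\}$, $\varphi'=\partial_E\varphi$, and let $\bar H=L^2(\Omega_0;|\varphi'(E,\bar v)|^{-1}dx\,dv)$ (real-valued), with $\bar{\mathcal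 H}\subset\bar H$ the subspace of functions that are a.e. odd in $x$ and odd in $v_1$. For $\xi\in C^1_c(\Omega_0)$ put $\bar{\mathcal D}\xi=v_1\partial_x\xi-U_0'(x)\partial_{v_1}\xi$. Let $\mathrm D(\bar{\mathcal D})$ be the set of $g\in\bar H$ for which there is $\bar{\mathcal D}g\in\bar H$ with $$\int_{\Omega_0}\frac{1}{|\varphi'|}\,g\,\bar{\mathcal D}\xi\,dx\,dv=-\int_{\Omega_0}\frac1{|\varphi'|}\,(\bar{\mathcal D}g)\,\xi\,dx\,dv\quad\text{for all }\xi\in C^1_c(\Omega_0),$$ and $\mathrm D(\bar{\mathcal D}^2)=\{g\in\mathrm D(\bar{\mathcal D}):\bar{\mathcal D}g\in\mathrm D(\bar{\mathcal D})\}$. Extending functions by $0$ outside $\Omega_0$, put $$(\bar{\mathcal B}g)(x,v)=4\pi|\varphi'(E,\bar v)|\,v_1\int_{\mathbb R^3}\tilde v_1\,g(x,\tilde v)\,d\tilde v,\qquad \bar{\mathcal A}=-\bar{\mathcal D}^2-\bar{\mathcal B}\ \text{ on }\mathrm D(\bar{\mathcal D}^2).$$ The quadratic form of $\bar{\mathcal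 A}$ is, for $g\in\mathrm D(\bar{\mathcal D})$, $$\langle\bar{\mathcal A}g,g\rangle_{\bar H}=\|\bar{\mathcal D}g\|_{\bar H}^2-\frac1{4\pi}\|U_{\bar{\mathcal D}g}'\|_{L^2(\mathbb R)}^2,\qquad U_h(x)=2\pi\int_{\mathbb R}|x-y|\int_{\mathbb R^3}h(y,v)\,dv\,dy .$$ **Theorem.** $\bar{\mathcal A}$ restricts to a well-defined operator $\mathrm D(\bar{\mathcal D}^2)\cap\bar{\mathcal H}\to\bar{\mathcal H}$, and there exists $c>0$ (depending on the steady state) such that for all $g\in\mathrm D(\bar{\mathcal D})\cap\bar{\mathcal H}$ one has $U'_{\bar{\mathcal D}g}\in L^2(\mathbb R)$ and $$\langle\bar{\mathcal A}g,g\rangle_{\bar H}\ge c\,\|g\|_{\bar H}^2 .$$ Moreover the kernel of $\bar{\mathcal A}\colon\mathrm D(\bar{\mathcal D}^2)\cap\bar{\mathcal H}\to\bar{\mathcal H}$ is trivial, and its spectrum is bounded away from zero: it is contained in $[c,\infty)$. -/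

import Mathlib

open MeasureTheory Set Real

noncomputable section

/-- Points `(x, v₁, v̄)` with `x, v₁ ∈ ℝ` and `v̄ = (v₂, v₃) ∈ ℝ²`. -/
abbrev PlanarPhase : Type := ℝ × ℝ × (ℝ × ℝ)

/-- The potential `U_ρ(x) = 2π ∫ |x - y| ρ(y) dy` induced by a planar mass density `ρ`. -/
def planarPotential (ρ : ℝ → ℝ) (x : ℝ) : ℝ := 2 * π * ∫ y, |x - y| * ρ y

/-- The admissible energy dependencies: a polytrope with exponent `k > 1/2`, or King's. -/
inductive EnergyProfile : Type
  | polytrope (k : ℝ) (hk : 1 / 2 < k)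
  | king

/-- The profile as a function of `η = E₀ - E`: `η ↦ (η)₊ ^ k` (with value `0` for `η ≤ 0`),
respectively `η ↦ (exp η - 1)₊`. -/
def EnergyProfile.toFun : EnergyProfile → ℝ → ℝ
  | .polytrope k _, η => if 0 < η then η ^ k else 0
  | .king, η => max (exp η - 1) 0

/-- The ingredients of the ansatz `f₀(x, v) = φ(E, v̄) = α(E) β(v̄)`, `E = v₁² / 2 + U₀(x)`. -/
structure PlanarData where
  /-- the type of the energy dependence `α` -/
  profile : EnergyProfile
  /-- the cut-off energy -/
  E₀ : ℝ
  /-- the dependence on `v̄` -/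
  β : ℝ × ℝ → ℝ
  /-- the stationary potential -/
  U₀ : ℝ → ℝ

namespace PlanarData

/-- `α(E)`. -/
def α (S : PlanarData) (E : ℝ) : ℝ := S.profile.toFun (S.E₀ - E)

/-- `φ(E, v̄) = α(E) β(v̄)`. -/
def φ (S : PlanarData) (E : ℝ) (w : ℝ × ℝ) : ℝ := S.α E * S.β w

/-- `φ' = ∂φ/∂E`. -/
def φ' (S : PlanarData) (E : ℝ) (w : ℝ × ℝ) : ℝ := deriv (fun e => S.φ e w) E

/-- The particle energy `E(x, v₁) = v₁² / 2 + U₀(x)`. -/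
def energy (S : PlanarData) (x v₁ : ℝ) : ℝ := v₁ ^ 2 / 2 + S.U₀ x

/-- The phase space density `f₀`. -/
def f₀ (S : PlanarData) (z : PlanarPhase) : ℝ := S.φ (S.energy z.1 z.2.1) z.2.2

/-- The mass density `ρ₀(x) = ∫ f₀(x, v) dv`. -/
def ρ₀ (S : PlanarData) (x : ℝ) : ℝ := ∫ v : ℝ × (ℝ × ℝ), S.f₀ (x, v)

/-- The data form a nontrivial plane symmetric steady state of finite mass of the Vlasov-Poisson
system. The Vlasov equation holds because `f₀` is a function of the conserved quantities; what
remains is the Poisson equation for the self-consistent potential. -/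
structure IsSteadyState (S : PlanarData) : Prop where
  β_continuous : Continuous S.β
  β_compact : HasCompactSupport S.β
  β_nonneg : ∀ w, 0 ≤ S.β w
  β_integral : ∫ w, S.β w = 1
  /-- reflection symmetry, part of plane symmetry -/
  symm : ∀ (x v₁ : ℝ) (w : ℝ × ℝ), S.f₀ (-x, -v₁, w) = S.f₀ (x, v₁, w)
  /-- finite mass -/
  integrable : Integrable S.ρ₀
  /-- nontriviality -/
  mass_pos : 0 < ∫ x, S.ρ₀ x
  /-- the integral that defines the potential converges -/
  integrable_potential : ∀ x, Integrable fun y => |x - y| * S.ρ₀ y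
  /-- the Poisson equation -/
  poisson : ∀ x, S.U₀ x = planarPotential S.ρ₀ x

/-- `Ω₀ = {f₀ ≠ 0}`. -/
def Ω₀ (S : PlanarData) : Set PlanarPhase := {z | S.f₀ z ≠ 0}

/-- The measure `|φ'(E, v̄)|⁻¹ dx dv` on `Ω₀`. -/
def weightedMeasure (S : PlanarData) : Measure PlanarPhase :=
  (volume.restrict S.Ω₀).withDensity
    fun z => ENNReal.ofReal (1 / |S.φ' (S.energy z.1 z.2.1) z.2.2|)

/-- The real Hilbert space `H = L²(Ω₀; |φ'|⁻¹ dx dv)`. -/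
abbrev H (S : PlanarData) : Type := Lp ℝ 2 S.weightedMeasure

/-- The subspace of the `g ∈ H` that are odd in `x` and odd in `v₁`, a.e. on `Ω₀`. -/
def Hodd (S : PlanarData) : Set S.H :=
  {g | ∀ᵐ z ∂S.weightedMeasure,
    g z = -g (-z.1, z.2.1, z.2.2) ∧ g z = -g (z.1, -z.2.1, z.2.2)}

/-- The classical transport operator `D ξ = v₁ ∂ₓ ξ - U₀'(x) ∂_{v₁} ξ` on `C¹` functions. -/
def classicalTransport (S : PlanarData) (ξ : PlanarPhase → ℝ) (z : PlanarPhase) : ℝ :=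
  fderiv ℝ ξ z (z.2.1, -deriv S.U₀ z.1, 0)

/-- `g ∈ D(D)` and `D g = h` weakly, tested against all `ξ ∈ C¹_c(Ω₀)`. -/
def HasTransport (S : PlanarData) (g h : S.H) : Prop :=
  ∀ ξ : PlanarPhase → ℝ, ContDiff ℝ 1 ξ → HasCompactSupport ξ → tsupport ξ ⊆ S.Ω₀ →
    ∫ z, g z * S.classicalTransport ξ z ∂S.weightedMeasure
      = -∫ z, h z * ξ z ∂S.weightedMeasure

/-- The domain `D(D²) = {g ∈ D(D) | D g ∈ D(D)}`. -/
def domSq (S : PlanarData) : Set S.H :=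
  {g | ∃ h k : S.H, S.HasTransport g h ∧ S.HasTransport h k}

/-- The density `ρ_h(x) = ∫ h(x, v) dv`, with `h` extended by `0` outside `Ω₀`. -/
def inducedDensity (S : PlanarData) (h : S.H) (x : ℝ) : ℝ :=
  ∫ v : ℝ × (ℝ × ℝ), S.Ω₀.indicator h (x, v)

/-- The derivative `U_h'` of the potential induced by `h ∈ H`. -/
def inducedField (S : PlanarData) (h : S.H) : ℝ → ℝ :=
  deriv (planarPotential (S.inducedDensity h))

/-- The quadratic form `⟨A g, g⟩ = ‖D g‖² - (1 / 4π) ‖U_{D g}'‖₂²` of `g ∈ D(D)`, as a function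
of `h = D g`. -/
def antonovForm (S : PlanarData) (h : S.H) : ℝ :=
  ‖h‖ ^ 2 - 1 / (4 * π) * ∫ x, S.inducedField h x ^ 2

/-- `J(g)(x) = ∫ v₁ g(x, v) dv`, with `g` extended by `0` outside `Ω₀`. -/
def J (S : PlanarData) (g : S.H) (x : ℝ) : ℝ :=
  ∫ v : ℝ × (ℝ × ℝ), v.1 * S.Ω₀.indicator g (x, v)

/-- `(B g)(x, v) = 4π |φ'(E, v̄)| v₁ J(g)(x)`. -/
def B (S : PlanarData) (g : S.H) (z : PlanarPhase) : ℝ :=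
  4 * π * |S.φ' (S.energy z.1 z.2.1) z.2.2| * z.2.1 * S.J g z.1

/-- `g ∈ D(D²)` and `A g = f`, where `A = -D² - B` is the planar Antonov operator. -/
def HasAntonov (S : PlanarData) (g f : S.H) : Prop :=
  ∃ h k : S.H, S.HasTransport g h ∧ S.HasTransport h k ∧
    ∀ᵐ z ∂S.weightedMeasure, f z = -k z - S.B g z

end PlanarData

/-- The spectrum of the restriction to the subspace `K` of the (unbounded) operator with graph
`{(g, f) | A g f}`. The number `l` belongs to the resolvent set if `A - l` maps the vectors of its
domain in `K` bijectively onto `K` and the inverse is bounded. -/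
def operatorSpectrum {X : Type*} [NormedAddCommGroup X] [NormedSpace ℝ X]
    (K : Set X) (A : X → X → Prop) : Set ℝ :=
  {l | ¬((∀ f ∈ K, ∃! g, g ∈ K ∧ A g (f + l • g)) ∧
    ∃ C : ℝ, ∀ g ∈ K, ∀ f ∈ K, A g (f + l • g) → ‖g‖ ≤ C * ‖f‖)}

end

/-! Write `v` for `v₁`, `D` for the transport operator and `J` for the flux `∫ v g dv`. By the
continuity equation the field induced by `D g` is `4π J(g)`, so the form equals `‖D g‖² - 4π
‖J(g)‖²`. Integration by parts in `v` gives `∫ v² |φ'| dv ≤ ρ₀(x)`. The Cauchy-Schwarz inequality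
then yields `‖J(g)‖² ≤ ∫ ρ₀ g² / |φ'|` (`integral_J_sq_le`), and it suffices to bound `‖D g‖²` below
by the integral of `(4π ρ₀ + 3c) g² / |φ'|`.

This is a Hardy-type inequality along the characteristic flow. An odd-odd function vanishes where `x
v` does, so it can be compared with `x v`, whose logarithmic derivative is `q = D(x v) / (x v) = v /
x - U₀' / v`. Since `D` is skew, `∫ (D g - q g)² / |φ'| ≥ 0` becomes `‖D g‖² ≥ ∫ -(D q + q²) g² /
|φ'|`. By `U₀'' = 4π ρ₀` the singular squares cancel and `-(D q + q²) = 4π ρ₀ + 3 U₀' / x`. The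
density term absorbs the flux term exactly. In the remainder `U₀' / x` is bounded below by some `c >
0` on the support, because `U₀'` is odd and increasing with slope `4π ρ₀(0) > 0` at the origin
(`exists_mul_sq_le`). The constant of the theorem is `3c`. The computation is done for test
functions with a regularised `q` (`riccati_le`, `coercive_test`).

The passage to weak transport pairs requires that test functions form a core of `D`
(`exists_seq_test`). This follows from skew-symmetry of the weak operator
(`inner_add_inner_eq_zero`), which is proved by Friedrichs mollification after localisation with
cut-offs invariant under the flow. Both reflections reverse the flow, so `D` exchanges parities and
the core can be projected onto odd-odd functions (`coercive`).

For the spectrum, the form of `A - l` with `l` below the constant is coercive on the graph space of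
`D` over the odd-odd functions. The Lax-Milgram theorem solves `A g = f + l g`
(`exists_antonov_eq`), and coercivity of the form gives uniqueness and the bound on the inverse. -/

noncomputable section

open Filter Topology
open scoped RealInnerProductSpace

/-! ### Energy profiles and their velocity integrals. -/

namespace EnergyProfile

/-- The derivative of the profile at positive arguments. -/
def rate : EnergyProfile → ℝ → ℝ
  | .polytrope k _, η => k * η ^ (k - 1)
  | .king, η => exp η

lemma toFun_of_nonpos (p : EnergyProfile) {η : ℝ} (h : η ≤ 0) : p.toFun η = 0 := by
  cases p with
  | polytrope k hk => simp [toFun, not_lt.2 h]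
  | king => simp [toFun, h]

lemma toFun_pos (p : EnergyProfile) {η : ℝ} (h : 0 < η) : 0 < p.toFun η := by
  cases p with
  | polytrope k hk => simp only [toFun, if_pos h]; positivity
  | king => simp [toFun, h]

lemma toFun_nonneg (p : EnergyProfile) (η : ℝ) : 0 ≤ p.toFun η := by
  rcases le_or_gt η 0 with h | h
  · rw [p.toFun_of_nonpos h]
  · exact (p.toFun_pos h).le

lemma toFun_polytrope (k : ℝ) (hk : 1 / 2 < k) (η : ℝ) :
    (polytrope k hk).toFun η = (max η 0) ^ k := by
  rcases le_or_gt η 0 with h | h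
  · rw [toFun_of_nonpos _ h, max_eq_right h, zero_rpow (by linarith)]
  · simp [toFun, if_pos h, max_eq_left h.le]

lemma continuous_toFun (p : EnergyProfile) : Continuous p.toFun := by
  cases p with
  | polytrope k hk =>
    rw [funext (toFun_polytrope k hk)]
    exact (continuous_id.max continuous_const).rpow_const fun _ => Or.inr (by linarith)
  | king =>
    change Continuous fun η => max (exp η - 1) 0
    fun_prop

lemma monotone_toFun (p : EnergyProfile) : Monotone p.toFun := by
  cases p with
  | polytrope k hk =>
    rw [funext (toFun_polytrope k hk)]
    intro a b hab
    exact rpow_le_rpow (le_max_right _ _) (max_le_max_right _ hab) (by linarith)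
  | king =>
    intro a b hab
    exact max_le_max_right _ (sub_le_sub_right (exp_le_exp.2 hab) _)

lemma rate_pos (p : EnergyProfile) {η : ℝ} (h : 0 < η) : 0 < p.rate η := by
  cases p with
  | polytrope k hk => simp only [rate]; have : 0 < k := by linarith
                      positivity
  | king => exact exp_pos _

lemma hasDerivAt_toFun (p : EnergyProfile) {η : ℝ} (h : 0 < η) :
    HasDerivAt p.toFun (p.rate η) η := by
  cases p with
  | polytrope k hk =>
    refine (hasDerivAt_rpow_const (p := k) (Or.inl h.ne')).congr_of_eventuallyEq ?_
    filter_upwards [lt_mem_nhds h] with t ht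
    simp [toFun, if_pos ht]
  | king =>
    refine ((hasDerivAt_exp η).sub_const 1).congr_of_eventuallyEq ?_
    filter_upwards [lt_mem_nhds h] with t ht
    simp [toFun, ht.le]

lemma contDiffAt_rate (p : EnergyProfile) {η : ℝ} (h : 0 < η) : ContDiffAt ℝ 1 p.rate η := by
  cases p with
  | polytrope k hk => exact contDiffAt_const.mul (contDiffAt_id.rpow_const_of_ne h.ne')
  | king => exact contDiff_exp.contDiffAt

lemma continuousOn_rate (p : EnergyProfile) : ContinuousOn p.rate (Ioi 0) := fun _ h =>
  (p.contDiffAt_rate h).continuousAt.continuousWithinAt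

/-- Only a blow-up of the rate at the cut-off energy matters. It occurs for polytropes with `k < 1`;
in the other cases the rate is bounded on `(0, M]` and `κ = 1` serves. -/
lemma exists_rate_le (p : EnergyProfile) (M : ℝ) : ∃ κ C : ℝ, 1 / 2 < κ ∧ κ ≤ 1 ∧ 0 ≤ C ∧
    ∀ η, 0 < η → η ≤ M → p.rate η ≤ C * η ^ (κ - 1) := by
  cases p with
  | polytrope k hk =>
    rcases le_or_gt k 1 with h1 | h1
    · exact ⟨k, k, hk, h1, by linarith, fun η _ _ => le_rfl⟩
    · refine ⟨1, k * (max M 0) ^ (k - 1), by norm_num, le_rfl, by positivity, fun η h0 hM => ?_⟩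
      simp only [rate, sub_self, rpow_zero, mul_one]
      exact mul_le_mul_of_nonneg_left
        (rpow_le_rpow h0.le (hM.trans (le_max_left _ _)) (by linarith)) (by linarith)
  | king =>
    exact ⟨1, exp M, by norm_num, le_rfl, (exp_pos _).le, fun η _ hM => by
      simpa [rate] using hM⟩

lemma toFun_shell_eq_zero (p : EnergyProfile) {η v : ℝ} (h : 1 + |η| ≤ |v|) :
    p.toFun (η - v ^ 2 / 2) = 0 := by
  apply p.toFun_of_nonpos
  have h1 : (1 + |η|) ^ 2 ≤ v ^ 2 := by
    rw [← sq_abs v]; gcongr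
  nlinarith [le_abs_self η, sq_nonneg |η|]

lemma continuous_toFun_shell (p : EnergyProfile) (η : ℝ) :
    Continuous fun v : ℝ => p.toFun (η - v ^ 2 / 2) :=
  p.continuous_toFun.comp (by fun_prop)

lemma integrable_toFun_shell (p : EnergyProfile) (η : ℝ) :
    Integrable fun v : ℝ => p.toFun (η - v ^ 2 / 2) := by
  refine (p.continuous_toFun_shell η).integrable_of_hasCompactSupport
    (HasCompactSupport.intro (isCompact_Icc (a := -(1 + |η|)) (b := 1 + |η|)) fun v hv => ?_)
  apply p.toFun_shell_eq_zero
  by_contra! h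
  exact hv ⟨(abs_lt.1 h).1.le, (abs_lt.1 h).2.le⟩

/-- The density generated by the profile where the potential well has depth `η`. -/
def reach (p : EnergyProfile) (η : ℝ) : ℝ := ∫ v : ℝ, p.toFun (η - v ^ 2 / 2)

lemma reach_nonneg (p : EnergyProfile) (η : ℝ) : 0 ≤ p.reach η :=
  integral_nonneg fun _ => p.toFun_nonneg _

lemma monotone_reach (p : EnergyProfile) : Monotone p.reach := fun a b hab =>
  integral_mono (p.integrable_toFun_shell a) (p.integrable_toFun_shell b) fun v =>
    p.monotone_toFun (by linarith)

lemma continuous_reach (p : EnergyProfile) : Continuous p.reach := by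
  refine continuous_iff_continuousAt.2 fun η₀ => ?_
  refine continuousAt_of_dominated (bound := fun v => p.toFun (η₀ + 1 - v ^ 2 / 2))
    (Eventually.of_forall fun η => (p.continuous_toFun_shell η).aestronglyMeasurable) ?_
    (p.integrable_toFun_shell _) (Eventually.of_forall fun v => ?_)
  · filter_upwards [gt_mem_nhds (show η₀ < η₀ + 1 by linarith)] with η hη
    refine Eventually.of_forall fun v => ?_
    rw [Real.norm_of_nonneg (p.toFun_nonneg _)]
    exact p.monotone_toFun (by linarith)
  · exact (p.continuous_toFun.comp (by fun_prop)).continuousAt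

lemma setOf_shell (η : ℝ) : {v : ℝ | v ^ 2 / 2 < η} = Ioo (-√(2 * η)) √(2 * η) := by
  ext v
  rw [mem_ofPred_eq, mem_Ioo, ← abs_lt, Real.lt_sqrt (abs_nonneg v), sq_abs]
  constructor <;> intro h <;> linarith

/-- Integration by parts: the `v`-derivative of `p.toFun (η - v² / 2)` is `-v` times the rate. On
the phase space this becomes the bound of `∫ v₁² |φ'| dv` by `ρ₀`. The computation is done on `[-b,
b]` strictly inside the shell, because the rate may be singular at its edge. -/
lemma lintegral_sq_mul_rate_le (p : EnergyProfile) (η : ℝ) :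
    ∫⁻ v in {v : ℝ | v ^ 2 / 2 < η}, ENNReal.ofReal (v ^ 2 * p.rate (η - v ^ 2 / 2))
      ≤ ENNReal.ofReal (p.reach η) := by
  have key : ∀ b : ℝ, 0 ≤ b → b ^ 2 / 2 < η →
      ∫⁻ v in Ioc (-b) b, ENNReal.ofReal (v ^ 2 * p.rate (η - v ^ 2 / 2))
        ≤ ENNReal.ofReal (p.reach η) := by
    intro b hb hbη
    have hin : ∀ v ∈ Icc (-b) b, 0 < η - v ^ 2 / 2 := fun v hv => by
      have : v ^ 2 ≤ b ^ 2 := sq_le_sq' hv.1 hv.2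
      linarith
    have hle : -b ≤ b := by linarith
    have hcont : ContinuousOn (fun v => v ^ 2 * p.rate (η - v ^ 2 / 2)) (Icc (-b) b) :=
      ContinuousOn.mul (by fun_prop)
        (p.continuousOn_rate.comp (by fun_prop) fun v hv => hin v hv)
    have hcont' : ContinuousOn (fun v => v ^ 2 * p.rate (η - v ^ 2 / 2)
        - p.toFun (η - v ^ 2 / 2)) (Icc (-b) b) :=
      hcont.sub (p.continuous_toFun_shell η).continuousOn
    have hI := hcont.integrableOn_Icc (μ := volume)
    rw [← ofReal_integral_eq_lintegral_ofReal (hI.mono_set Ioc_subset_Icc_self)]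
    · apply ENNReal.ofReal_le_ofReal
      have hftc : ∫ v in (-b)..b, (v ^ 2 * p.rate (η - v ^ 2 / 2) - p.toFun (η - v ^ 2 / 2))
          = -b * p.toFun (η - b ^ 2 / 2) - -(-b) * p.toFun (η - (-b) ^ 2 / 2) := by
        refine intervalIntegral.integral_eq_sub_of_hasDerivAt
          (f := fun v => -v * p.toFun (η - v ^ 2 / 2)) (fun v hv => ?_) ?_
        · rw [uIcc_of_le hle] at hv
          have h1 : HasDerivAt (fun v : ℝ => η - v ^ 2 / 2) (-v) v := by
            have := ((hasDerivAt_pow 2 v).div_const 2).const_sub η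
            convert! this using 1
            simp
          have h2 := ((hasDerivAt_id v).neg).mul
            ((p.hasDerivAt_toFun (hin v hv)).comp v h1)
          convert! h2 using 1
          simp only [Function.comp, Pi.neg_apply, id]
          ring
        · exact hcont'.intervalIntegrable_of_Icc hle
      rw [intervalIntegral.integral_sub (hcont.intervalIntegrable_of_Icc hle)
        ((p.continuous_toFun_shell η).intervalIntegrable _ _)] at hftc
      rw [← intervalIntegral.integral_of_le hle]
      have h3 : ∫ v in (-b)..b, p.toFun (η - v ^ 2 / 2) ≤ p.reach η := by
        rw [intervalIntegral.integral_of_le hle]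
        exact setIntegral_le_integral (p.integrable_toFun_shell η)
          (Eventually.of_forall fun _ => p.toFun_nonneg _)
      -- The boundary terms enter with a favourable sign and are dropped.
      have h4 : 0 ≤ b * p.toFun (η - b ^ 2 / 2) := mul_nonneg hb (p.toFun_nonneg _)
      have h5 : 0 ≤ b * p.toFun (η - (-b) ^ 2 / 2) := mul_nonneg hb (p.toFun_nonneg _)
      linarith
    · refine (ae_restrict_mem measurableSet_Ioc).mono fun v hv => ?_
      exact mul_nonneg (sq_nonneg _) (p.rate_pos (hin v (Ioc_subset_Icc_self hv))).le
  rcases le_or_gt η 0 with hη | hη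
  · have : {v : ℝ | v ^ 2 / 2 < η} = ∅ := by
      ext v; simp only [mem_ofPred_eq, mem_empty_iff_false, iff_false, not_lt]
      nlinarith [sq_nonneg v]
    simp [this]
  · set a := √(2 * η) with ha
    have ha2 : a ^ 2 = 2 * η := Real.sq_sqrt (by positivity)
    have ha0 : 0 < a := Real.sqrt_pos.2 (by positivity)
    -- The half-widths `a - a / (n + 1)` increase to `a`, starting from the empty interval at `n =
    -- 0`, so monotone convergence carries the bound to the whole shell.
    have hU : {v : ℝ | v ^ 2 / 2 < η} = ⋃ n : ℕ, Ioc (-(a - a / (n + 1))) (a - a / (n + 1)) := by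
      rw [setOf_shell]
      ext v
      simp only [mem_iUnion, mem_Ioo, mem_Ioc, ← ha]
      constructor
      · rintro ⟨h1, h2⟩
        have hv : 0 < a - |v| := by
          rw [sub_pos, abs_lt]; exact ⟨h1, h2⟩
        obtain ⟨n, hn⟩ := exists_nat_gt (a / (a - |v|))
        refine ⟨n, ?_⟩
        have h3 : a / (n + 1) < a - |v| := by
          rw [div_lt_iff₀ hv] at hn
          rw [div_lt_iff₀ (by positivity)]
          nlinarith
        have := abs_lt.1 (show |v| < a - a / (n + 1) by linarith)
        exact ⟨this.1, this.2.le⟩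
      · rintro ⟨n, h1, h2⟩
        have : 0 < a / (n + 1) := by positivity
        constructor <;> linarith
    rw [hU, setLIntegral_iUnion_of_directed]
    · refine iSup_le fun n => key _ ?_ ?_
      · rw [sub_nonneg]
        exact div_le_self ha0.le (by linarith [n.cast_nonneg (α := ℝ)])
      · have h1 : 0 < a / (n + 1) := by positivity
        have h2 : 0 ≤ a - a / (n + 1) := by
          rw [sub_nonneg]
          exact div_le_self ha0.le (by linarith [n.cast_nonneg (α := ℝ)])
        nlinarith
    · refine Monotone.directed_le fun m n hmn => ?_
      have : a / (n + 1) ≤ a / (m + 1) := by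
        gcongr
      exact Ioc_subset_Ioc (by linarith) (by linarith)

/-- With `a = √(2η)` one has `η - v² / 2 = (a + v) (a - v) / 2`, and for each `v` one of the factors
is at least `a`. The negative power `κ - 1` is thus bounded by a sum of two integrable powers, and
the integral scales like `a ^ (2κ - 1)`. It stays bounded as `a → 0` because `κ > 1/2`; this is the
role of the restriction `k > 1/2`. -/
lemma exists_lintegral_rate_le (p : EnergyProfile) (M : ℝ) : ∃ C : ℝ, ∀ η ≤ M,
    ∫⁻ v in {v : ℝ | v ^ 2 / 2 < η}, ENNReal.ofReal (p.rate (η - v ^ 2 / 2))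
      ≤ ENNReal.ofReal C := by
  obtain ⟨κ, C, hκ, hκ1, hC, hr⟩ := p.exists_rate_le M
  have hκ0 : 0 < κ := by linarith
  refine ⟨C * (1 / 2) ^ (κ - 1) * (2 * (2 ^ κ / κ)) * (√(2 * M)) ^ (2 * κ - 1), fun η hη => ?_⟩
  rcases le_or_gt η 0 with hη0 | hη0
  · have : {v : ℝ | v ^ 2 / 2 < η} = ∅ := by
      ext v; simp only [mem_ofPred_eq, mem_empty_iff_false, iff_false, not_lt]
      nlinarith [sq_nonneg v]
    simp [this]
  set a := √(2 * η) with ha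
  have ha2 : a ^ 2 = 2 * η := Real.sq_sqrt (by positivity)
  have ha0 : 0 < a := Real.sqrt_pos.2 (by positivity)
  have haM : a ≤ √(2 * M) := Real.sqrt_le_sqrt (by linarith)
  have i1 : IntervalIntegrable (fun t : ℝ => t ^ (κ - 1)) volume 0 (2 * a) :=
    intervalIntegral.intervalIntegrable_rpow' (by linarith)
  have e1 : ∫ t in (0 : ℝ)..(2 * a), t ^ (κ - 1) = (2 * a) ^ κ / κ := by
    rw [integral_rpow (Or.inl (by linarith))]
    simp [zero_rpow hκ0.ne']
  have i2 : IntervalIntegrable (fun v : ℝ => (a + v) ^ (κ - 1)) volume (-a) a := by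
    have := i1.comp_add_left a
    convert! this using 1 <;> ring
  have e2 : ∫ v in (-a)..a, (a + v) ^ (κ - 1) = (2 * a) ^ κ / κ := by
    rw [← e1, intervalIntegral.integral_comp_add_left (fun t => t ^ (κ - 1))]
    congr 1 <;> ring
  have i3 : IntervalIntegrable (fun v : ℝ => (a - v) ^ (κ - 1)) volume (-a) a := by
    have := (i1.comp_sub_left a).symm
    convert! this using 1 <;> ring
  have e3 : ∫ v in (-a)..a, (a - v) ^ (κ - 1) = (2 * a) ^ κ / κ := by
    rw [← e1, intervalIntegral.integral_comp_sub_left (fun t => t ^ (κ - 1))]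
    congr 1 <;> ring
  have hle : -a ≤ a := by linarith
  set F : ℝ → ℝ := fun v => C * (a / 2) ^ (κ - 1) * ((a + v) ^ (κ - 1) + (a - v) ^ (κ - 1)) with hF
  have iF : IntervalIntegrable F volume (-a) a := (i2.add i3).const_mul _
  rw [setOf_shell]
  calc ∫⁻ v in Ioo (-a) a, ENNReal.ofReal (p.rate (η - v ^ 2 / 2))
      ≤ ∫⁻ v in Ioo (-a) a, ENNReal.ofReal (F v) := by
        refine setLIntegral_mono' measurableSet_Ioo fun v hv => ENNReal.ofReal_le_ofReal ?_
        have hp : 0 < a + v := by linarith [hv.1]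
        have hm : 0 < a - v := by linarith [hv.2]
        have hfac : η - v ^ 2 / 2 = (a + v) * (a - v) / 2 := by nlinarith
        have h0 : 0 < η - v ^ 2 / 2 := by rw [hfac]; positivity
        refine (hr _ h0 (by nlinarith [sq_nonneg v])).trans ?_
        rw [hF]
        simp only
        rw [mul_assoc]
        refine mul_le_mul_of_nonneg_left ?_ hC
        have hneg : κ - 1 ≤ 0 := by linarith
        rcases le_total 0 v with h | h
        · calc (η - v ^ 2 / 2) ^ (κ - 1) ≤ (a / 2 * (a - v)) ^ (κ - 1) := by
                apply rpow_le_rpow_of_nonpos (by positivity) _ hneg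
                rw [hfac]; nlinarith
            _ = (a / 2) ^ (κ - 1) * (a - v) ^ (κ - 1) := mul_rpow (by positivity) hm.le
            _ ≤ _ := by
                gcongr
                linarith [rpow_nonneg hp.le (κ - 1)]
        · calc (η - v ^ 2 / 2) ^ (κ - 1) ≤ (a / 2 * (a + v)) ^ (κ - 1) := by
                apply rpow_le_rpow_of_nonpos (by positivity) _ hneg
                rw [hfac]; nlinarith
            _ = (a / 2) ^ (κ - 1) * (a + v) ^ (κ - 1) := mul_rpow (by positivity) hp.le
            _ ≤ _ := by
                gcongr
                linarith [rpow_nonneg hm.le (κ - 1)]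
    _ = ∫⁻ v in Ioc (-a) a, ENNReal.ofReal (F v) := by
        rw [restrict_Ioo_eq_restrict_Ioc]
    _ = ENNReal.ofReal (∫ v in (-a)..a, F v) := by
        rw [intervalIntegral.integral_of_le hle, ofReal_integral_eq_lintegral_ofReal]
        · exact (intervalIntegrable_iff_integrableOn_Ioc_of_le hle).1 iF
        · refine (ae_restrict_mem measurableSet_Ioc).mono fun v hv => ?_
          have hp : 0 ≤ a + v := by linarith [hv.1]
          have hm : 0 ≤ a - v := by linarith [hv.2]
          simp only [hF, Pi.zero_apply]
          positivity
    _ ≤ _ := by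
        apply ENNReal.ofReal_le_ofReal
        have : ∫ v in (-a)..a, F v
            = C * (1 / 2) ^ (κ - 1) * (2 * (2 ^ κ / κ)) * a ^ (2 * κ - 1) := by
          simp only [hF]
          rw [intervalIntegral.integral_const_mul, intervalIntegral.integral_add i2 i3, e2, e3,
            mul_rpow (by norm_num) ha0.le, show a / 2 = 1 / 2 * a by ring,
            mul_rpow (by norm_num) ha0.le,
            show 2 * κ - 1 = (κ - 1) + κ by ring, rpow_add ha0]
          ring
        rw [this]
        gcongr
        linarith

end EnergyProfile

/-! ### One-dimensional potentials and the regularity, symmetry and convexity of `U₀`. -/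

lemma hasDerivAt_planarPotential {ρ : ℝ → ℝ} {x : ℝ} (hρ : Integrable ρ)
    (hx : Integrable fun y => |x - y| * ρ y) :
    HasDerivAt (planarPotential ρ) (2 * π * (2 * (∫ y in Iic x, ρ y) - ∫ y, ρ y)) x := by
  have hsm : Measurable fun y : ℝ => if y ≤ x then (1 : ℝ) else -1 :=
    Measurable.ite measurableSet_Iic measurable_const measurable_const
  -- The kernel `|t - y|` is 1-Lipschitz in `t`, and differentiable at `t = x` except for the null
  -- set `y = x`; the value given to the sign there is immaterial.
  have key := hasDerivAt_integral_of_dominated_loc_of_lip (μ := volume)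
    (F := fun t y => |t - y| * ρ y) (F' := fun y => (if y ≤ x then 1 else -1) * ρ y)
    (bound := fun y => |ρ y|) (s := univ) (x₀ := x) univ_mem
    (Eventually.of_forall fun t =>
      (by fun_prop : Continuous fun y => |t - y|).aestronglyMeasurable.mul hρ.1) hx
    (hsm.aestronglyMeasurable.mul hρ.1)
    (Eventually.of_forall fun y => LipschitzOnWith.of_dist_le_mul fun s _ t _ => by
      rw [Real.dist_eq, Real.dist_eq, ← sub_mul, abs_mul, mul_comm]
      simp only [Real.coe_nnabs, abs_abs]
      refine mul_le_mul_of_nonneg_left ?_ (abs_nonneg _)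
      refine (abs_abs_sub_abs_le _ _).trans_eq ?_
      congr 1; ring) hρ.abs (by
        filter_upwards [compl_mem_ae_iff.2 (measure_singleton x)] with y hy
        have hy : y ≠ x := hy
        refine HasDerivAt.mul_const ?_ _
        rcases lt_or_gt_of_ne hy with h | h
        · rw [if_pos h.le]
          refine (hasDerivAt_abs_pos (sub_pos.2 h)).comp_sub_const x y
        · rw [if_neg (not_le.2 h)]
          refine (hasDerivAt_abs_neg (sub_neg.2 h)).comp_sub_const x y)
  have h2 : ∫ y, (if y ≤ x then 1 else -1) * ρ y = 2 * (∫ y in Iic x, ρ y) - ∫ y, ρ y := by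
    rw [← integral_indicator measurableSet_Iic, ← integral_const_mul, ← integral_sub
      ((hρ.indicator measurableSet_Iic).const_mul 2) hρ]
    refine integral_congr_ae (Eventually.of_forall fun y => ?_)
    simp only [indicator, mem_Iic]
    split_ifs <;> ring
  rw [← h2]
  exact key.2.const_mul _

namespace PlanarData

lemma ρ₀_eq (S : PlanarData) (hβ : ∫ w, S.β w = 1) (x : ℝ) :
    S.ρ₀ x = S.profile.reach (S.E₀ - S.U₀ x) := by
  have : S.ρ₀ x = ∫ v : ℝ × (ℝ × ℝ),
      S.profile.toFun (S.E₀ - S.U₀ x - v.1 ^ 2 / 2) * S.β v.2 := by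
    refine integral_congr_ae (Eventually.of_forall fun v => ?_)
    simp only [f₀, φ, α, energy]
    congr 2; ring
  rw [this, Measure.volume_eq_prod, integral_prod_mul
    (fun v : ℝ => S.profile.toFun (S.E₀ - S.U₀ x - v ^ 2 / 2)) S.β, hβ, mul_one]
  rfl

namespace IsSteadyState

variable {S : PlanarData} (hS : S.IsSteadyState)
include hS

lemma ρ₀_eq (x : ℝ) : S.ρ₀ x = S.profile.reach (S.E₀ - S.U₀ x) :=
  S.ρ₀_eq hS.β_integral x

lemma U₀_eq : S.U₀ = planarPotential S.ρ₀ := funext hS.poisson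

lemma hasDerivAt_U₀_aux (x : ℝ) :
    HasDerivAt S.U₀ (2 * π * (2 * (∫ y in Iic x, S.ρ₀ y) - ∫ y, S.ρ₀ y)) x := by
  rw [hS.U₀_eq]
  exact hasDerivAt_planarPotential hS.integrable (hS.integrable_potential x)

lemma hasDerivAt_U₀ (x : ℝ) : HasDerivAt S.U₀ (deriv S.U₀ x) x :=
  (hS.hasDerivAt_U₀_aux x).differentiableAt.hasDerivAt

lemma continuous_U₀ : Continuous S.U₀ :=
  continuous_iff_continuousAt.2 fun x => (hS.hasDerivAt_U₀ x).continuousAt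

/-- A bootstrap: integrability of the density already makes `U₀` differentiable, and the density is
a continuous function of `U₀`. This in turn gives `U₀'' = 4π ρ₀` in the classical sense. -/
lemma continuous_ρ₀ : Continuous S.ρ₀ := by
  rw [funext hS.ρ₀_eq]
  exact S.profile.continuous_reach.comp (continuous_const.sub hS.continuous_U₀)

lemma ρ₀_nonneg (x : ℝ) : 0 ≤ S.ρ₀ x := by
  rw [hS.ρ₀_eq]; exact S.profile.reach_nonneg _

lemma hasDerivAt_deriv_U₀ (x : ℝ) : HasDerivAt (deriv S.U₀) (4 * π * S.ρ₀ x) x := by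
  have h : deriv S.U₀ = fun x => 2 * π * (2 * (∫ y in Iic x, S.ρ₀ y) - ∫ y, S.ρ₀ y) :=
    funext fun x => (hS.hasDerivAt_U₀_aux x).deriv
  rw [h]
  have h1 : HasDerivAt (fun x => ∫ y in Iic x, S.ρ₀ y) (S.ρ₀ x) x := by
    have h2 : (fun x => ∫ y in Iic x, S.ρ₀ y)
        = fun x => (∫ y in Iic 0, S.ρ₀ y) + ∫ y in (0 : ℝ)..x, S.ρ₀ y := by
      funext t
      rw [← intervalIntegral.integral_Iic_sub_Iic hS.integrable.integrableOn
        hS.integrable.integrableOn]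
      ring
    rw [h2]
    exact (intervalIntegral.integral_hasDerivAt_right (hS.integrable.intervalIntegrable)
      hS.continuous_ρ₀.stronglyMeasurable.stronglyMeasurableAtFilter
      hS.continuous_ρ₀.continuousAt).const_add _
  have h3 := ((h1.const_mul 2).sub_const (∫ y, S.ρ₀ y)).const_mul (2 * π)
  convert! h3 using 1
  ring

lemma continuous_deriv_U₀ : Continuous (deriv S.U₀) :=
  continuous_iff_continuousAt.2 fun x => (hS.hasDerivAt_deriv_U₀ x).continuousAt

lemma contDiff_deriv_U₀ : ContDiff ℝ 1 (deriv S.U₀) := by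
  rw [contDiff_one_iff_deriv]
  refine ⟨fun x => (hS.hasDerivAt_deriv_U₀ x).differentiableAt, ?_⟩
  rw [funext fun x => (hS.hasDerivAt_deriv_U₀ x).deriv]
  exact continuous_const.mul hS.continuous_ρ₀

lemma contDiff_U₀ : ContDiff ℝ 1 S.U₀ := by
  rw [contDiff_one_iff_deriv]
  exact ⟨fun x => (hS.hasDerivAt_U₀ x).differentiableAt, hS.continuous_deriv_U₀⟩

lemma ρ₀_neg (x : ℝ) : S.ρ₀ (-x) = S.ρ₀ x := by
  have h : ∀ y, S.ρ₀ y = ∫ v : ℝ × (ℝ × ℝ), S.f₀ (y, -v.1, v.2) := fun y => by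
    simp only [ρ₀, f₀, energy, neg_sq]
  rw [h (-x)]
  simp only [hS.symm]
  rfl

lemma U₀_neg (x : ℝ) : S.U₀ (-x) = S.U₀ x := by
  rw [hS.poisson, hS.poisson, planarPotential, planarPotential,
    ← integral_neg_eq_self (fun y => |x - y| * S.ρ₀ y)]
  congr 2
  funext y
  rw [hS.ρ₀_neg, ← abs_neg]
  congr 2; ring

lemma deriv_U₀_neg (x : ℝ) : deriv S.U₀ (-x) = -deriv S.U₀ x := by
  have h := (hS.hasDerivAt_U₀ (-x)).comp x (hasDerivAt_neg x)
  have h2 : S.U₀ ∘ Neg.neg = S.U₀ := funext hS.U₀_neg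
  rw [h2] at h
  rw [h.deriv]; ring

lemma deriv_U₀_zero : deriv S.U₀ 0 = 0 := by
  have := hS.deriv_U₀_neg 0
  rw [neg_zero] at this
  linarith

lemma deriv_U₀_eq (x : ℝ) : deriv S.U₀ x = ∫ y in (0 : ℝ)..x, 4 * π * S.ρ₀ y := by
  rw [intervalIntegral.integral_eq_sub_of_hasDerivAt (f := deriv S.U₀)
    (fun y _ => hS.hasDerivAt_deriv_U₀ y)
    ((continuous_const.mul hS.continuous_ρ₀).intervalIntegrable _ _), hS.deriv_U₀_zero, sub_zero]

lemma monotone_deriv_U₀ : Monotone (deriv S.U₀) :=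
  monotone_of_deriv_nonneg (fun x => (hS.hasDerivAt_deriv_U₀ x).differentiableAt) fun x => by
    rw [(hS.hasDerivAt_deriv_U₀ x).deriv]
    exact mul_nonneg (by positivity) (hS.ρ₀_nonneg x)

lemma monotoneOn_U₀ : MonotoneOn S.U₀ (Ici 0) := by
  refine monotoneOn_of_deriv_nonneg (convex_Ici 0) hS.continuous_U₀.continuousOn
    (fun x _ => (hS.hasDerivAt_U₀ x).differentiableAt.differentiableWithinAt) fun x hx => ?_
  rw [interior_Ici] at hx
  rw [← hS.deriv_U₀_zero]
  exact hS.monotone_deriv_U₀ (le_of_lt hx)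

lemma U₀_zero_le (x : ℝ) : S.U₀ 0 ≤ S.U₀ x := by
  rcases le_total 0 x with h | h
  · exact hS.monotoneOn_U₀ self_mem_Ici h h
  · rw [← hS.U₀_neg x]
    exact hS.monotoneOn_U₀ self_mem_Ici (mem_Ici.2 (by linarith)) (by linarith)

lemma ρ₀_le (x : ℝ) : S.ρ₀ x ≤ S.ρ₀ 0 := by
  rw [hS.ρ₀_eq, hS.ρ₀_eq]
  exact S.profile.monotone_reach (by linarith [hS.U₀_zero_le x])

lemma ρ₀_zero_pos : 0 < S.ρ₀ 0 := by
  by_contra! h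
  have : ∀ x, S.ρ₀ x = 0 := fun x => le_antisymm ((hS.ρ₀_le x).trans h) (hS.ρ₀_nonneg x)
  have h2 := hS.mass_pos
  simp [this] at h2

/-- The potential grows linearly: `U₀(x) ≥ 2π (|x| M - m)`, where `M > 0` is the mass and `m` the
first moment. -/
lemma exists_radius : ∃ R, 0 < R ∧ ∀ x, S.U₀ x < S.E₀ → |x| ≤ R := by
  have hM := hS.mass_pos
  have h0 : Integrable fun y => |y| * S.ρ₀ y := by simpa using hS.integrable_potential 0
  set M := ∫ x, S.ρ₀ x
  set m := ∫ y, |y| * S.ρ₀ y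
  have hU : ∀ x, 2 * π * (|x| * M - m) ≤ S.U₀ x := fun x => by
    rw [hS.poisson, planarPotential]
    refine mul_le_mul_of_nonneg_left ?_ (by positivity)
    rw [← integral_const_mul, ← integral_sub (hS.integrable.const_mul _) h0]
    refine integral_mono ((hS.integrable.const_mul _).sub h0) (hS.integrable_potential x)
      fun y => ?_
    simp only [← sub_mul]
    exact mul_le_mul_of_nonneg_right (abs_sub_abs_le_abs_sub _ _) (hS.ρ₀_nonneg y)
  refine ⟨max 1 ((S.E₀ / (2 * π) + m) / M), by positivity, fun x hx => le_max_of_le_right ?_⟩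
  rw [le_div_iff₀ hM]
  have h1 := (hU x).trans hx.le
  have h2 : |x| * M - m ≤ S.E₀ / (2 * π) := by
    rw [le_div_iff₀ (by positivity)]; linarith
  linarith

/-- The source of the spectral gap. Near the origin `U₀'` grows at least linearly since `ρ₀(0) > 0`;
monotonicity of `U₀'` extends a linear bound to the whole support, and oddness covers `x < 0`. -/
lemma exists_mul_sq_le : ∃ c, 0 < c ∧ ∀ x, S.U₀ x < S.E₀ → c * x ^ 2 ≤ x * deriv S.U₀ x := by
  obtain ⟨R, hR, hR'⟩ := hS.exists_radius
  have hρ := hS.ρ₀_zero_pos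
  obtain ⟨δ, hδ, hδ'⟩ : ∃ δ > 0, ∀ y, |y| < δ → S.ρ₀ 0 / 2 < S.ρ₀ y := by
    have := hS.continuous_ρ₀.continuousAt.eventually
      (lt_mem_nhds (show S.ρ₀ 0 / 2 < S.ρ₀ 0 by linarith))
    obtain ⟨δ, hδ, h⟩ := Metric.eventually_nhds_iff.1 this
    exact ⟨δ, hδ, fun y hy => h (by simpa using hy)⟩
  have hlow : ∀ t, 0 ≤ t → t < δ → 2 * π * S.ρ₀ 0 * t ≤ deriv S.U₀ t := by
    intro t ht htδ
    rw [hS.deriv_U₀_eq]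
    have h1 : ∫ y in (0 : ℝ)..t, 2 * π * S.ρ₀ 0 ≤ ∫ y in (0 : ℝ)..t, 4 * π * S.ρ₀ y := by
      refine intervalIntegral.integral_mono_on ht (by simp)
        ((continuous_const.mul hS.continuous_ρ₀).intervalIntegrable _ _) fun y hy => ?_
      have h3 := hδ' y (by rw [abs_of_nonneg hy.1]; linarith [hy.2])
      nlinarith [pi_pos]
    rw [intervalIntegral.integral_const, smul_eq_mul, sub_zero] at h1
    linarith
  -- The contraction `x ↦ (τ / R) x` maps `[0, R]` into `[0, τ]`, where the bound near the origin
  -- applies, and does not increase `x`, so monotonicity of `U₀'` can be used.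
  set τ := min (δ / 2) R with hτ
  have hτ0 : 0 < τ := lt_min (by linarith) hR
  have hpos : ∀ x, 0 ≤ x → x ≤ R → 2 * π * S.ρ₀ 0 * (τ / R) * x ≤ deriv S.U₀ x := by
    intro x hx hxR
    have hxτ : τ / R * x ≤ τ := by
      calc τ / R * x ≤ τ / R * R := by gcongr
        _ = τ := by field_simp
    have hxx : τ / R * x ≤ x := mul_le_of_le_one_left hx ((div_le_one hR).2 (min_le_right _ _))
    have h2 : τ < δ := (min_le_left _ _).trans_lt (by linarith)
    rw [mul_assoc]
    exact (hlow (τ / R * x) (by positivity) (hxτ.trans_lt h2)).trans (hS.monotone_deriv_U₀ hxx)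
  refine ⟨2 * π * S.ρ₀ 0 * (τ / R), by positivity, fun x hx => ?_⟩
  have hxR := hR' x hx
  rcases le_total 0 x with h | h
  · rw [abs_of_nonneg h] at hxR
    nlinarith [hpos x h hxR]
  · rw [abs_of_nonpos h] at hxR
    have := hpos (-x) (by linarith) hxR
    rw [hS.deriv_U₀_neg] at this
    nlinarith

/-- `U₀'` is Lipschitz. -/
lemma abs_deriv_U₀_sub_le (x y : ℝ) :
    |deriv S.U₀ x - deriv S.U₀ y| ≤ 4 * π * S.ρ₀ 0 * |x - y| := by
  have := Convex.norm_image_sub_le_of_norm_hasDerivWithin_le (s := univ) (f := deriv S.U₀)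
    (C := 4 * π * S.ρ₀ 0) (x := y) (y := x)
    (fun z _ => (hS.hasDerivAt_deriv_U₀ z).hasDerivWithinAt) (fun z _ => by
      rw [Real.norm_of_nonneg (mul_nonneg (by positivity) (hS.ρ₀_nonneg z))]
      have := hS.ρ₀_le z
      gcongr) convex_univ (mem_univ _) (mem_univ _)
  simpa [Real.norm_eq_abs] using this

end IsSteadyState
end PlanarData

/-! ### Test functions, the weighted measure and the weak transport operator. -/

lemma ContinuousOn.continuous_mul_of_tsupport_subset {X : Type*} [TopologicalSpace X]
    {U : Set X} (hU : IsOpen U) {f g : X → ℝ} (hg : ContinuousOn g U) (hf : Continuous f)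
    (hs : tsupport f ⊆ U) : Continuous fun x => g x * f x := by
  refine continuous_of_tsupport fun x hx => ?_
  have hx' : x ∈ U := hs (tsupport_mul_subset_right hx)
  exact (hg.continuousAt (hU.mem_nhds hx')).mul hf.continuousAt

lemma contDiff_of_forall_mem_tsupport {E : Type*} [NormedAddCommGroup E] [NormedSpace ℝ E]
    {f : E → ℝ} (h : ∀ x ∈ tsupport f, ContDiffAt ℝ 1 f x) : ContDiff ℝ 1 f := by
  refine contDiff_iff_contDiffAt.2 fun x => ?_
  by_cases hx : x ∈ tsupport f
  · exact h x hx
  · exact contDiffAt_const.congr_of_eventuallyEq (notMem_tsupport_iff_eventuallyEq.1 hx)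

/-- Integration by parts against the constant `1`. Only the derivative in one direction is required,
so `f` may contain factors that are merely continuous in the other directions. -/
lemma integral_eq_zero_of_hasLineDerivAt {E : Type*} [NormedAddCommGroup E] [NormedSpace ℝ E]
    [MeasurableSpace E] [BorelSpace E] [FiniteDimensional ℝ E] {μ : Measure E}
    [μ.IsAddHaarMeasure] {f f' : E → ℝ} {v : E} (hf : Integrable f μ) (hf' : Integrable f' μ)
    (h : ∀ x, HasLineDerivAt ℝ f (f' x) x v) : ∫ x, f' x ∂μ = 0 := by
  have := integral_bilinear_hasLineDerivAt_right_eq_neg_left_of_integrable (μ := μ)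
    (f := fun _ => (1 : ℝ)) (f' := fun _ => 0) (g := f) (g' := f') (v := v)
    (B := ContinuousLinearMap.mul ℝ ℝ) (by simp) (by simpa using hf') (by simpa using hf)
    (fun x _ => (hasFDerivAt_const (1 : ℝ) x).hasLineDerivAt v) (fun x _ => h x)
  simpa using this

instance : (volume : Measure PlanarPhase).IsAddHaarMeasure :=
  have : (volume : Measure (ℝ × ℝ)).IsAddHaarMeasure :=
    inferInstanceAs (Measure.prod volume volume).IsAddHaarMeasure
  have : (volume : Measure (ℝ × (ℝ × ℝ))).IsAddHaarMeasure :=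
    inferInstanceAs (Measure.prod volume volume).IsAddHaarMeasure
  inferInstanceAs (Measure.prod volume volume).IsAddHaarMeasure

namespace PlanarData

variable (S : PlanarData)

/-- The depth `E₀ - E` of a phase space point below the cut-off energy. -/
def depth (z : PlanarPhase) : ℝ := S.E₀ - S.energy z.1 z.2.1

/-- `|φ'|` on `Ω₀`, extended by zero. -/
def slope (z : PlanarPhase) : ℝ :=
  S.Ω₀.indicator (fun z => S.profile.rate (S.depth z) * S.β z.2.2) z

/-- The characteristic vector field. -/
def field (z : PlanarPhase) : PlanarPhase := (z.2.1, -deriv S.U₀ z.1, 0)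

/-- The admissible test functions: `C¹` with compact support in `Ω₀`. -/
structure IsTest (ξ : PlanarPhase → ℝ) : Prop where
  contDiff : ContDiff ℝ 1 ξ
  compact : HasCompactSupport ξ
  subset : tsupport ξ ⊆ S.Ω₀

open Classical in
/-- The class in `H` of a square integrable function. -/
def toH (F : PlanarPhase → ℝ) : S.H :=
  if h : MemLp F 2 S.weightedMeasure then h.toLp F else 0

variable {S}

lemma coeFn_toH {F : PlanarPhase → ℝ} (h : MemLp F 2 S.weightedMeasure) :
    S.toH F =ᵐ[S.weightedMeasure] F := by
  rw [toH, dif_pos h]; exact h.coeFn_toLp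

lemma inner_eq (g h : S.H) : ⟪g, h⟫ = ∫ z, g z * h z ∂S.weightedMeasure := by
  rw [L2.inner_def]
  exact integral_congr_ae (Eventually.of_forall fun z => by simp [mul_comm])

lemma classicalTransport_eq (ξ : PlanarPhase → ℝ) (z : PlanarPhase) :
    S.classicalTransport ξ z = fderiv ℝ ξ z (S.field z) := rfl

lemma slope_of_notMem {z : PlanarPhase} (hz : z ∉ S.Ω₀) : S.slope z = 0 :=
  indicator_of_notMem hz _

lemma slope_of_mem {z : PlanarPhase} (hz : z ∈ S.Ω₀) :
    S.slope z = S.profile.rate (S.depth z) * S.β z.2.2 := indicator_of_mem hz _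

lemma classicalTransport_mul {f g : PlanarPhase → ℝ} {z : PlanarPhase}
    (hf : DifferentiableAt ℝ f z) (hg : DifferentiableAt ℝ g z) :
    S.classicalTransport (fun z => f z * g z) z
      = f z * S.classicalTransport g z + g z * S.classicalTransport f z := by
  rw [classicalTransport_eq, fderiv_fun_mul hf hg]
  simp [classicalTransport_eq]

lemma classicalTransport_congr {f g : PlanarPhase → ℝ} {z : PlanarPhase}
    (h : f =ᶠ[𝓝 z] g) : S.classicalTransport f z = S.classicalTransport g z := by
  rw [classicalTransport_eq, h.fderiv_eq, classicalTransport_eq]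

lemma tsupport_classicalTransport (ξ : PlanarPhase → ℝ) :
    tsupport (S.classicalTransport ξ) ⊆ tsupport ξ := by
  refine closure_minimal (fun z hz => ?_) (isClosed_tsupport _)
  by_contra h
  apply hz
  rw [classicalTransport_congr (notMem_tsupport_iff_eventuallyEq.1 h), classicalTransport_eq]
  simp

namespace IsTest

variable {ξ ζ : PlanarPhase → ℝ}

lemma transport_compact (hξ : S.IsTest ξ) : HasCompactSupport (S.classicalTransport ξ) :=
  hξ.compact.mono' ((subset_tsupport _).trans (tsupport_classicalTransport ξ))

lemma transport_subset (hξ : S.IsTest ξ) : tsupport (S.classicalTransport ξ) ⊆ S.Ω₀ :=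
  (tsupport_classicalTransport ξ).trans hξ.subset

lemma mul_left (hξ : S.IsTest ξ) (hf : ∀ z ∈ S.Ω₀, ContDiffAt ℝ 1 ζ z) :
    S.IsTest fun z => ζ z * ξ z where
  contDiff := contDiff_of_forall_mem_tsupport fun z hz =>
    (hf z (hξ.subset (tsupport_mul_subset_right hz))).mul hξ.contDiff.contDiffAt
  compact := hξ.compact.mul_left
  subset := tsupport_mul_subset_right.trans hξ.subset

lemma add (hξ : S.IsTest ξ) (hζ : S.IsTest ζ) : S.IsTest fun z => ξ z + ζ z where
  contDiff := hξ.contDiff.add hζ.contDiff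
  compact := hξ.compact.add hζ.compact
  subset := (tsupport_add _ _).trans (union_subset hξ.subset hζ.subset)

lemma const_mul (hξ : S.IsTest ξ) (c : ℝ) : S.IsTest fun z => c * ξ z :=
  hξ.mul_left fun _ _ => contDiffAt_const

lemma differentiable (hξ : S.IsTest ξ) : Differentiable ℝ ξ :=
  hξ.contDiff.differentiable one_ne_zero

end IsTest

namespace IsSteadyState

variable (hS : S.IsSteadyState)
include hS

lemma mem_Ω₀ {z : PlanarPhase} : z ∈ S.Ω₀ ↔ 0 < S.depth z ∧ 0 < S.β z.2.2 := by
  simp only [Ω₀, mem_ofPred_eq, f₀, φ, α, mul_ne_zero_iff]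
  refine and_congr ⟨fun h => ?_, fun h => (S.profile.toFun_pos h).ne'⟩
    ⟨fun h => (hS.β_nonneg _).lt_of_ne' h, fun h => h.ne'⟩
  by_contra! h'
  exact h (S.profile.toFun_of_nonpos h')

lemma contDiff_depth : ContDiff ℝ 1 S.depth := by
  have := hS.contDiff_U₀
  unfold depth energy
  fun_prop

lemma continuous_depth : Continuous S.depth := hS.contDiff_depth.continuous

lemma hasFDerivAt_depth_field (z : PlanarPhase) : fderiv ℝ S.depth z (S.field z) = 0 := by
  have h1 : HasFDerivAt (fun z : PlanarPhase => z.1)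
    (ContinuousLinearMap.fst ℝ ℝ (ℝ × (ℝ × ℝ))) z := hasFDerivAt_fst
  have h2 : HasFDerivAt (fun z : PlanarPhase => z.2.1)
    ((ContinuousLinearMap.fst ℝ ℝ (ℝ × ℝ)).comp (ContinuousLinearMap.snd ℝ ℝ (ℝ × (ℝ × ℝ)))) z :=
    hasFDerivAt_fst.comp z hasFDerivAt_snd
  have h3 := ((((h2.pow 2).const_mul (1 / 2)).add
    ((hS.hasDerivAt_U₀ z.1).comp_hasFDerivAt z h1))).const_sub S.E₀
  have h4 : S.depth = fun z => S.E₀ - ((1 / 2 * z.2.1 ^ 2) + (S.U₀ ∘ fun z => z.1) z) := by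
    funext z; simp only [depth, energy, Function.comp]; ring
  rw [h4]
  refine (congrArg (fun L : PlanarPhase →L[ℝ] ℝ => L (S.field z)) h3.fderiv).trans ?_
  simp [field]
  ring

lemma isOpen_Ω₀ : IsOpen S.Ω₀ := by
  have : S.Ω₀ = {z | 0 < S.depth z} ∩ {z | 0 < S.β z.2.2} := by
    ext z; exact hS.mem_Ω₀
  rw [this]
  exact (isOpen_lt continuous_const hS.continuous_depth).inter
    (isOpen_lt continuous_const (hS.β_continuous.comp (by fun_prop)))

lemma measurableSet_Ω₀ : MeasurableSet S.Ω₀ := hS.isOpen_Ω₀.measurableSet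

lemma abs_φ' {z : PlanarPhase} (hz : z ∈ S.Ω₀) :
    |S.φ' (S.energy z.1 z.2.1) z.2.2| = S.slope z := by
  obtain ⟨h1, h2⟩ := hS.mem_Ω₀.1 hz
  have h3 : HasDerivAt (fun e => S.φ e z.2.2)
      (S.profile.rate (S.depth z) * (-1) * S.β z.2.2) (S.energy z.1 z.2.1) :=
    ((S.profile.hasDerivAt_toFun h1).comp (S.energy z.1 z.2.1)
      ((hasDerivAt_id (S.energy z.1 z.2.1)).const_sub S.E₀)).mul_const (S.β z.2.2)
  rw [slope_of_mem hz, φ', h3.deriv, abs_mul, abs_mul, abs_of_pos h2,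
    abs_of_pos (S.profile.rate_pos h1)]
  simp

lemma slope_pos {z : PlanarPhase} (hz : z ∈ S.Ω₀) : 0 < S.slope z := by
  obtain ⟨h1, h2⟩ := hS.mem_Ω₀.1 hz
  rw [slope_of_mem hz]
  exact mul_pos (S.profile.rate_pos h1) h2

lemma slope_nonneg (z : PlanarPhase) : 0 ≤ S.slope z := by
  by_cases hz : z ∈ S.Ω₀
  · exact (hS.slope_pos hz).le
  · rw [slope_of_notMem hz]

lemma continuousOn_rate_depth : ContinuousOn (fun z => S.profile.rate (S.depth z)) S.Ω₀ :=
  S.profile.continuousOn_rate.comp hS.continuous_depth.continuousOn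
    fun _ hz => (hS.mem_Ω₀.1 hz).1

lemma continuousOn_slope : ContinuousOn S.slope S.Ω₀ :=
  (hS.continuousOn_rate_depth.mul
    (hS.β_continuous.comp (by fun_prop : Continuous fun z : PlanarPhase => z.2.2)).continuousOn).congr
    fun _ hz => slope_of_mem hz

lemma continuousOn_inv_slope : ContinuousOn (fun z => (S.slope z)⁻¹) S.Ω₀ :=
  hS.continuousOn_slope.inv₀ fun _ hz => (hS.slope_pos hz).ne'

lemma measurable_slope : Measurable S.slope := by
  classical
  have h : S.slope = S.Ω₀.piecewise S.slope 0 := by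
    funext z
    by_cases hz : z ∈ S.Ω₀
    · simp [hz]
    · simp [hz, slope_of_notMem hz]
  rw [h]
  exact hS.continuousOn_slope.measurable_piecewise continuousOn_const hS.measurableSet_Ω₀

lemma measurable_ofReal_inv_slope :
    Measurable fun z => ENNReal.ofReal (S.slope z)⁻¹ := hS.measurable_slope.inv.ennreal_ofReal

/-- The restriction to `Ω₀` is absorbed into the density: `slope` vanishes outside `Ω₀`, and the
inverse of `0` is `0`. -/
lemma weightedMeasure_eq :
    S.weightedMeasure = volume.withDensity fun z => ENNReal.ofReal (S.slope z)⁻¹ := by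
  rw [weightedMeasure, ← withDensity_indicator hS.measurableSet_Ω₀]
  congr 1
  funext z
  by_cases hz : z ∈ S.Ω₀
  · rw [indicator_of_mem hz, hS.abs_φ' hz, one_div]
  · rw [indicator_of_notMem hz, slope_of_notMem hz]; simp

lemma ae_weighted_iff {P : PlanarPhase → Prop} :
    (∀ᵐ z ∂S.weightedMeasure, P z) ↔ ∀ᵐ z, z ∈ S.Ω₀ → P z := by
  rw [hS.weightedMeasure_eq, ae_withDensity_iff hS.measurable_ofReal_inv_slope]
  refine eventually_congr (Eventually.of_forall fun z => ?_)
  have : ENNReal.ofReal (S.slope z)⁻¹ ≠ 0 ↔ z ∈ S.Ω₀ := by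
    constructor
    · intro h
      by_contra hz
      rw [slope_of_notMem hz] at h
      simp at h
    · intro hz
      simp [hS.slope_pos hz]
  rw [this]

lemma integral_weighted (F : PlanarPhase → ℝ) :
    ∫ z, F z ∂S.weightedMeasure = ∫ z, (S.slope z)⁻¹ * F z := by
  rw [hS.weightedMeasure_eq, integral_withDensity_eq_integral_toReal_smul
    hS.measurable_ofReal_inv_slope (by simp)]
  refine integral_congr_ae (Eventually.of_forall fun z => ?_)
  simp only [smul_eq_mul]
  rw [ENNReal.toReal_ofReal (inv_nonneg.2 (hS.slope_nonneg z))]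

lemma integrable_weighted {F : PlanarPhase → ℝ} :
    Integrable F S.weightedMeasure ↔ Integrable fun z => (S.slope z)⁻¹ * F z := by
  rw [hS.weightedMeasure_eq, integrable_withDensity_iff_integrable_smul'
    hS.measurable_ofReal_inv_slope (by simp)]
  refine integrable_congr (Eventually.of_forall fun z => ?_)
  simp only [smul_eq_mul]
  rw [ENNReal.toReal_ofReal (inv_nonneg.2 (hS.slope_nonneg z))]

lemma lintegral_weighted (F : PlanarPhase → ENNReal) :
    ∫⁻ z, F z ∂S.weightedMeasure = ∫⁻ z, ENNReal.ofReal (S.slope z)⁻¹ * F z := by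
  rw [hS.weightedMeasure_eq, lintegral_withDensity_eq_lintegral_mul_non_measurable _
    hS.measurable_ofReal_inv_slope (by simp)]
  rfl

/-- Continuous functions with compact support in `Ω₀`, times continuous functions on `Ω₀`. -/
lemma integrable_mul {f F : PlanarPhase → ℝ} (hf : ContinuousOn f S.Ω₀) (hF : Continuous F)
    (hc : HasCompactSupport F) (hs : tsupport F ⊆ S.Ω₀) : Integrable fun z => f z * F z :=
  (hf.continuous_mul_of_tsupport_subset hS.isOpen_Ω₀ hF hs).integrable_of_hasCompactSupport
    hc.mul_left

lemma memLp_of_continuous {F : PlanarPhase → ℝ} (hF : Continuous F)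
    (hc : HasCompactSupport F) (hs : tsupport F ⊆ S.Ω₀) : MemLp F 2 S.weightedMeasure := by
  rw [memLp_two_iff_integrable_sq hF.aestronglyMeasurable, hS.integrable_weighted]
  refine hS.integrable_mul hS.continuousOn_inv_slope (hF.pow 2) ?_ ?_
  · exact hc.comp_left (g := fun t : ℝ => t ^ 2) (by simp)
  · refine subset_trans ?_ hs
    simpa [sq] using tsupport_mul_subset_left (f := F) (g := F)

lemma continuous_field : Continuous S.field := by
  have := hS.continuous_deriv_U₀
  unfold field
  fun_prop

lemma continuous_transport {ξ : PlanarPhase → ℝ} (hξ : ContDiff ℝ 1 ξ) :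
    Continuous (S.classicalTransport ξ) :=
  (hξ.continuous_fderiv one_ne_zero).clm_apply hS.continuous_field

lemma memLp_test {ξ : PlanarPhase → ℝ} (hξ : S.IsTest ξ) : MemLp ξ 2 S.weightedMeasure :=
  hS.memLp_of_continuous hξ.contDiff.continuous hξ.compact hξ.subset

lemma memLp_transport {ξ : PlanarPhase → ℝ} (hξ : S.IsTest ξ) :
    MemLp (S.classicalTransport ξ) 2 S.weightedMeasure :=
  hS.memLp_of_continuous (hS.continuous_transport hξ.contDiff) hξ.transport_compact
    hξ.transport_subset

omit hS in
lemma inner_toH (g : S.H) {F : PlanarPhase → ℝ} (hF : MemLp F 2 S.weightedMeasure) :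
    ⟪g, S.toH F⟫ = ∫ z, g z * F z ∂S.weightedMeasure := by
  rw [inner_eq]
  refine integral_congr_ae ?_
  filter_upwards [coeFn_toH hF] with z hz
  rw [hz]

lemma hasTransport_iff {g h : S.H} : S.HasTransport g h ↔
    ∀ ξ, S.IsTest ξ → ⟪g, S.toH (S.classicalTransport ξ)⟫ = -⟪h, S.toH ξ⟫ := by
  constructor
  · intro H ξ hξ
    rw [inner_toH _ (hS.memLp_test hξ), inner_toH _ (hS.memLp_transport hξ)]
    exact H ξ hξ.contDiff hξ.compact hξ.subset
  · intro H ξ h1 h2 h3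
    have hξ : S.IsTest ξ := ⟨h1, h2, h3⟩
    rw [← inner_toH _ (hS.memLp_test hξ), ← inner_toH _ (hS.memLp_transport hξ)]
    exact H ξ hξ

lemma weightedMeasure_lt_top {K : Set PlanarPhase} (hKc : IsCompact K) (hK : K ⊆ S.Ω₀) :
    S.weightedMeasure K < ⊤ := by
  rw [hS.weightedMeasure_eq, withDensity_apply _ hKc.measurableSet]
  refine lt_of_le_of_lt ?_
    ((hS.continuousOn_inv_slope.mono hK).integrableOn_compact (μ := volume) hKc).2
  refine lintegral_mono fun z => ?_
  rw [← ofReal_norm]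
  exact ENNReal.ofReal_le_ofReal (le_abs_self _)

/-- Test functions are total in `H`. -/
lemma eq_zero_of_inner_test {u : S.H} (hu : ∀ ξ, S.IsTest ξ → ⟪u, S.toH ξ⟫ = 0) : u = 0 := by
  have key : ∀ᵐ z, z ∈ S.Ω₀ → (S.slope z)⁻¹ * u z = 0 := by
    -- The fundamental lemma of the calculus of variations on the open set `Ω₀`, applied to `u /
    -- |φ'|`; local integrability holds because the weighted measure is finite on compact subsets of
    -- `Ω₀`.
    refine hS.isOpen_Ω₀.ae_eq_zero_of_integral_contDiff_smul_eq_zero ?_ fun ξ h1 h2 h3 => ?_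
    · rw [locallyIntegrableOn_iff hS.isOpen_Ω₀.isLocallyClosed]
      intro K hK hKc
      have h1 : IntegrableOn u K S.weightedMeasure := by
        have hfin := hS.weightedMeasure_lt_top hKc hK
        have : IsFiniteMeasure (S.weightedMeasure.restrict K) := ⟨by simpa using hfin⟩
        exact ((Lp.memLp u).restrict K).integrable one_le_two
      have h2 : Integrable (K.indicator u) S.weightedMeasure :=
        h1.integrable_indicator hKc.measurableSet
      rw [hS.integrable_weighted] at h2
      rw [← integrable_indicator_iff hKc.measurableSet]
      refine h2.congr (Eventually.of_forall fun z => ?_)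
      by_cases hz : z ∈ K <;> simp [hz]
    · have hξ : S.IsTest ξ := ⟨h1.of_le (by exact_mod_cast le_top), h2, h3⟩
      have := hu ξ hξ
      rw [inner_toH _ (hS.memLp_test hξ), hS.integral_weighted] at this
      rw [← this]
      refine integral_congr_ae (Eventually.of_forall fun z => ?_)
      simp only [smul_eq_mul]; ring
  rw [Lp.eq_zero_iff_ae_eq_zero]
  refine hS.ae_weighted_iff.2 ?_
  filter_upwards [key] with z hz hzΩ
  have := hz hzΩ
  have h1 := hS.slope_pos hzΩ
  simpa [h1.ne'] using this

lemma hasTransport_unique {g h h' : S.H} (h1 : S.HasTransport g h) (h2 : S.HasTransport g h') :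
    h = h' := by
  rw [hS.hasTransport_iff] at h1 h2
  refine sub_eq_zero.1 (hS.eq_zero_of_inner_test fun ξ hξ => ?_)
  rw [inner_sub_left]
  linarith [h1 ξ hξ, h2 ξ hξ]

lemma transport_comp_depth {G : ℝ → ℝ} {z : PlanarPhase}
    (hG : DifferentiableAt ℝ G (S.depth z)) :
    S.classicalTransport (fun z => G (S.depth z)) z = 0 := by
  have h1 := hG.hasFDerivAt.comp z
    (hS.contDiff_depth.differentiable one_ne_zero z).hasFDerivAt
  rw [classicalTransport_eq, show fderiv ℝ (fun z => G (S.depth z)) z = _ from h1.fderiv]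
  simp [hS.hasFDerivAt_depth_field z]

lemma contDiffAt_inv_rate {z : PlanarPhase} (hz : z ∈ S.Ω₀) :
    ContDiffAt ℝ 1 (fun z => (S.profile.rate (S.depth z))⁻¹) z := by
  have h := (hS.mem_Ω₀.1 hz).1
  exact ((S.profile.contDiffAt_rate h).comp z hS.contDiff_depth.contDiffAt).inv
    (S.profile.rate_pos h).ne'

-- Used for coefficients containing `1 / β(v̄)`, which is not differentiable in general but constant
-- in the directions of `x` and `v₁`.
omit hS in
lemma hasLineDerivAt_mul_of_const {c ξ : PlanarPhase → ℝ} {z v : PlanarPhase}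
    (hξ : DifferentiableAt ℝ ξ z) (hc : ∀ t : ℝ, c (z + t • v) = c z) :
    HasLineDerivAt ℝ (fun z => c z * ξ z) (c z * fderiv ℝ ξ z v) z v := by
  have h := (hξ.hasFDerivAt.hasLineDerivAt v)
  unfold HasLineDerivAt at h ⊢
  simp only [hc]
  exact h.const_mul (c z)

/-- The classical transport operator has vanishing weighted mean on test functions. -/
lemma integral_transport_eq_zero {ζ : PlanarPhase → ℝ} (hζ : S.IsTest ζ) :
    ∫ z, S.classicalTransport ζ z ∂S.weightedMeasure = 0 := by
  -- The weight is the product of `1 / rate` and `1 / β`. The first factor is `C¹` and a function of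
  -- the energy, hence annihilated by `D`, and is moved into the test function; the second stays
  -- outside.
  have hξ : S.IsTest fun z => (S.profile.rate (S.depth z))⁻¹ * ζ z :=
    hζ.mul_left fun z hz => hS.contDiffAt_inv_rate hz
  set ξ := fun z => (S.profile.rate (S.depth z))⁻¹ * ζ z with hξdef
  have e1 : ∀ z, (S.slope z)⁻¹ * S.classicalTransport ζ z
      = (S.β z.2.2)⁻¹ * S.classicalTransport ξ z := by
    intro z
    by_cases hz : z ∈ S.Ω₀
    · rw [slope_of_mem hz, hξdef, classicalTransport_mul
        ((hS.contDiffAt_inv_rate hz).differentiableAt one_ne_zero) (hζ.differentiable z),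
        hS.transport_comp_depth (G := fun t => (S.profile.rate t)⁻¹), mul_inv]
      · ring
      · have h := (hS.mem_Ω₀.1 hz).1
        exact ((S.profile.contDiffAt_rate h).differentiableAt one_ne_zero).inv
          (S.profile.rate_pos h).ne'
    · rw [image_eq_zero_of_notMem_tsupport fun h => hz (hζ.transport_subset h),
        image_eq_zero_of_notMem_tsupport fun h => hz (hξ.transport_subset h)]
      simp
  rw [hS.integral_weighted, integral_congr_ae (Eventually.of_forall e1)]
  -- The vector field is divergence free componentwise: `c1` does not depend on `x`, and `c2` does
  -- not depend on `v₁`, so both directional derivatives integrate to zero.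
  set c1 : PlanarPhase → ℝ := fun z => (S.β z.2.2)⁻¹ * z.2.1 with hc1
  set c2 : PlanarPhase → ℝ := fun z => -((S.β z.2.2)⁻¹ * deriv S.U₀ z.1) with hc2
  have hβ : ContinuousOn (fun z : PlanarPhase => (S.β z.2.2)⁻¹) S.Ω₀ :=
    (hS.β_continuous.comp (by fun_prop : Continuous fun z : PlanarPhase => z.2.2)).continuousOn.inv₀
      fun z hz => ((hS.mem_Ω₀.1 hz).2).ne'
  have k1 : ContinuousOn c1 S.Ω₀ := hβ.mul (by fun_prop)
  have k2 : ContinuousOn c2 S.Ω₀ :=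
    (hβ.mul (hS.continuous_deriv_U₀.comp continuous_fst).continuousOn).neg
  have dint : ∀ (c : PlanarPhase → ℝ) (v : PlanarPhase), ContinuousOn c S.Ω₀ →
      Integrable fun z => c z * fderiv ℝ ξ z v := fun c v hc => by
    refine hS.integrable_mul hc ((hξ.contDiff.continuous_fderiv one_ne_zero).clm_apply
      continuous_const) ?_ ?_
    · exact hξ.compact.fderiv_apply ℝ v
    · refine (closure_minimal (fun z hz => ?_) (isClosed_tsupport _)).trans hξ.subset
      by_contra h
      apply hz
      simp [(notMem_tsupport_iff_eventuallyEq.1 h).fderiv_eq]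
  have z1 : ∫ z, c1 z * fderiv ℝ ξ z (1, 0, 0) = 0 :=
    integral_eq_zero_of_hasLineDerivAt (f := fun z => c1 z * ξ z) (v := ((1, 0, 0) : PlanarPhase))
      (hS.integrable_mul k1 hξ.contDiff.continuous hξ.compact hξ.subset)
      (dint _ _ k1) fun z => hasLineDerivAt_mul_of_const (hξ.differentiable z) (by simp [hc1])
  have z2 : ∫ z, c2 z * fderiv ℝ ξ z (0, 1, 0) = 0 :=
    integral_eq_zero_of_hasLineDerivAt (f := fun z => c2 z * ξ z) (v := ((0, 1, 0) : PlanarPhase))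
      (hS.integrable_mul k2 hξ.contDiff.continuous hξ.compact hξ.subset)
      (dint _ _ k2) fun z => hasLineDerivAt_mul_of_const (hξ.differentiable z) (by simp [hc2])
  have e2 : ∀ z, (S.β z.2.2)⁻¹ * S.classicalTransport ξ z
      = c1 z * fderiv ℝ ξ z (1, 0, 0) + c2 z * fderiv ℝ ξ z (0, 1, 0) := by
    intro z
    have : S.field z = z.2.1 • ((1, 0, 0) : PlanarPhase)
        + (-deriv S.U₀ z.1) • ((0, 1, 0) : PlanarPhase) := by
      simp [field]
    rw [classicalTransport_eq, this, map_add, map_smul, map_smul]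
    simp only [smul_eq_mul, hc1, hc2]
    ring
  rw [integral_congr_ae (Eventually.of_forall e2), integral_add (dint _ _ k1) (dint _ _ k2),
    z1, z2, add_zero]

/-- The product rule, together with the vanishing mean of `D (ξ ζ)`. -/
lemma hasTransport_toH {ξ : PlanarPhase → ℝ} (hξ : S.IsTest ξ) :
    S.HasTransport (S.toH ξ) (S.toH (S.classicalTransport ξ)) := by
  rw [hS.hasTransport_iff]
  intro ζ hζ
  rw [real_inner_comm, inner_toH _ (hS.memLp_test hξ), inner_toH _ (hS.memLp_test hζ),
    eq_neg_iff_add_eq_zero, ← integral_add]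
  · rw [← hS.integral_transport_eq_zero (hζ.mul_left (ζ := ξ) fun z _ => hξ.contDiff.contDiffAt)]
    refine integral_congr_ae ?_
    filter_upwards [coeFn_toH (hS.memLp_transport hξ), coeFn_toH (hS.memLp_transport hζ)]
      with z h1 h2
    rw [h1, h2, classicalTransport_mul (hξ.differentiable z) (hζ.differentiable z)]
    ring
  · exact (Lp.memLp _).integrable_mul (hS.memLp_test hξ)
  · exact (Lp.memLp _).integrable_mul (hS.memLp_test hζ)

end IsSteadyState
end PlanarData

/-! ### Mollification with bounds uniform in the scale. -/

section Mollifier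

variable {E : Type*} [NormedAddCommGroup E] [NormedSpace ℝ E] [FiniteDimensional ℝ E]
  [MeasurableSpace E] [BorelSpace E] (μ : Measure E) [μ.IsAddHaarMeasure]

/-- The smooth bump function on `E` that is rescaled to a mollifier. -/
def mollifierBump : ContDiffBump (0 : E) := ⟨1, 2, one_pos, one_lt_two⟩

/-- The standard mollifier, supported in the ball of radius `2 ε`. -/
def mollifier (ε : ℝ) (z : E) : ℝ :=
  ε⁻¹ ^ Module.finrank ℝ E * (mollifierBump (E := E)).normed μ (ε⁻¹ • z)

/-- The mollification of `u` at scale `2 ε`. -/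
def mollify (ε : ℝ) (u : E → ℝ) : E → ℝ :=
  convolution (mollifier μ ε) u (ContinuousLinearMap.mul ℝ ℝ) μ

variable {μ}

omit [BorelSpace E] [μ.IsAddHaarMeasure] in
lemma contDiff_mollifier (ε : ℝ) : ContDiff ℝ 1 (mollifier μ ε : E → ℝ) :=
  contDiff_const.mul ((mollifierBump (E := E)).contDiff_normed.comp (contDiff_const_smul ε⁻¹))

omit [BorelSpace E] [μ.IsAddHaarMeasure] in
lemma mollifier_nonneg {ε : ℝ} (hε : 0 < ε) (z : E) : 0 ≤ mollifier μ ε z :=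
  mul_nonneg (by positivity) (ContDiffBump.nonneg_normed _ _)

lemma mollifier_eq_zero {ε : ℝ} (hε : 0 < ε) {z : E} (hz : 2 * ε ≤ ‖z‖) :
    mollifier μ ε z = 0 := by
  have : ε⁻¹ • z ∉ Function.support ((mollifierBump (E := E)).normed μ) := by
    rw [ContDiffBump.support_normed_eq, mem_ball_zero_iff, norm_smul, norm_inv,
      Real.norm_of_nonneg hε.le, not_lt]
    change (2 : ℝ) ≤ _
    rw [inv_mul_eq_div, le_div_iff₀ hε]
    exact hz
  rw [mollifier, Function.notMem_support.1 this, mul_zero]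

lemma hasCompactSupport_mollifier {ε : ℝ} (hε : 0 < ε) :
    HasCompactSupport (mollifier μ ε : E → ℝ) :=
  HasCompactSupport.intro (isCompact_closedBall 0 (2 * ε)) fun z hz => mollifier_eq_zero hε (by
    rw [mem_closedBall_zero_iff, not_le] at hz; exact hz.le)

lemma fderiv_mollifier_eq_zero {ε : ℝ} (hε : 0 < ε) {z : E} (hz : 2 * ε < ‖z‖) :
    fderiv ℝ (mollifier μ ε) z = 0 := by
  have : mollifier μ ε =ᶠ[𝓝 z] fun _ => 0 := by
    filter_upwards [continuous_norm.continuousAt.eventually (lt_mem_nhds hz)] with y hy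
    exact mollifier_eq_zero hε (le_of_lt hy)
  rw [this.fderiv_eq]
  simp

lemma integral_mollifier {ε : ℝ} (hε : 0 < ε) : ∫ z, mollifier μ ε z ∂μ = 1 := by
  have h := (mollifierBump (E := E)).integral_normed (μ := μ)
  simp only [mollifier]
  rw [integral_const_mul, Measure.integral_comp_smul, h]
  have : 0 < ε⁻¹ ^ Module.finrank ℝ E := by positivity
  rw [smul_eq_mul, mul_one, abs_inv, abs_of_pos this, mul_inv_cancel₀ this.ne']

/-- The bounds follow by scaling. The extra factor `ε⁻¹` of the gradient is later compensated by the
Lipschitz bound of the characteristic field on the support of the mollifier. -/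
lemma exists_mollifier_bound (μ : Measure E) [μ.IsAddHaarMeasure] :
    ∃ C : ℝ, 0 ≤ C ∧ ∀ ε : ℝ, 0 < ε → ∀ z : E,
      mollifier μ ε z ≤ C * ε⁻¹ ^ Module.finrank ℝ E ∧
      ‖fderiv ℝ (mollifier μ ε) z‖ ≤ C * ε⁻¹ ^ Module.finrank ℝ E * ε⁻¹ := by
  set k := (mollifierBump (E := E)).normed μ with hk
  have hkc : HasCompactSupport k := ContDiffBump.hasCompactSupport_normed _
  have hkd : ContDiff ℝ 1 k := ContDiffBump.contDiff_normed _
  obtain ⟨C₀, h₀⟩ := hkc.exists_bound_of_continuous hkd.continuous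
  obtain ⟨C₁, h₁⟩ := (hkc.fderiv ℝ).exists_bound_of_continuous (hkd.continuous_fderiv one_ne_zero)
  refine ⟨max 0 (max C₀ C₁), le_max_left _ _, fun ε hε z => ⟨?_, ?_⟩⟩
  · rw [mollifier, mul_comm]
    gcongr
    exact (le_abs_self _).trans ((h₀ _).trans ((le_max_left _ _).trans (le_max_right _ _)))
  · have h2 := (((hkd.differentiable one_ne_zero (ε⁻¹ • z)).hasFDerivAt.comp z
      ((hasFDerivAt_id z).const_smul ε⁻¹)).const_mul (ε⁻¹ ^ Module.finrank ℝ E)).fderiv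
    have h3 : fderiv ℝ (mollifier μ ε) z = _ := h2
    rw [h3, norm_smul, Real.norm_of_nonneg (by positivity), ContinuousLinearMap.comp_smul,
      norm_smul, ContinuousLinearMap.comp_id, Real.norm_of_nonneg (by positivity)]
    have h4 := (h₁ (ε⁻¹ • z)).trans ((le_max_right C₀ C₁).trans (le_max_right 0 _))
    calc ε⁻¹ ^ Module.finrank ℝ E * (ε⁻¹ * ‖fderiv ℝ k (ε⁻¹ • z)‖)
        ≤ ε⁻¹ ^ Module.finrank ℝ E * (ε⁻¹ * max 0 (max C₀ C₁)) := by gcongr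
      _ = _ := by ring

lemma mollify_apply (ε : ℝ) (u : E → ℝ) (z : E) :
    mollify μ ε u z = ∫ y, mollifier μ ε (z - y) * u y ∂μ := by
  rw [mollify, convolution_eq_swap]; rfl

lemma contDiff_mollify {ε : ℝ} (hε : 0 < ε) {u : E → ℝ} (hu : Integrable u μ) :
    ContDiff ℝ 1 (mollify μ ε u) :=
  (hasCompactSupport_mollifier hε).contDiff_convolution_left (n := 1) _ (contDiff_mollifier ε)
    hu.locallyIntegrable

lemma fderiv_mollify {ε : ℝ} (hε : 0 < ε) {u : E → ℝ} (hu : Integrable u μ) (z b : E) :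
    fderiv ℝ (mollify μ ε u) z b = ∫ y, fderiv ℝ (mollifier μ ε) (z - y) b * u y ∂μ := by
  have h := (hasCompactSupport_mollifier (μ := μ) hε).hasFDerivAt_convolution_left
    (ContinuousLinearMap.mul ℝ ℝ) (contDiff_mollifier ε) hu.locallyIntegrable z
  rw [mollify, h.fderiv, convolution_eq_swap, ContinuousLinearMap.integral_apply]
  · rfl
  · have := ((hasCompactSupport_mollifier (μ := μ) hε).fderiv ℝ).convolutionExists_left
      ((ContinuousLinearMap.mul ℝ ℝ).precompL E)
      ((contDiff_mollifier ε).continuous_fderiv one_ne_zero) hu.locallyIntegrable z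
    exact this.integrable_swap

lemma mollify_eq_zero {ε : ℝ} (hε : 0 < ε) {u : E → ℝ} {K : Set E} (hu : ∀ z ∉ K, u z = 0)
    {z : E} (hz : z ∉ Metric.cthickening (2 * ε) K) : mollify μ ε u z = 0 := by
  rw [mollify_apply]
  refine integral_eq_zero_of_ae (Eventually.of_forall fun y => ?_)
  by_cases hy : y ∈ K
  · have : 2 * ε ≤ ‖z - y‖ := by
      by_contra! h
      exact hz (Metric.mem_cthickening_of_dist_le z y _ K hy (by rw [dist_eq_norm]; exact h.le))
    simp [mollifier_eq_zero hε this]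
  · simp [hu y hy]

/-- Weak convergence of mollifications. -/
lemma tendsto_integral_mollify_mul {u ψ : E → ℝ} (hu : Integrable u μ) (hψ : Continuous ψ)
    (hc : HasCompactSupport ψ) :
    Tendsto (fun ε => ∫ z, mollify μ ε u z * ψ z ∂μ) (𝓝[>] 0) (𝓝 (∫ z, u z * ψ z ∂μ)) := by
  have hψi : Integrable ψ μ := hψ.integrable_of_hasCompactSupport hc
  rw [Metric.tendsto_nhds]
  intro δ hδ
  set δ' := δ / (2 * ((∫ y, ‖u y‖ ∂μ) + 1)) with hδ'
  have hN : 0 ≤ ∫ y, ‖u y‖ ∂μ := integral_nonneg fun _ => norm_nonneg _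
  have hδ'0 : 0 < δ' := by positivity
  obtain ⟨r, hr, hψr⟩ := Metric.uniformContinuous_iff.1
    (hc.uniformContinuous_of_continuous hψ) δ' hδ'0
  filter_upwards [self_mem_nhdsWithin,
    mem_nhdsWithin_of_mem_nhds (gt_mem_nhds (show (0 : ℝ) < r / 2 by linarith))] with ε hε hεr
  have hε : 0 < ε := hε
  obtain ⟨C, hC, hb⟩ := exists_mollifier_bound μ
  have hmc : Continuous (mollifier μ ε : E → ℝ) := (contDiff_mollifier ε).continuous
  have hprod : Integrable (fun p : E × E => mollifier μ ε (p.1 - p.2) * u p.2 * ψ p.1)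
      (μ.prod μ) := by
    have h1 : Integrable (fun p : E × E => ψ p.1 * u p.2) (μ.prod μ) := hψi.mul_prod hu
    have h2 := h1.bdd_mul (f := fun p : E × E => mollifier μ ε (p.1 - p.2))
      (c := C * ε⁻¹ ^ Module.finrank ℝ E)
      (hmc.comp (continuous_fst.sub continuous_snd)).aestronglyMeasurable
      (Eventually.of_forall fun p => by
        rw [Real.norm_of_nonneg (mollifier_nonneg hε _)]; exact (hb ε hε _).1)
    refine h2.congr (Eventually.of_forall fun p => ?_)
    simp only; ring
  -- Fubini moves the mollifier onto `ψ`, whose averages converge uniformly by uniform continuity.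
  have e1 : ∫ z, mollify μ ε u z * ψ z ∂μ
      = ∫ y, (∫ z, mollifier μ ε (z - y) * ψ z ∂μ) * u y ∂μ := by
    calc ∫ z, mollify μ ε u z * ψ z ∂μ
        = ∫ z, ∫ y, mollifier μ ε (z - y) * u y * ψ z ∂μ ∂μ := by
          congr 1; funext z
          rw [mollify_apply, ← integral_mul_const]
      _ = ∫ y, ∫ z, mollifier μ ε (z - y) * u y * ψ z ∂μ ∂μ := integral_integral_swap hprod
      _ = _ := by
          congr 1; funext y
          rw [← integral_mul_const]
          congr 1; funext z; ring
  have hin : ∀ y, |(∫ z, mollifier μ ε (z - y) * ψ z ∂μ) - ψ y| ≤ δ' := by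
    intro y
    have i0 : Integrable (fun z => mollifier μ ε (z - y)) μ :=
      (hmc.integrable_of_hasCompactSupport (hasCompactSupport_mollifier hε)).comp_sub_right y
    have i1 : Integrable (fun z => mollifier μ ε (z - y) * ψ z) μ :=
      hψi.bdd_mul (c := C * ε⁻¹ ^ Module.finrank ℝ E)
        (hmc.comp (continuous_id.sub continuous_const)).aestronglyMeasurable
        (Eventually.of_forall fun p => by
          rw [Real.norm_of_nonneg (mollifier_nonneg hε _)]; exact (hb ε hε _).1)
    have i2 : ∫ z, mollifier μ ε (z - y) ∂μ = 1 := by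
      rw [integral_sub_right_eq_self (mollifier μ ε)]; exact integral_mollifier hε
    have e : (∫ z, mollifier μ ε (z - y) * ψ z ∂μ) - ψ y
        = ∫ z, mollifier μ ε (z - y) * (ψ z - ψ y) ∂μ := by
      simp only [mul_sub]
      rw [integral_sub i1 (i0.mul_const _), integral_mul_const, i2, one_mul]
    rw [e, ← Real.norm_eq_abs]
    refine (norm_integral_le_of_norm_le (i0.mul_const δ') (Eventually.of_forall fun z => ?_)).trans
      (by rw [integral_mul_const, i2, one_mul])
    rw [norm_mul, Real.norm_of_nonneg (mollifier_nonneg hε _)]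
    by_cases hz : 2 * ε ≤ ‖z - y‖
    · simp [mollifier_eq_zero hε hz]
    · refine mul_le_mul_of_nonneg_left ?_ (mollifier_nonneg hε _)
      have := hψr (a := z) (b := y) (by rw [dist_eq_norm]; linarith)
      rw [dist_eq_norm] at this
      exact this.le
  have hcont : Integrable (fun y => (∫ z, mollifier μ ε (z - y) * ψ z ∂μ) * u y) μ := by
    have := hprod.integral_prod_right
    refine this.congr (Eventually.of_forall fun y => ?_)
    simp only
    rw [← integral_mul_const]
    congr 1; funext z; ring
  obtain ⟨Cψ, hCψ⟩ := hc.exists_bound_of_continuous hψ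
  have hup : Integrable (fun y => u y * ψ y) μ := by
    refine (hu.bdd_mul (f := ψ) hψ.aestronglyMeasurable (Eventually.of_forall hCψ)).congr
      (Eventually.of_forall fun y => ?_)
    simp only; ring
  rw [Real.dist_eq, e1, ← integral_sub hcont hup, ← Real.norm_eq_abs]
  refine (norm_integral_le_of_norm_le (hu.norm.const_mul δ')
    (Eventually.of_forall fun y => ?_)).trans_lt ?_
  · rw [mul_comm (u y), ← sub_mul, norm_mul]
    exact mul_le_mul_of_nonneg_right (hin y) (norm_nonneg _)
  · rw [integral_const_mul, hδ', div_mul_eq_mul_div, div_lt_iff₀ (by positivity)]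
    nlinarith

/-- Averages over balls of a fixed radius are bounded in `L²`. -/
lemma lintegral_sq_le_of_le_average {ε C : ℝ} (hε : 0 < ε) {u F : E → ℝ}
    (hu : Measurable u)
    (hF : ∀ z, ‖F z‖ₑ ≤ ENNReal.ofReal (C * ε⁻¹ ^ Module.finrank ℝ E)
      * ∫⁻ y in Metric.closedBall z (2 * ε), ‖u y‖ₑ ∂μ) :
    ∫⁻ z, ‖F z‖ₑ ^ 2 ∂μ
      ≤ (ENNReal.ofReal C * μ (Metric.closedBall 0 2)) ^ 2 * ∫⁻ y, ‖u y‖ₑ ^ 2 ∂μ := by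
  set d := Module.finrank ℝ E
  set V := μ (Metric.closedBall (0 : E) (2 * ε)) with hV
  set c := ENNReal.ofReal (C * ε⁻¹ ^ d) with hc
  have hVz : ∀ z : E, μ (Metric.closedBall z (2 * ε)) = V := fun z =>
    Measure.addHaar_closedBall_center μ z _
  -- The volume of the ball scales like `ε ^ d` and cancels the height of the kernel; this makes the
  -- final bound independent of `ε`.
  have hcV : c * V = ENNReal.ofReal C * μ (Metric.closedBall 0 2) := by
    have h1 : V = ENNReal.ofReal (ε ^ d) * μ (Metric.closedBall 0 2) := by
      rw [hV, mul_comm 2 ε]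
      exact Measure.addHaar_closedBall_mul μ 0 hε.le (by norm_num)
    rw [h1, hc, ← mul_assoc, ENNReal.ofReal_mul' (by positivity), mul_assoc (ENNReal.ofReal C),
      ← ENNReal.ofReal_mul (by positivity), ← mul_pow, inv_mul_cancel₀ hε.ne', one_pow,
      ENNReal.ofReal_one, mul_one]
  have hue : Measurable fun y => ‖u y‖ₑ := hu.enorm
  -- Cauchy-Schwarz on each ball. Integrating over the centre and exchanging the integrals by
  -- Tonelli then produces a second factor `V`.
  have hCS : ∀ z, (∫⁻ y in Metric.closedBall z (2 * ε), ‖u y‖ₑ ∂μ) ^ 2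
      ≤ V * ∫⁻ y in Metric.closedBall z (2 * ε), ‖u y‖ₑ ^ 2 ∂μ := by
    intro z
    have h := ENNReal.lintegral_mul_le_Lp_mul_Lq (μ.restrict (Metric.closedBall z (2 * ε)))
      Real.HolderConjugate.two_two (f := fun _ => 1) (g := fun y => ‖u y‖ₑ)
      aemeasurable_const hue.aemeasurable
    simp only [Pi.mul_apply, lintegral_const, Measure.restrict_apply,
      MeasurableSet.univ, univ_inter, hVz, ENNReal.rpow_two, one_pow, one_mul] at h
    calc _ ≤ (V ^ (1 / 2 : ℝ) * (∫⁻ y in Metric.closedBall z (2 * ε), ‖u y‖ₑ ^ 2 ∂μ)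
          ^ (1 / 2 : ℝ)) ^ 2 := by gcongr
      _ = _ := by
        rw [mul_pow, ← ENNReal.rpow_natCast, ← ENNReal.rpow_natCast, ← ENNReal.rpow_mul,
          ← ENNReal.rpow_mul]
        norm_num
  have hset : MeasurableSet {p : E × E | p.2 ∈ Metric.closedBall p.1 (2 * ε)} :=
    measurableSet_le (f := fun p : E × E => dist p.2 p.1) (by fun_prop) measurable_const
  calc ∫⁻ z, ‖F z‖ₑ ^ 2 ∂μ
      ≤ ∫⁻ z, c ^ 2 * (V * ∫⁻ y in Metric.closedBall z (2 * ε), ‖u y‖ₑ ^ 2 ∂μ) ∂μ := by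
        refine lintegral_mono fun z => ?_
        calc ‖F z‖ₑ ^ 2 ≤ (c * ∫⁻ y in Metric.closedBall z (2 * ε), ‖u y‖ₑ ∂μ) ^ 2 := by
              gcongr; exact hF z
          _ ≤ _ := by rw [mul_pow]; gcongr; exact hCS z
    _ = ∫⁻ z, c ^ 2 * V * ∫⁻ y, {p : E × E | p.2 ∈ Metric.closedBall p.1 (2 * ε)}.indicator
          (fun p => ‖u p.2‖ₑ ^ 2) (z, y) ∂μ ∂μ := by
        refine lintegral_congr fun z => ?_
        rw [← lintegral_indicator Metric.isClosed_closedBall.measurableSet, mul_assoc]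
        rfl
    _ = c ^ 2 * V * ∫⁻ y, ∫⁻ z, {p : E × E | p.2 ∈ Metric.closedBall p.1 (2 * ε)}.indicator
          (fun p => ‖u p.2‖ₑ ^ 2) (z, y) ∂μ ∂μ := by
        have hm : Measurable ({p : E × E | p.2 ∈ Metric.closedBall p.1 (2 * ε)}.indicator
          (fun p => ‖u p.2‖ₑ ^ 2)) := ((hue.comp measurable_snd).pow_const 2).indicator hset
        rw [lintegral_const_mul _ hm.lintegral_prod_right']
        congr 1
        exact lintegral_lintegral_swap (f := fun z y =>
          {p : E × E | p.2 ∈ Metric.closedBall p.1 (2 * ε)}.indicator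
            (fun p => ‖u p.2‖ₑ ^ 2) (z, y)) hm.aemeasurable
    _ = c ^ 2 * V * ∫⁻ y, V * ‖u y‖ₑ ^ 2 ∂μ := by
        congr 1
        refine lintegral_congr fun y => ?_
        have : ∀ z, {p : E × E | p.2 ∈ Metric.closedBall p.1 (2 * ε)}.indicator
            (fun p => ‖u p.2‖ₑ ^ 2) (z, y)
            = (Metric.closedBall y (2 * ε)).indicator (fun _ => ‖u y‖ₑ ^ 2) z := fun z => by
          simp only [indicator, mem_ofPred_eq, Metric.mem_closedBall, dist_comm]
        simp only [this]
        rw [lintegral_indicator_const Metric.isClosed_closedBall.measurableSet, hVz, mul_comm]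
    _ = _ := by
        rw [lintegral_const_mul _ (hue.pow_const 2), ← hcV]
        ring

end Mollifier

/-! ### Invariant cut-offs and the unweighted form of the transport equation. -/

namespace PlanarData
variable {S : PlanarData}

/-- Test functions that are invariant under the characteristic flow. -/
structure IsInvariantCutoff (S : PlanarData) (χ : PlanarPhase → ℝ) : Prop extends S.IsTest χ where
  transport : ∀ z, S.classicalTransport χ z = 0

lemma transport_comp_snd {G : ℝ × ℝ → ℝ} (hG : Differentiable ℝ G) (z : PlanarPhase) :
    S.classicalTransport (fun z => G z.2.2) z = 0 := by
  have h := (hG z.2.2).hasFDerivAt.comp z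
    ((ContinuousLinearMap.snd ℝ ℝ (ℝ × ℝ)).comp
      (ContinuousLinearMap.snd ℝ ℝ (ℝ × (ℝ × ℝ)))).hasFDerivAt
  refine (congrArg (fun L : PlanarPhase →L[ℝ] ℝ => L (S.field z)) h.fderiv).trans ?_
  simp [field]

namespace IsSteadyState
variable (hS : S.IsSteadyState)
include hS

lemma exists_bound_of_mem_Ω₀ : ∃ R, ∀ z ∈ S.Ω₀, z ∈ Metric.closedBall (0 : PlanarPhase) R := by
  obtain ⟨R, hR, hx⟩ := hS.exists_radius
  obtain ⟨R', hw⟩ := hS.β_compact.isCompact.isBounded.subset_closedBall (0 : ℝ × ℝ)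
  refine ⟨max R (max √(2 * (S.E₀ - S.U₀ 0)) R'), fun z hz => ?_⟩
  obtain ⟨h1, h2⟩ := hS.mem_Ω₀.1 hz
  simp only [depth, energy] at h1
  rw [mem_closedBall_zero_iff, Prod.norm_def, Prod.norm_def]
  refine max_le_max ?_ (max_le_max ?_ ?_)
  · exact hx _ (by nlinarith [sq_nonneg z.2.1])
  · rw [Real.norm_eq_abs]
    refine Real.abs_le_sqrt ?_
    linarith [hS.U₀_zero_le z.1]
  · exact mem_closedBall_zero_iff.1 (hw (subset_tsupport _ h2.ne'))

/-- An exhaustion of `Ω₀` by invariant cut-off functions. -/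
lemma exists_invariantCutoff : ∃ χ : ℕ → PlanarPhase → ℝ, (∀ n, S.IsInvariantCutoff (χ n)) ∧
    (∀ n z, 0 ≤ χ n z ∧ χ n z ≤ 1) ∧ ∀ z ∈ S.Ω₀, Tendsto (fun n => χ n z) atTop (𝓝 1) := by
  -- As `β` is only continuous, it is replaced by a `C¹` function with the same set of positivity.
  -- Functions of `depth` and of `b(v̄)` are invariant under the flow.
  obtain ⟨b, hb, hbs, hbr⟩ := IsOpen.exists_contDiff_support_eq (n := 1)
    (isOpen_lt continuous_const hS.β_continuous : IsOpen {w | 0 < S.β w})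
  obtain ⟨R, hR⟩ := hS.exists_bound_of_mem_Ω₀
  have hb0 : ∀ w, 0 ≤ b w := fun w => (hbr ⟨w, rfl⟩).1
  have hbpos : ∀ w, 0 < b w ↔ 0 < S.β w := fun w => by
    rw [(hb0 w).lt_iff_ne', ← Function.mem_support, hb]; rfl
  -- This cut-off vanishes for `t ≤ 1 / n` and equals `1` for `t ≥ 2 / n`.
  set A : ℕ → ℝ → ℝ := fun n t => smoothTransition (n * t - 1) with hA
  have hAd : ∀ n, ContDiff ℝ 1 (A n) := fun n =>
    (smoothTransition.contDiff (n := 1)).comp (by fun_prop)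
  have hA0 : ∀ n t, A n t ≠ 0 → 1 / (n : ℝ) ≤ t ∧ 0 < (n : ℝ) := fun n t h => by
    have h1 : 0 < n * t - 1 := by
      by_contra! h'
      exact h (smoothTransition.zero_of_nonpos h')
    have hn : (0 : ℝ) < n := by
      rcases n.eq_zero_or_pos with rfl | hn
      · norm_num at h1
      · exact_mod_cast hn
    refine ⟨?_, hn⟩
    rw [div_le_iff₀ hn]; linarith
  have hA1 : ∀ t, 0 < t → Tendsto (fun n => A n t) atTop (𝓝 1) := fun t ht => by
    refine tendsto_const_nhds.congr' ?_
    filter_upwards [(tendsto_natCast_atTop_atTop (R := ℝ)).eventually_ge_atTop (2 / t)] with n hn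
    rw [div_le_iff₀ ht] at hn
    exact (smoothTransition.one_of_one_le (by linarith)).symm
  have hbc : ContDiff ℝ 1 fun z : PlanarPhase => b z.2.2 := hbs.comp (by fun_prop)
  refine ⟨fun n z => A n (S.depth z) * A n (b z.2.2), fun n => ⟨⟨?_, ?_, ?_⟩, ?_⟩, ?_, ?_⟩
  · exact ((hAd n).comp hS.contDiff_depth).mul ((hAd n).comp hbc)
  · refine HasCompactSupport.intro (isCompact_closedBall 0 R) fun z hz => ?_
    by_contra h
    obtain ⟨h1, h2⟩ := mul_ne_zero_iff.1 h
    obtain ⟨h1, hn⟩ := hA0 n _ h1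
    obtain ⟨h2, -⟩ := hA0 n _ h2
    have hn' : 0 < 1 / (n : ℝ) := by positivity
    exact hz (hR z (hS.mem_Ω₀.2 ⟨hn'.trans_le h1, (hbpos _).1 (hn'.trans_le h2)⟩))
  -- For `n = 0` the convention `1 / 0 = 0` would make the closed set below too large; there the
  -- cut-off is identically zero.
  · rcases n.eq_zero_or_pos with rfl | hn
    · have : (fun z => A 0 (S.depth z) * A 0 (b z.2.2)) = 0 := by
        funext z
        have : A 0 (S.depth z) = 0 := smoothTransition.zero_of_nonpos (by simp)
        simp [this]
      simp only
      rw [this]; simp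
    · refine (closure_minimal (t := {z | 1 / (n : ℝ) ≤ S.depth z ∧ 1 / (n : ℝ) ≤ b z.2.2})
        (fun z hz => ?_) ?_).trans fun z hz => ?_
      · obtain ⟨h1, h2⟩ := mul_ne_zero_iff.1 hz
        exact ⟨(hA0 n _ h1).1, (hA0 n _ h2).1⟩
      · exact (isClosed_le continuous_const hS.continuous_depth).inter
          (isClosed_le continuous_const hbc.continuous)
      · have hn' : 0 < 1 / (n : ℝ) := by positivity
        exact hS.mem_Ω₀.2 ⟨hn'.trans_le hz.1, (hbpos _).1 (hn'.trans_le hz.2)⟩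
  · intro z
    simp only
    rw [classicalTransport_mul (f := fun z => A n (S.depth z)) (g := fun z => A n (b z.2.2))
      (((hAd n).comp hS.contDiff_depth).differentiable one_ne_zero z)
      (((hAd n).comp hbc).differentiable one_ne_zero z),
      hS.transport_comp_depth ((hAd n).differentiable one_ne_zero _),
      transport_comp_snd (G := fun w => A n (b w))
        (((hAd n).comp hbs).differentiable one_ne_zero)]
    ring
  · exact fun n z => ⟨mul_nonneg (smoothTransition.nonneg _) (smoothTransition.nonneg _),
      mul_le_one₀ (smoothTransition.le_one _) (smoothTransition.nonneg _)
        (smoothTransition.le_one _)⟩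
  · intro z hz
    obtain ⟨h1, h2⟩ := hS.mem_Ω₀.1 hz
    simpa using (hA1 _ h1).mul (hA1 _ ((hbpos _).2 h2))

omit hS in
/-- Elements of `H` are square integrable against bounded weights. -/
lemma memLp_mul_coe (g : S.H) {χ : PlanarPhase → ℝ} (hχ : AEStronglyMeasurable χ S.weightedMeasure)
    {C : ℝ} (hC : ∀ z, |χ z| ≤ C) : MemLp (fun z => χ z * g z) 2 S.weightedMeasure :=
  (Lp.memLp g).of_le_mul (c := C) (hχ.mul (Lp.memLp g).1) (Eventually.of_forall fun z => by
    rw [norm_mul]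
    exact mul_le_mul_of_nonneg_right (hC z) (norm_nonneg _))

omit hS in
lemma _root_.PlanarData.IsTest.exists_bound {ξ : PlanarPhase → ℝ} (hξ : S.IsTest ξ) :
    ∃ C, ∀ z, |ξ z| ≤ C := hξ.compact.exists_bound_of_continuous hξ.contDiff.continuous

omit hS in
lemma memLp_test_mul (g : S.H) {χ : PlanarPhase → ℝ} (hχ : S.IsTest χ) :
    MemLp (fun z => χ z * g z) 2 S.weightedMeasure := by
  obtain ⟨C, hC⟩ := hχ.exists_bound
  exact memLp_mul_coe g hχ.contDiff.continuous.aestronglyMeasurable hC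

lemma integrable_test_mul (g : S.H) {F : PlanarPhase → ℝ} (hF : Continuous F)
    (hc : HasCompactSupport F) (hs : tsupport F ⊆ S.Ω₀) : Integrable fun z => F z * g z := by
  have h1 : MemLp (fun z => S.slope z * F z) 2 S.weightedMeasure :=
    hS.memLp_of_continuous (hS.continuousOn_slope.continuous_mul_of_tsupport_subset
      hS.isOpen_Ω₀ hF hs) hc.mul_left (tsupport_mul_subset_right.trans hs)
  have h2 : Integrable (fun z => S.slope z * F z * g z) S.weightedMeasure :=
    h1.integrable_mul (Lp.memLp g)
  rw [hS.integrable_weighted] at h2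
  refine h2.congr (Eventually.of_forall fun z => ?_)
  by_cases hz : z ∈ S.Ω₀
  · have := (hS.slope_pos hz).ne'
    simp only; field_simp
  · simp [image_eq_zero_of_notMem_tsupport fun h => hz (hs h)]

omit hS in
/-- Localisation of weak transport pairs. -/
lemma hasTransport_cutoff {g h : S.H} (H : S.HasTransport g h) {χ : PlanarPhase → ℝ}
    (hχ : S.IsInvariantCutoff χ) :
    S.HasTransport (S.toH fun z => χ z * g z) (S.toH fun z => χ z * h z) := by
  intro ξ h1 h2 h3
  have hξ : S.IsTest ξ := ⟨h1, h2, h3⟩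
  have hχξ : S.IsTest fun z => χ z * ξ z := hξ.mul_left fun z _ => hχ.contDiff.contDiffAt
  have := H _ hχξ.contDiff hχξ.compact hχξ.subset
  have e1 : ∫ z, S.toH (fun z => χ z * g z) z * S.classicalTransport ξ z ∂S.weightedMeasure
      = ∫ z, g z * S.classicalTransport (fun z => χ z * ξ z) z ∂S.weightedMeasure := by
    refine integral_congr_ae ?_
    filter_upwards [coeFn_toH (memLp_test_mul g hχ.toIsTest)] with z hz
    rw [hz, classicalTransport_mul (hχ.differentiable z) (hξ.differentiable z), hχ.transport]
    ring
  have e2 : ∫ z, S.toH (fun z => χ z * h z) z * ξ z ∂S.weightedMeasure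
      = ∫ z, h z * (χ z * ξ z) ∂S.weightedMeasure := by
    refine integral_congr_ae ?_
    filter_upwards [coeFn_toH (memLp_test_mul h hχ.toIsTest)] with z hz
    rw [hz]; ring
  rw [e1, e2, this]

lemma continuous_β_snd : Continuous fun z : PlanarPhase => S.β z.2.2 :=
  hS.β_continuous.comp (by fun_prop)

/-- Localised weak transport pairs satisfy the transport equation without weight. -/
lemma integral_cutoff_mul_transport {g h : S.H} (H : S.HasTransport g h) {χ : PlanarPhase → ℝ}
    (hχ : S.IsInvariantCutoff χ) {ξ : PlanarPhase → ℝ} (hξ : ContDiff ℝ 1 ξ) :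
    ∫ z, χ z * g z * S.classicalTransport ξ z = -∫ z, χ z * h z * ξ z := by
  -- The weight would be removed by testing with `rate * β * ξ * χ`, but `β` need not be
  -- differentiable. It is approximated by mollifications `b n` in `v̄` alone, which `D` still
  -- annihilates; no derivative of `b n` remains, so pointwise convergence and a uniform bound
  -- suffice for the limit.
  set φ : ℕ → ContDiffBump (0 : ℝ × ℝ) := fun n =>
    ⟨1 / (n + 1), 2 / (n + 1), by positivity, by gcongr; norm_num⟩ with hφ
  have hφ0 : Tendsto (fun n => (φ n).rOut) atTop (𝓝 0) := by
    simpa [hφ, div_eq_mul_inv] using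
      (tendsto_one_div_add_atTop_nhds_zero_nat (𝕜 := ℝ)).const_mul 2
  set b : ℕ → ℝ × ℝ → ℝ := fun n =>
    convolution ((φ n).normed volume) S.β (ContinuousLinearMap.lsmul ℝ ℝ) volume with hb
  have : (volume : Measure (ℝ × ℝ)).IsAddHaarMeasure :=
    inferInstanceAs (Measure.prod volume volume).IsAddHaarMeasure
  have hbC : ∀ n, ContDiff ℝ 1 (b n) := fun n =>
    (φ n).hasCompactSupport_normed.contDiff_convolution_left (n := 1) _ (φ n).contDiff_normed
      hS.β_continuous.locallyIntegrable
  have hbt : ∀ w, Tendsto (fun n => b n w) atTop (𝓝 (S.β w)) := fun w =>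
    ContDiffBump.convolution_tendsto_right_of_continuous hφ0 hS.β_continuous w
  obtain ⟨M, hM⟩ := hS.β_compact.exists_bound_of_continuous hS.β_continuous
  have hM0 : 0 ≤ M := (norm_nonneg _).trans (hM 0)
  have hbM : ∀ n w, |b n w| ≤ M + M := fun n w => by
    have h1 := (φ n).dist_normed_convolution_le (g := S.β) (x₀ := w) (ε := M + M) (μ := volume)
      hS.β_continuous.aestronglyMeasurable (fun x _ => by
        rw [Real.dist_eq]
        exact (abs_sub _ _).trans (add_le_add (hM _) (hM _)))
    have h2 : b n w = ∫ t, (φ n).normed volume t * S.β (w - t) := rfl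
    have h3 : |b n w| ≤ M := by
      rw [h2, ← Real.norm_eq_abs]
      have hint : Integrable ((φ n).normed volume) := (φ n).integrable_normed
      refine (norm_integral_le_of_norm_le (hint.mul_const M) (Eventually.of_forall fun t => ?_)).trans
        (by rw [integral_mul_const, (φ n).integral_normed, one_mul])
      rw [norm_mul, Real.norm_of_nonneg ((φ n).nonneg_normed _)]
      exact mul_le_mul_of_nonneg_left (hM _) ((φ n).nonneg_normed _)
    linarith
  have hβinv : ContinuousOn (fun z : PlanarPhase => (S.β z.2.2)⁻¹) S.Ω₀ :=
    hS.continuous_β_snd.continuousOn.inv₀ fun z hz => ((hS.mem_Ω₀.1 hz).2).ne'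
  have htest : ∀ n, S.IsTest fun z => S.profile.rate (S.depth z) * b n z.2.2 * ξ z * χ z :=
    fun n => hχ.toIsTest.mul_left fun z hz => by
      refine ContDiffAt.mul (ContDiffAt.mul ?_ ?_) hξ.contDiffAt
      · exact (S.profile.contDiffAt_rate (hS.mem_Ω₀.1 hz).1).comp z hS.contDiff_depth.contDiffAt
      · exact ((hbC n).comp (by fun_prop : ContDiff ℝ 1 fun z : PlanarPhase => z.2.2)).contDiffAt
  have hχ0 : ∀ z ∉ S.Ω₀, χ z = 0 := fun z hz =>
    image_eq_zero_of_notMem_tsupport fun h' => hz (hχ.subset h')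
  have hDtest : ∀ n, ∀ z ∈ S.Ω₀, S.classicalTransport
      (fun z => S.profile.rate (S.depth z) * b n z.2.2 * ξ z * χ z) z
      = S.profile.rate (S.depth z) * b n z.2.2 * χ z * S.classicalTransport ξ z := fun n z hz => by
    have hr := S.profile.contDiffAt_rate (hS.mem_Ω₀.1 hz).1
    have d1 : DifferentiableAt ℝ (fun z => S.profile.rate (S.depth z)) z :=
      (hr.comp z hS.contDiff_depth.contDiffAt).differentiableAt one_ne_zero
    have d2 : DifferentiableAt ℝ (fun z : PlanarPhase => b n z.2.2) z :=
      ((hbC n).comp (by fun_prop : ContDiff ℝ 1 fun z : PlanarPhase => z.2.2)).differentiable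
        one_ne_zero z
    have d3 := hξ.differentiable one_ne_zero z
    rw [classicalTransport_mul ((d1.fun_mul d2).fun_mul d3) (hχ.differentiable z), hχ.transport,
      classicalTransport_mul (d1.fun_mul d2) d3, classicalTransport_mul d1 d2,
      transport_comp_snd ((hbC n).differentiable one_ne_zero),
      hS.transport_comp_depth (hr.differentiableAt one_ne_zero)]
    ring
  have hlim : ∀ (u : S.H) (F : PlanarPhase → ℝ), Continuous F →
      Tendsto (fun n => ∫ z, b n z.2.2 * ((S.β z.2.2)⁻¹ * (F z * χ z)) * u z) atTop
        (𝓝 (∫ z, χ z * u z * F z)) := by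
    intro u F hF
    have hFχs : tsupport (fun z => F z * χ z) ⊆ S.Ω₀ :=
      tsupport_mul_subset_right.trans hχ.subset
    have hFχc : HasCompactSupport fun z => F z * χ z := hχ.compact.mul_left
    have hG : Continuous fun z => (S.β z.2.2)⁻¹ * (F z * χ z) :=
      hβinv.continuous_mul_of_tsupport_subset hS.isOpen_Ω₀ (hF.mul hχ.contDiff.continuous) hFχs
    have hGi : Integrable fun z => (S.β z.2.2)⁻¹ * (F z * χ z) * u z :=
      hS.integrable_test_mul u hG hFχc.mul_left (tsupport_mul_subset_right.trans hFχs)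
    refine tendsto_integral_of_dominated_convergence
      (fun z => (M + M) * ‖(S.β z.2.2)⁻¹ * (F z * χ z) * u z‖) (fun n => ?_)
      (hGi.norm.const_mul _) (fun n => Eventually.of_forall fun z => ?_)
      (Eventually.of_forall fun z => ?_)
    · simp only [mul_assoc (b n _)]
      exact ((hbC n).continuous.comp (by fun_prop)).aestronglyMeasurable.mul hGi.1
    · rw [mul_assoc, norm_mul]
      exact mul_le_mul_of_nonneg_right (hbM n _) (norm_nonneg _)
    · by_cases hz : z ∈ S.Ω₀
      · have hβz := (hS.mem_Ω₀.1 hz).2.ne'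
        have := ((hbt z.2.2).mul_const ((S.β z.2.2)⁻¹ * (F z * χ z))).mul_const (u z)
        convert! this using 2
        field_simp
      · simp [hχ0 z hz]
  have h1 := hlim g _ (hS.continuous_transport hξ)
  have h2 := (hlim h _ hξ.continuous).neg
  refine tendsto_nhds_unique (h1.congr fun n => ?_) h2
  have := H _ (htest n).contDiff (htest n).compact (htest n).subset
  rw [hS.integral_weighted, hS.integral_weighted] at this
  convert! this using 1
  · refine integral_congr_ae (Eventually.of_forall fun z => ?_)
    by_cases hz : z ∈ S.Ω₀
    · have h5 := (S.profile.rate_pos (hS.mem_Ω₀.1 hz).1).ne'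
      simp only [hDtest n z hz, slope_of_mem hz]
      field_simp
    · simp [hχ0 z hz, slope_of_notMem hz]
  · congr 1
    refine integral_congr_ae (Eventually.of_forall fun z => ?_)
    by_cases hz : z ∈ S.Ω₀
    · have h5 := (S.profile.rate_pos (hS.mem_Ω₀.1 hz).1).ne'
      simp only [slope_of_mem hz]
      field_simp
    · simp [hχ0 z hz, slope_of_notMem hz]

end IsSteadyState
end PlanarData

/-! ### Skew-symmetry of the weak transport operator and density of test functions in the graph
norm. -/

/-- Bounded sequences in a Hilbert space converge weakly if they do so on a total set. -/
lemma tendsto_inner_of_total {E ι : Type*} [NormedAddCommGroup E] [InnerProductSpace ℝ E]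
    [CompleteSpace E] {l : Filter ι} {T : Set E} (hT : ∀ u : E, (∀ t ∈ T, ⟪u, t⟫ = 0) → u = 0)
    {x : ι → E} {x₀ : E} {C : ℝ} (hC : ∀ᶠ i in l, ‖x i‖ ≤ C)
    (h : ∀ t ∈ T, Tendsto (fun i => ⟪x i, t⟫) l (𝓝 ⟪x₀, t⟫)) (y : E) :
    Tendsto (fun i => ⟪x i, y⟫) l (𝓝 ⟪x₀, y⟫) := by
  have hspan : ∀ p ∈ Submodule.span ℝ T, Tendsto (fun i => ⟪x i, p⟫) l (𝓝 ⟪x₀, p⟫) := by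
    intro p hp
    induction hp using Submodule.span_induction with
    | mem t ht => exact h t ht
    | zero => simp [tendsto_const_nhds]
    | add p q _ _ hp hq => simpa [inner_add_right] using hp.add hq
    | smul c p _ hp => simpa [inner_smul_right] using hp.const_mul c
  have hdense : (Submodule.span ℝ T).topologicalClosure = ⊤ := by
    rw [Submodule.topologicalClosure_eq_top_iff, Submodule.eq_bot_iff]
    intro u hu
    exact hT u fun t ht => (Submodule.mem_orthogonal' _ u).1 hu t (Submodule.subset_span ht)
  have hy : y ∈ closure (Submodule.span ℝ T : Set E) := by
    rw [← Submodule.topologicalClosure_coe, hdense]; trivial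
  rw [Metric.tendsto_nhds]
  intro ε hε
  set M := |C| + ‖x₀‖ + 1 with hM
  have hM0 : 0 < M := by positivity
  obtain ⟨p, hp, hyp⟩ := Metric.mem_closure_iff.1 hy (ε / (2 * M)) (by positivity)
  filter_upwards [hC, Metric.tendsto_nhds.1 (hspan p hp) (ε / 2) (by positivity)] with i h1 h2
  rw [Real.dist_eq] at h2 ⊢
  have e : ⟪x i, y⟫ - ⟪x₀, y⟫ = (⟪x i, p⟫ - ⟪x₀, p⟫) + ⟪x i - x₀, y - p⟫ := by
    simp only [inner_sub_left, inner_sub_right]; ring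
  rw [e]
  have h3 : |⟪x i - x₀, y - p⟫| ≤ M * ‖y - p‖ := by
    refine (abs_real_inner_le_norm _ _).trans (mul_le_mul_of_nonneg_right ?_ (norm_nonneg _))
    linarith [norm_sub_le (x i) x₀, le_abs_self C]
  have h4 : M * ‖y - p‖ < ε / 2 := by
    rw [dist_eq_norm] at hyp
    calc M * ‖y - p‖ < M * (ε / (2 * M)) := by gcongr
      _ = ε / 2 := by field_simp
  exact (abs_add_le _ _).trans_lt (by linarith)

/-- An integral kernel of width `2 ε` and height of order `ε⁻ᵈ` is dominated by averages. -/
lemma enorm_integral_le_average {E : Type*} [NormedAddCommGroup E] [NormedSpace ℝ E]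
    [MeasurableSpace E] [BorelSpace E] {μ : Measure E}
    {ε c : ℝ} {s : E → ℝ} {z : E} {G : E → ℝ}
    (hG : ∀ y, ‖G y‖ ≤ c * ‖s y‖) (hG0 : ∀ y, 2 * ε < ‖z - y‖ → G y = 0) :
    ‖∫ y, G y ∂μ‖ₑ ≤ ENNReal.ofReal c * ∫⁻ y in Metric.closedBall z (2 * ε), ‖s y‖ₑ ∂μ := by
  refine (enorm_integral_le_lintegral_enorm _).trans ?_
  rw [← lintegral_const_mul' _ _ ENNReal.ofReal_ne_top,
    ← lintegral_indicator Metric.isClosed_closedBall.measurableSet]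
  refine lintegral_mono fun y => ?_
  by_cases hy : y ∈ Metric.closedBall z (2 * ε)
  · rw [indicator_of_mem hy]
    have := hG y
    rw [← ofReal_norm, ← ofReal_norm, ← ENNReal.ofReal_mul' (norm_nonneg _)]
    exact ENNReal.ofReal_le_ofReal this
  · rw [indicator_of_notMem hy, hG0 y (by
      rwa [Metric.mem_closedBall, not_le, dist_comm, dist_eq_norm] at hy)]
    simp

namespace PlanarData
variable {S : PlanarData}

lemma norm_toH_sq {F : PlanarPhase → ℝ} (hF : MemLp F 2 S.weightedMeasure) :
    ‖S.toH F‖ ^ 2 = ∫ z, F z ^ 2 ∂S.weightedMeasure := by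
  rw [← real_inner_self_eq_norm_sq, inner_eq]
  refine integral_congr_ae ?_
  filter_upwards [coeFn_toH hF] with z hz
  rw [hz, sq]

lemma norm_toH_sq_le {F : PlanarPhase → ℝ} (hF : MemLp F 2 S.weightedMeasure) {B : ENNReal}
    (hB : B ≠ ⊤) (h : ∫⁻ z, ‖F z‖ₑ ^ 2 ∂S.weightedMeasure ≤ B) : ‖S.toH F‖ ^ 2 ≤ B.toReal := by
  rw [norm_toH_sq hF, integral_eq_lintegral_of_nonneg_ae
    (Eventually.of_forall fun z => sq_nonneg _) (hF.1.pow 2)]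
  refine ENNReal.toReal_mono hB (le_trans (le_of_eq ?_) h)
  refine lintegral_congr fun z => ?_
  rw [← ofReal_norm, ← ENNReal.ofReal_pow (norm_nonneg _), Real.norm_eq_abs, sq_abs]

lemma toH_add {F G : PlanarPhase → ℝ} (hF : MemLp F 2 S.weightedMeasure)
    (hG : MemLp G 2 S.weightedMeasure) : S.toH (fun z => F z + G z) = S.toH F + S.toH G := by
  have h : MemLp (fun z => F z + G z) 2 S.weightedMeasure := hF.add hG
  rw [toH, toH, toH, dif_pos hF, dif_pos hG, dif_pos h]
  exact MemLp.toLp_add hF hG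

lemma toH_const_mul (c : ℝ) {F : PlanarPhase → ℝ} (hF : MemLp F 2 S.weightedMeasure) :
    S.toH (fun z => c * F z) = c • S.toH F := by
  have h : MemLp (fun z => c * F z) 2 S.weightedMeasure := hF.const_mul c
  rw [toH, toH, dif_pos hF, dif_pos h]
  exact MemLp.toLp_const_smul c hF

namespace IsSteadyState
variable (hS : S.IsSteadyState)
include hS

lemma inner_toH_toH {F G : PlanarPhase → ℝ} (hF : MemLp F 2 S.weightedMeasure)
    (hG : MemLp G 2 S.weightedMeasure) :
    ⟪S.toH F, S.toH G⟫ = ∫ z, F z * ((S.slope z)⁻¹ * G z) := by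
  rw [inner_toH _ hG, integral_congr_ae (g := fun z => F z * G z), hS.integral_weighted]
  · congr 1; funext z; ring
  · filter_upwards [coeFn_toH hF] with z hz
    rw [hz]

lemma norm_field_sub_le (z y : PlanarPhase) :
    ‖S.field z - S.field y‖ ≤ max 1 (4 * π * S.ρ₀ 0) * ‖z - y‖ := by
  have h1 : |z.1 - y.1| ≤ ‖z - y‖ := norm_fst_le (z - y)
  have h2 : |z.2.1 - y.2.1| ≤ ‖z - y‖ := (norm_fst_le (z - y).2).trans (norm_snd_le (z - y))
  have hL : 0 ≤ max 1 (4 * π * S.ρ₀ 0) := zero_le_one.trans (le_max_left _ _)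
  rw [Prod.norm_def, Prod.norm_def]
  refine max_le ?_ (max_le ?_ ?_)
  · refine le_trans ?_ (mul_le_mul_of_nonneg_right (le_max_left _ _) (norm_nonneg _))
    rw [one_mul]; exact h2
  · have h3 := hS.abs_deriv_U₀_sub_le y.1 z.1
    have h4 : (S.field z - S.field y).2.1 = deriv S.U₀ y.1 - deriv S.U₀ z.1 := by
      simp [field]; ring
    rw [h4, Real.norm_eq_abs]
    refine h3.trans (mul_le_mul (le_max_right _ _) ?_ (abs_nonneg _) hL)
    rw [abs_sub_comm]; exact h1
  · simp only [field, Prod.snd_sub, sub_self, norm_zero]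
    positivity

lemma memLp_volume_test_mul (g : S.H) {χ : PlanarPhase → ℝ} (hχ : S.IsTest χ) :
    MemLp (fun z => χ z * g z) 2 volume := by
  have hm : AEStronglyMeasurable (fun z => χ z * g z) volume :=
    hχ.contDiff.continuous.aestronglyMeasurable.mul (Lp.stronglyMeasurable g).aestronglyMeasurable
  rw [memLp_two_iff_integrable_sq hm]
  have h1 := (Lp.memLp g).integrable_sq
  rw [hS.integrable_weighted] at h1
  have hc : Continuous fun z => S.slope z * χ z :=
    hS.continuousOn_slope.continuous_mul_of_tsupport_subset hS.isOpen_Ω₀ hχ.contDiff.continuous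
      hχ.subset
  obtain ⟨C, hC⟩ := (hχ.compact.mul_left (f := S.slope)).exists_bound_of_continuous hc
  obtain ⟨C', hC'⟩ := hχ.exists_bound
  refine (h1.bdd_mul (c := C * C') (hc.mul hχ.contDiff.continuous).aestronglyMeasurable
    (Eventually.of_forall fun z => ?_)).congr (Eventually.of_forall fun z => ?_)
  · change ‖S.slope z * χ z * χ z‖ ≤ _
    rw [norm_mul]
    exact mul_le_mul (hC z) (hC' z) (norm_nonneg _) ((norm_nonneg _).trans (hC z))
  · by_cases hz : z ∈ S.Ω₀
    · have := (hS.slope_pos hz).ne'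
      simp only [Pi.mul_apply]; field_simp
    · simp [image_eq_zero_of_notMem_tsupport fun h => hz (hχ.subset h)]

/-- Friedrichs' commutator. The derivative of the mollification carries the field at `z`, while the
weak equation tested with the mollifier carries the field at `y`. Their difference is of order `ε`
on the support of the mollifier. -/
lemma transport_mollify {g h : S.H} (H : S.HasTransport g h) {χ : PlanarPhase → ℝ}
    (hχ : S.IsInvariantCutoff χ) {ε : ℝ} (hε : 0 < ε) (z : PlanarPhase) :
    S.classicalTransport (mollify volume ε fun y => χ y * g y) z
      = ∫ y, (fderiv ℝ (mollifier volume ε) (z - y) (S.field z - S.field y) * (χ y * g y)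
        + mollifier volume ε (z - y) * (χ y * h y)) := by
  have hg := hS.integrable_test_mul g hχ.contDiff.continuous hχ.compact hχ.subset
  have hh := hS.integrable_test_mul h hχ.contDiff.continuous hχ.compact hχ.subset
  set k : PlanarPhase → ℝ := mollifier volume ε with hk
  have hkd : ContDiff ℝ 1 k := contDiff_mollifier ε
  have hkc : HasCompactSupport k := hasCompactSupport_mollifier hε
  have hξ : ContDiff ℝ 1 fun y => k (z - y) := hkd.comp (by fun_prop)
  have hξc : HasCompactSupport fun y => k (z - y) :=
    hkc.comp_homeomorph (Homeomorph.subLeft z)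
  have hD : ∀ y, S.classicalTransport (fun y => k (z - y)) y = -fderiv ℝ k (z - y) (S.field y) := by
    intro y
    have h1 := (hkd.differentiable one_ne_zero (z - y)).hasFDerivAt.comp y
      ((hasFDerivAt_id y).const_sub z)
    refine (congrArg (fun L : PlanarPhase →L[ℝ] ℝ => L (S.field y)) h1.fderiv).trans ?_
    simp
  have key := hS.integral_cutoff_mul_transport H hχ hξ
  simp only [hD] at key
  obtain ⟨C, hC⟩ := hkc.exists_bound_of_continuous hkd.continuous
  obtain ⟨C', hC'⟩ := (hkc.fderiv ℝ).exists_bound_of_continuous (hkd.continuous_fderiv one_ne_zero)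
  have hfc : Continuous fun y => fderiv ℝ k (z - y) :=
    (hkd.continuous_fderiv one_ne_zero).comp (by fun_prop)
  have i1 : Integrable fun y => fderiv ℝ k (z - y) (S.field z) * (χ y * g y) :=
    hg.bdd_mul (c := C' * ‖S.field z‖) (hfc.clm_apply continuous_const).aestronglyMeasurable
      (Eventually.of_forall fun y => (ContinuousLinearMap.le_opNorm _ _).trans
        (mul_le_mul_of_nonneg_right (hC' _) (norm_nonneg _)))
  have i2 : Integrable fun y => fderiv ℝ k (z - y) (S.field y) * (χ y * g y) := by
    have hc2 : Continuous fun y => fderiv ℝ k (z - y) (S.field y) :=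
      hfc.clm_apply hS.continuous_field
    have hs2 : HasCompactSupport fun y => fderiv ℝ k (z - y) (S.field y) := by
      have h3 : HasCompactSupport fun y => fderiv ℝ k (z - y) :=
        (hkc.fderiv ℝ).comp_homeomorph (Homeomorph.subLeft z)
      refine h3.mono' fun y hy => ?_
      refine subset_tsupport _ fun h0 => hy ?_
      simp only [h0, zero_apply]
    obtain ⟨C2, hC2⟩ := hs2.exists_bound_of_continuous hc2
    exact hg.bdd_mul (c := C2) hc2.aestronglyMeasurable (Eventually.of_forall hC2)
  have i3 : Integrable fun y => k (z - y) * (χ y * h y) :=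
    hh.bdd_mul (c := C) hξ.continuous.aestronglyMeasurable (Eventually.of_forall fun y => hC _)
  rw [classicalTransport_eq, fderiv_mollify hε hg]
  have e : ∫ y, k (z - y) * (χ y * h y) = ∫ y, fderiv ℝ k (z - y) (S.field y) * (χ y * g y) := by
    have e1 : ∫ y, χ y * g y * -fderiv ℝ k (z - y) (S.field y)
        = -∫ y, fderiv ℝ k (z - y) (S.field y) * (χ y * g y) := by
      rw [← integral_neg]
      congr 1; funext y; ring
    have e2 : ∫ y, χ y * h y * k (z - y) = ∫ y, k (z - y) * (χ y * h y) := by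
      congr 1; funext y; ring
    rw [e1, e2] at key
    linarith
  have i4 : Integrable fun y =>
      fderiv ℝ k (z - y) (S.field z - S.field y) * (χ y * g y) := by
    refine (i1.sub i2).congr (Eventually.of_forall fun y => ?_)
    simp only [Pi.sub_apply, map_sub, sub_mul]
  rw [integral_add i4 i3, e, ← integral_add i4 i2]
  congr 1; funext y
  simp only [map_sub]; ring

/-- The mollifications of a localised weak transport pair are test functions that are bounded in
the graph norm. -/
lemma exists_mollify_bound {g h : S.H} (H : S.HasTransport g h) {χ : PlanarPhase → ℝ}
    (hχ : S.IsInvariantCutoff χ) : ∃ C : ℝ, ∀ᶠ ε in 𝓝[>] (0 : ℝ),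
      S.IsTest (mollify volume ε fun y => χ y * g y) ∧
      ‖S.toH (mollify volume ε fun y => χ y * g y)‖ ≤ C ∧
      ‖S.toH (S.classicalTransport (mollify volume ε fun y => χ y * g y))‖ ≤ C := by
  -- For small `ε` the mollifications are supported in this compact neighbourhood inside `Ω₀`, on
  -- which the weight is bounded.
  obtain ⟨δ, hδ, hK'⟩ := hχ.compact.isCompact.exists_cthickening_subset_open hS.isOpen_Ω₀ hχ.subset
  set K' := Metric.cthickening δ (tsupport χ) with hK'def
  have hK'c : IsCompact K' := hχ.compact.isCompact.cthickening
  obtain ⟨CW, hCW⟩ := hK'c.exists_bound_of_continuousOn (hS.continuousOn_inv_slope.mono hK')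
  obtain ⟨C₀, hC₀, hb⟩ := exists_mollifier_bound (volume : Measure PlanarPhase)
  set Lip := max 1 (4 * π * S.ρ₀ 0) with hLip
  have hLip0 : 0 ≤ Lip := zero_le_one.trans (le_max_left _ _)
  set u : PlanarPhase → ℝ := fun y => χ y * g y with hu
  set q : PlanarPhase → ℝ := fun y => χ y * h y with hq
  set s : PlanarPhase → ℝ := fun y => |u y| + |q y| with hs
  have hui : Integrable u :=
    hS.integrable_test_mul g hχ.contDiff.continuous hχ.compact hχ.subset
  have hum : Measurable u :=
    hχ.contDiff.continuous.measurable.mul (Lp.stronglyMeasurable g).measurable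
  have hqm : Measurable q :=
    hχ.contDiff.continuous.measurable.mul (Lp.stronglyMeasurable h).measurable
  have hsm : Measurable s := by fun_prop
  have hs2 : ∫⁻ y, ‖s y‖ₑ ^ 2 ≠ ⊤ := by
    have h1 : MemLp s 2 volume :=
      (hS.memLp_volume_test_mul g hχ.toIsTest).abs.add (hS.memLp_volume_test_mul h hχ.toIsTest).abs
    have h2 := h1.integrable_sq.2
    rw [HasFiniteIntegral] at h2
    refine ne_of_lt (lt_of_le_of_lt (le_of_eq (lintegral_congr fun y => ?_)) h2)
    rw [enorm_pow]
  have hs0 : ∀ y, ‖s y‖ = |u y| + |q y| := fun y => Real.norm_of_nonneg (by positivity)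
  -- The commutator contributes `C₀ ε⁻ᵈ ε⁻¹ * (Lip * 2ε)`, which gives `2 * Lip`; the mollifier
  -- itself gives the `1`.
  set C₁ := C₀ * (2 * Lip + 1) with hC₁
  set B := ENNReal.ofReal CW * ((ENNReal.ofReal C₁ *
    (volume : Measure PlanarPhase) (Metric.closedBall 0 2)) ^ 2 * ∫⁻ y, ‖s y‖ₑ ^ 2) with hB
  have hBt : B ≠ ⊤ := by
    refine ENNReal.mul_ne_top ENNReal.ofReal_ne_top (ENNReal.mul_ne_top (ENNReal.pow_ne_top
      (ENNReal.mul_ne_top ENNReal.ofReal_ne_top ?_)) hs2)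
    exact (isCompact_closedBall _ _).measure_lt_top.ne
  have hnorm : ∀ {ε : ℝ} {F : PlanarPhase → ℝ}, 0 < ε → MemLp F 2 S.weightedMeasure →
      (∀ z ∉ K', F z = 0) →
      (∀ z, ‖F z‖ₑ ≤ ENNReal.ofReal (C₁ * ε⁻¹ ^ Module.finrank ℝ PlanarPhase)
        * ∫⁻ y in Metric.closedBall z (2 * ε), ‖s y‖ₑ) → ‖S.toH F‖ ≤ √B.toReal := by
    intro ε F hε hF hF0 hFb
    refine Real.le_sqrt_of_sq_le (norm_toH_sq_le hF hBt ?_)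
    rw [hS.lintegral_weighted]
    calc ∫⁻ z, ENNReal.ofReal (S.slope z)⁻¹ * ‖F z‖ₑ ^ 2
        ≤ ∫⁻ z, ENNReal.ofReal CW * ‖F z‖ₑ ^ 2 := by
          refine lintegral_mono fun z => ?_
          by_cases hz : z ∈ K'
          · gcongr
            exact (le_abs_self _).trans (hCW z hz)
          · simp [hF0 z hz]
      _ = ENNReal.ofReal CW * ∫⁻ z, ‖F z‖ₑ ^ 2 := lintegral_const_mul' _ _ ENNReal.ofReal_ne_top
      _ ≤ B := by
          rw [hB]
          gcongr
          exact lintegral_sq_le_of_le_average hε hsm hFb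
  refine ⟨√B.toReal, ?_⟩
  filter_upwards [self_mem_nhdsWithin,
    mem_nhdsWithin_of_mem_nhds (gt_mem_nhds (show (0 : ℝ) < δ / 2 by linarith))] with ε hε hεδ
  have hε : 0 < ε := hε
  have hu0 : ∀ z ∉ tsupport χ, u z = 0 := fun z hz => by
    simp [hu, image_eq_zero_of_notMem_tsupport hz]
  have hm0 : ∀ z ∉ K', mollify volume ε u z = 0 := fun z hz =>
    mollify_eq_zero hε hu0 fun h' => hz (Metric.cthickening_mono (by linarith) _ h')
  have hts : tsupport (mollify volume ε u) ⊆ K' :=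
    closure_minimal (fun z hz => by
      by_contra h'
      exact hz (hm0 z h')) Metric.isClosed_cthickening
  have htest : S.IsTest (mollify volume ε u) :=
    ⟨contDiff_mollify hε hui, HasCompactSupport.intro hK'c hm0, hts.trans hK'⟩
  refine ⟨htest, hnorm hε (hS.memLp_test htest) hm0 fun z => ?_,
    hnorm hε (hS.memLp_transport htest) (fun z hz =>
      image_eq_zero_of_notMem_tsupport fun h' =>
        hz (hts (tsupport_classicalTransport _ h'))) fun z => ?_⟩
  · rw [mollify_apply]
    refine enorm_integral_le_average (fun y => ?_) fun y hy => by
      rw [mollifier_eq_zero hε hy.le, zero_mul]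
    rw [norm_mul, Real.norm_of_nonneg (mollifier_nonneg hε _), hs0]
    refine mul_le_mul ((hb ε hε _).1.trans ?_) ?_ (norm_nonneg _) (by positivity)
    · refine mul_le_mul_of_nonneg_right ?_ (by positivity)
      rw [hC₁]; nlinarith
    · rw [Real.norm_eq_abs]; linarith [abs_nonneg (q y)]
  · rw [hS.transport_mollify H hχ hε z]
    refine enorm_integral_le_average (fun y => ?_) fun y hy => by
      rw [mollifier_eq_zero hε hy.le, fderiv_mollifier_eq_zero hε hy]; simp
    have h1 : ‖fderiv ℝ (mollifier volume ε) (z - y) (S.field z - S.field y)‖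
        ≤ C₀ * ε⁻¹ ^ Module.finrank ℝ PlanarPhase * (2 * Lip) := by
      by_cases hy : 2 * ε < ‖z - y‖
      · rw [fderiv_mollifier_eq_zero hε hy]
        simp only [zero_apply, norm_zero]
        positivity
      · rw [not_lt] at hy
        calc _ ≤ ‖fderiv ℝ (mollifier volume ε) (z - y)‖ * ‖S.field z - S.field y‖ :=
              ContinuousLinearMap.le_opNorm _ _
          _ ≤ (C₀ * ε⁻¹ ^ Module.finrank ℝ PlanarPhase * ε⁻¹) * (Lip * (2 * ε)) := by
              refine mul_le_mul (hb ε hε _).2 ((hS.norm_field_sub_le z y).trans ?_)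
                (norm_nonneg _) (by positivity)
              exact mul_le_mul_of_nonneg_left hy hLip0
          _ = _ := by field_simp
    have h2 : ‖mollifier volume ε (z - y)‖ ≤ C₀ * ε⁻¹ ^ Module.finrank ℝ PlanarPhase := by
      rw [Real.norm_of_nonneg (mollifier_nonneg hε _)]
      exact (hb ε hε _).1
    refine (norm_add_le _ _).trans ?_
    rw [norm_mul _ (χ y * g y), norm_mul _ (χ y * h y), hs0, Real.norm_eq_abs (χ y * g y), Real.norm_eq_abs (χ y * h y)]
    have h3 := mul_le_mul_of_nonneg_right h1 (abs_nonneg (u y))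
    have h4 := mul_le_mul_of_nonneg_right h2 (abs_nonneg (q y))
    have hA : 0 ≤ C₀ * ε⁻¹ ^ Module.finrank ℝ PlanarPhase := by positivity
    have h5 : 0 ≤ C₀ * ε⁻¹ ^ Module.finrank ℝ PlanarPhase * |u y| := by positivity
    have h6 : 0 ≤ C₀ * ε⁻¹ ^ Module.finrank ℝ PlanarPhase * Lip * |q y| := by positivity
    rw [hC₁]
    simp only [hu, hq] at h3 h4 h5 h6 ⊢
    nlinarith

/-- The weak transport operator is skew-symmetric. -/
theorem inner_add_inner_eq_zero {g h b a : S.H} (H : S.HasTransport g h)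
    (H' : S.HasTransport b a) : ⟪a, g⟫ + ⟪b, h⟫ = 0 := by
  have htot : ∀ v : S.H, (∀ t ∈ {t : S.H | ∃ ξ, S.IsTest ξ ∧ t = S.toH ξ}, ⟪v, t⟫ = 0) → v = 0 :=
    fun v hv => hS.eq_zero_of_inner_test fun ξ hξ => hv _ ⟨ξ, hξ, rfl⟩
  -- The mollifications of `χ g` are admissible tests for the pair `(b, a)`. Since `a` and `b` are
  -- fixed, weak convergence is enough.
  have key : ∀ χ, S.IsInvariantCutoff χ →
      ⟪a, S.toH fun z => χ z * g z⟫ + ⟪b, S.toH fun z => χ z * h z⟫ = 0 := by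
    intro χ hχ
    obtain ⟨C, hC⟩ := hS.exists_mollify_bound H hχ
    have hT := hasTransport_cutoff H hχ
    have w1 : ∀ y, Tendsto (fun ε => ⟪S.toH (mollify volume ε fun y => χ y * g y), y⟫) (𝓝[>] 0)
        (𝓝 ⟪S.toH fun z => χ z * g z, y⟫) := by
      refine tendsto_inner_of_total htot (hC.mono fun ε h => h.2.1) ?_
      rintro _ ⟨ψ, hψ, rfl⟩
      have h1 := tendsto_integral_mollify_mul (μ := volume)
        (hS.integrable_test_mul g hχ.contDiff.continuous hχ.compact hχ.subset)
        (hS.continuousOn_inv_slope.continuous_mul_of_tsupport_subset hS.isOpen_Ω₀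
          hψ.contDiff.continuous hψ.subset) hψ.compact.mul_left
      have e : ⟪S.toH fun z => χ z * g z, S.toH ψ⟫
          = ∫ z, χ z * g z * ((S.slope z)⁻¹ * ψ z) :=
        hS.inner_toH_toH (memLp_test_mul g hχ.toIsTest) (hS.memLp_test hψ)
      rw [e]
      refine h1.congr' ?_
      filter_upwards [hC] with ε hε
      exact (hS.inner_toH_toH (hS.memLp_test hε.1) (hS.memLp_test hψ)).symm
    -- Convergence against test functions follows from `w1` by moving `D` to the test function; the
    -- graph norm bound extends it to all of `H`.
    have w2 : ∀ y, Tendsto (fun ε => ⟪S.toH (S.classicalTransport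
        (mollify volume ε fun y => χ y * g y)), y⟫) (𝓝[>] 0)
        (𝓝 ⟪S.toH fun z => χ z * h z, y⟫) := by
      refine tendsto_inner_of_total htot (hC.mono fun ε h => h.2.2) ?_
      rintro _ ⟨ψ, hψ, rfl⟩
      have h1 := (w1 (S.toH (S.classicalTransport ψ))).neg
      rw [hS.hasTransport_iff.1 hT ψ hψ, neg_neg] at h1
      refine h1.congr' ?_
      filter_upwards [hC] with ε hε
      rw [hS.hasTransport_iff.1 (hS.hasTransport_toH hε.1) ψ hψ, neg_neg]
    have w3 := (w1 a).add (w2 b)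
    rw [real_inner_comm, real_inner_comm _ b]
    refine tendsto_nhds_unique w3 (tendsto_const_nhds.congr' ?_)
    filter_upwards [hC] with ε hε
    rw [real_inner_comm, real_inner_comm b, hS.hasTransport_iff.1 H' _ hε.1]
    ring
  obtain ⟨χ, hχ, hχb, hχt⟩ := hS.exists_invariantCutoff
  -- The cut-offs are removed by dominated convergence.
  have hlim : ∀ v w : S.H, Tendsto (fun n => ⟪v, S.toH fun z => χ n z * w z⟫) atTop (𝓝 ⟪v, w⟫) := by
    intro v w
    have e : ∀ n, ⟪v, S.toH fun z => χ n z * w z⟫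
        = ∫ z, v z * (χ n z * w z) ∂S.weightedMeasure := fun n =>
      inner_toH _ (memLp_test_mul w (hχ n).toIsTest)
    simp only [e, inner_eq v w]
    have hvw : Integrable (fun z => v z * w z) S.weightedMeasure :=
      (Lp.memLp v).integrable_mul (Lp.memLp w)
    refine tendsto_integral_of_dominated_convergence (fun z => ‖v z * w z‖) (fun n => ?_)
      hvw.norm (fun n => Eventually.of_forall fun z => ?_) ?_
    · exact (Lp.memLp v).1.mul (memLp_test_mul w (hχ n).toIsTest).1
    · rw [norm_mul, norm_mul, norm_mul, Real.norm_of_nonneg (hχb n z).1]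
      refine mul_le_mul_of_nonneg_left ?_ (norm_nonneg _)
      exact mul_le_of_le_one_left (norm_nonneg _) (hχb n z).2
    · refine hS.ae_weighted_iff.2 (Eventually.of_forall fun z hz => ?_)
      simpa using ((hχt z hz).mul_const (w z)).const_mul (v z)
  refine tendsto_nhds_unique ((hlim a g).add (hlim b h)) (tendsto_const_nhds.congr fun n => ?_)
  exact (key (χ n) (hχ n)).symm

/-- The graph of the classical transport operator on test functions. -/
def testGraph : Submodule ℝ (WithLp 2 (S.H × S.H)) where
  carrier := {x | ∃ ξ, S.IsTest ξ ∧ x = WithLp.toLp 2 (S.toH ξ, S.toH (S.classicalTransport ξ))}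
  add_mem' := by
    rintro _ _ ⟨ξ, hξ, rfl⟩ ⟨ζ, hζ, rfl⟩
    refine ⟨_, hξ.add hζ, ?_⟩
    have e : S.classicalTransport (fun z => ξ z + ζ z)
        = fun z => S.classicalTransport ξ z + S.classicalTransport ζ z := by
      funext z
      rw [classicalTransport_eq, fderiv_fun_add (hξ.differentiable z) (hζ.differentiable z)]
      rfl
    rw [e, toH_add (hS.memLp_test hξ) (hS.memLp_test hζ),
      toH_add (hS.memLp_transport hξ) (hS.memLp_transport hζ)]
    rfl
  zero_mem' := by
    have h0 : S.IsTest fun _ => 0 := ⟨contDiff_const, HasCompactSupport.zero, by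
      rw [show tsupport (fun _ : PlanarPhase => (0 : ℝ)) = ∅ from tsupport_zero]
      exact empty_subset _⟩
    refine ⟨fun _ => 0, h0, ?_⟩
    have e : S.classicalTransport (fun _ => 0) = fun _ => 0 := by
      funext z
      simp [classicalTransport_eq]
    have e0 : S.toH (fun _ => 0) = 0 := by
      have := toH_const_mul 0 (hS.memLp_test h0)
      simpa using this
    rw [e, e0]
    rfl
  smul_mem' := by
    rintro c _ ⟨ξ, hξ, rfl⟩
    refine ⟨_, hξ.const_mul c, ?_⟩
    have e : S.classicalTransport (fun z => c * ξ z) = fun z => c * S.classicalTransport ξ z := by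
      funext z
      rw [classicalTransport_eq, fderiv_const_mul (hξ.differentiable z)]
      rfl
    rw [e, toH_const_mul c (hS.memLp_test hξ), toH_const_mul c (hS.memLp_transport hξ)]
    rfl

/-- Test functions form a core of the weak transport operator. -/
theorem exists_seq_test {g h : S.H} (H : S.HasTransport g h) : ∃ ξ : ℕ → PlanarPhase → ℝ,
    (∀ n, S.IsTest (ξ n)) ∧ Tendsto (fun n => S.toH (ξ n)) atTop (𝓝 g) ∧
    Tendsto (fun n => S.toH (S.classicalTransport (ξ n))) atTop (𝓝 h) := by
  -- The closure is the double orthogonal complement. Orthogonality of `x` to the test graph says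
  -- exactly that the weak transport of `x.snd` is `x.fst`, and skew-symmetry then makes `x`
  -- orthogonal to `(g, h)`.
  have hmem : WithLp.toLp 2 (g, h) ∈ (hS.testGraph).topologicalClosure := by
    rw [← Submodule.orthogonal_orthogonal_eq_closure, Submodule.mem_orthogonal]
    intro x hx
    have hx' : S.HasTransport x.snd x.fst := by
      rw [hS.hasTransport_iff]
      intro ξ hξ
      have := (Submodule.mem_orthogonal' _ x).1 hx _ ⟨ξ, hξ, rfl⟩
      rw [WithLp.prod_inner_apply] at this
      have h2 : ⟪x.fst, S.toH ξ⟫ + ⟪x.snd, S.toH (S.classicalTransport ξ)⟫ = 0 := this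
      linarith
    rw [WithLp.prod_inner_apply]
    exact hS.inner_add_inner_eq_zero H hx'
  rw [← SetLike.mem_coe, Submodule.topologicalClosure_coe, mem_closure_iff_seq_limit] at hmem
  obtain ⟨x, hx, hlim⟩ := hmem
  choose ξ hξ hxξ using hx
  have h1 : Tendsto (fun n => (x n).ofLp) atTop (𝓝 (g, h)) :=
    ((WithLp.prod_continuous_ofLp 2 S.H S.H).tendsto _).comp hlim
  refine ⟨ξ, hξ, ?_, ?_⟩
  · refine ((continuous_fst.tendsto _).comp h1).congr fun n => ?_
    simp [hxξ n]
  · refine ((continuous_snd.tendsto _).comp h1).congr fun n => ?_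
    simp [hxξ n]

end IsSteadyState
end PlanarData

/-! ### Extension by zero, velocity integrals and the flux. -/

namespace PlanarData
variable {S : PlanarData}

/-- The extension of an element of `H` by zero. -/
def ext (g : S.H) : PlanarPhase → ℝ := S.Ω₀.indicator g

namespace IsSteadyState
variable (hS : S.IsSteadyState)
include hS

lemma slope_eq (x v : ℝ) (w : ℝ × ℝ) : S.slope (x, v, w) =
    {v : ℝ | v ^ 2 / 2 < S.E₀ - S.U₀ x}.indicator
      (fun v => S.profile.rate (S.E₀ - S.U₀ x - v ^ 2 / 2)) v * S.β w := by
  have e : S.depth (x, v, w) = S.E₀ - S.U₀ x - v ^ 2 / 2 := by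
    simp only [depth, energy]; ring
  by_cases hz : (x, v, w) ∈ S.Ω₀
  · rw [slope_of_mem hz, indicator_of_mem, e]
    have := (hS.mem_Ω₀.1 hz).1
    rw [e] at this
    change v ^ 2 / 2 < _
    linarith
  · rw [slope_of_notMem hz]
    by_cases hv : v ^ 2 / 2 < S.E₀ - S.U₀ x
    · have : S.β w = 0 := by
        by_contra h
        exact hz (hS.mem_Ω₀.2 ⟨by rw [e]; linarith, (hS.β_nonneg w).lt_of_ne' h⟩)
      rw [this, mul_zero]
    · rw [indicator_of_notMem (by exact hv), zero_mul]

lemma lintegral_β : ∫⁻ w, ENNReal.ofReal (S.β w) = 1 := by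
  rw [← ofReal_integral_eq_lintegral_ofReal
    (hS.β_continuous.integrable_of_hasCompactSupport hS.β_compact)
    (Eventually.of_forall hS.β_nonneg), hS.β_integral, ENNReal.ofReal_one]

lemma lintegral_mul_slope (x : ℝ) {a : ℝ → ENNReal} (ha : Measurable a) :
    ∫⁻ v : ℝ × (ℝ × ℝ), a v.1 * ENNReal.ofReal (S.slope (x, v))
      = ∫⁻ v in {v : ℝ | v ^ 2 / 2 < S.E₀ - S.U₀ x},
          a v * ENNReal.ofReal (S.profile.rate (S.E₀ - S.U₀ x - v ^ 2 / 2)) := by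
  have hms : MeasurableSet {v : ℝ | v ^ 2 / 2 < S.E₀ - S.U₀ x} :=
    measurableSet_lt (by fun_prop) measurable_const
  have hrm : Measurable fun v => ENNReal.ofReal ({v : ℝ | v ^ 2 / 2 < S.E₀ - S.U₀ x}.indicator
      (fun v => S.profile.rate (S.E₀ - S.U₀ x - v ^ 2 / 2)) v) := by
    classical
    refine Measurable.ennreal_ofReal ?_
    rw [← piecewise_eq_indicator]
    refine ContinuousOn.measurable_piecewise ?_ continuousOn_const hms
    refine S.profile.continuousOn_rate.comp (by fun_prop) fun v hv => ?_
    have hv : v ^ 2 / 2 < S.E₀ - S.U₀ x := hv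
    exact sub_pos.2 hv
  have e : ∀ v : ℝ × (ℝ × ℝ), a v.1 * ENNReal.ofReal (S.slope (x, v))
      = (a v.1 * ENNReal.ofReal ({v : ℝ | v ^ 2 / 2 < S.E₀ - S.U₀ x}.indicator
      (fun v => S.profile.rate (S.E₀ - S.U₀ x - v ^ 2 / 2)) v.1)) * ENNReal.ofReal (S.β v.2) := by
    rintro ⟨v, w⟩
    rw [hS.slope_eq, ENNReal.ofReal_mul' (hS.β_nonneg w), mul_assoc]
  simp only [e]
  rw [Measure.volume_eq_prod, lintegral_prod_mul (f := fun v => a v * _)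
    (g := fun w => ENNReal.ofReal (S.β w)) (ha.mul hrm).aemeasurable
    hS.β_continuous.measurable.ennreal_ofReal.aemeasurable, hS.lintegral_β, mul_one,
    ← lintegral_indicator hms]
  refine lintegral_congr fun v => ?_
  by_cases hv : v ∈ {v : ℝ | v ^ 2 / 2 < S.E₀ - S.U₀ x} <;> simp [hv]

lemma lintegral_sq_mul_slope_le (x : ℝ) :
    ∫⁻ v : ℝ × (ℝ × ℝ), ‖v.1‖ₑ ^ 2 * ENNReal.ofReal (S.slope (x, v))
      ≤ ENNReal.ofReal (S.ρ₀ x) := by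
  rw [hS.lintegral_mul_slope x (a := fun v => ‖v‖ₑ ^ 2) (by fun_prop), hS.ρ₀_eq]
  refine le_trans (le_of_eq ?_) (S.profile.lintegral_sq_mul_rate_le _)
  refine lintegral_congr fun v => ?_
  rw [← ofReal_norm, ← ENNReal.ofReal_pow (norm_nonneg _), Real.norm_eq_abs, sq_abs,
    ENNReal.ofReal_mul (sq_nonneg _)]

/-- Because `|φ'|` is integrable, bounded functions times `|φ'|` belong to `H`, and elements of `H`
are integrable over phase space. -/
lemma integrable_slope : Integrable S.slope := by
  refine ⟨hS.measurable_slope.aestronglyMeasurable, ?_⟩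
  obtain ⟨C, hC⟩ := S.profile.exists_lintegral_rate_le (S.E₀ - S.U₀ 0)
  obtain ⟨R, hR, hR'⟩ := hS.exists_radius
  have hfib : ∀ x, ∫⁻ v : ℝ × (ℝ × ℝ), ENNReal.ofReal (S.slope (x, v))
      ≤ (Icc (-R) R).indicator (fun _ => ENNReal.ofReal C) x := by
    intro x
    have e := hS.lintegral_mul_slope x (a := fun _ => 1) measurable_const
    simp only [one_mul] at e
    by_cases hx : x ∈ Icc (-R) R
    · rw [indicator_of_mem hx, e]
      exact hC _ (by linarith [hS.U₀_zero_le x])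
    · have : {v : ℝ | v ^ 2 / 2 < S.E₀ - S.U₀ x} = ∅ := by
        ext v
        simp only [mem_ofPred_eq, mem_empty_iff_false, iff_false, not_lt]
        by_contra! h
        exact hx (abs_le.1 (hR' x (by nlinarith [sq_nonneg v])))
      rw [indicator_of_notMem hx, e, this]
      simp
  rw [HasFiniteIntegral]
  have e1 : ∫⁻ z, ‖S.slope z‖ₑ = ∫⁻ z, ENNReal.ofReal (S.slope z) :=
    lintegral_congr fun z => Real.enorm_of_nonneg (hS.slope_nonneg z)
  rw [e1, Measure.volume_eq_prod, lintegral_prod _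
    hS.measurable_slope.ennreal_ofReal.aemeasurable]
  refine (lintegral_mono hfib).trans_lt ?_
  rw [lintegral_indicator_const measurableSet_Icc, Real.volume_Icc]
  exact ENNReal.mul_lt_top ENNReal.ofReal_lt_top ENNReal.ofReal_lt_top

lemma weightedMeasure_absolutelyContinuous : S.weightedMeasure ≪ volume := by
  rw [hS.weightedMeasure_eq]
  exact withDensity_absolutelyContinuous _ _

lemma memLp_mul_slope {a : PlanarPhase → ℝ} (ha : Measurable a) {C : ℝ}
    (hC : ∀ z ∈ S.Ω₀, |a z| ≤ C) : MemLp (fun z => a z * S.slope z) 2 S.weightedMeasure := by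
  have hm : Measurable fun z => a z * S.slope z := ha.mul hS.measurable_slope
  rw [memLp_two_iff_integrable_sq hm.aestronglyMeasurable, hS.integrable_weighted]
  refine (hS.integrable_slope.const_mul (C ^ 2)).mono'
    (hS.measurable_slope.inv.mul ((ha.mul hS.measurable_slope).pow_const 2)).aestronglyMeasurable
    (Eventually.of_forall fun z => ?_)
  by_cases hz : z ∈ S.Ω₀
  · have h := hS.slope_pos hz
    have e : (S.slope z)⁻¹ * (a z * S.slope z) ^ 2 = a z ^ 2 * S.slope z := by field_simp
    rw [e, Real.norm_of_nonneg (by positivity)]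
    refine mul_le_mul_of_nonneg_right ?_ h.le
    rw [← sq_abs]
    exact pow_le_pow_left₀ (abs_nonneg _) (hC z hz) 2
  · simp [slope_of_notMem hz]

/-- Unweighted integrals of `a g` are inner products with a fixed element of `H`, hence continuous
in `g`. -/
lemma inner_mul_slope (g : S.H) {a : PlanarPhase → ℝ} (ha : Measurable a) {C : ℝ}
    (hC : ∀ z ∈ S.Ω₀, |a z| ≤ C) :
    ⟪g, S.toH fun z => a z * S.slope z⟫ = ∫ z, a z * ext g z := by
  rw [inner_toH _ (hS.memLp_mul_slope ha hC), hS.integral_weighted]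
  congr 1; funext z
  by_cases hz : z ∈ S.Ω₀
  · have h := hS.slope_pos hz
    rw [ext, indicator_of_mem hz]; field_simp
  · rw [ext, indicator_of_notMem hz, slope_of_notMem hz]; simp

lemma integrable_mul_ext (g : S.H) {a : PlanarPhase → ℝ} (ha : Measurable a) {C : ℝ}
    (hC : ∀ z ∈ S.Ω₀, |a z| ≤ C) : Integrable fun z => a z * ext g z := by
  have h1 : Integrable (fun z => g z * (a z * S.slope z)) S.weightedMeasure :=
    (Lp.memLp g).integrable_mul (hS.memLp_mul_slope ha hC)
  rw [hS.integrable_weighted] at h1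
  refine h1.congr (Eventually.of_forall fun z => ?_)
  by_cases hz : z ∈ S.Ω₀
  · have h := hS.slope_pos hz
    simp only [ext, indicator_of_mem hz]; field_simp
  · simp only [ext, indicator_of_notMem hz, slope_of_notMem hz]; simp

lemma integrable_ext (g : S.H) : Integrable (ext g) := by
  simpa using hS.integrable_mul_ext g (a := fun _ => 1) measurable_const (C := 1) (by simp)

lemma exists_velocity_bound : ∃ C, ∀ z ∈ S.Ω₀, |z.2.1| ≤ C := by
  obtain ⟨R, hR⟩ := hS.exists_bound_of_mem_Ω₀
  exact ⟨R, fun z hz => ((norm_fst_le z.2).trans (norm_snd_le z)).trans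
    (mem_closedBall_zero_iff.1 (hR z hz))⟩

lemma integrable_velocity_mul_ext (g : S.H) : Integrable fun z => z.2.1 * ext g z := by
  obtain ⟨C, hC⟩ := hS.exists_velocity_bound
  exact hS.integrable_mul_ext g (by fun_prop) hC

lemma ae_ext_eq {g : S.H} {F : PlanarPhase → ℝ} (h : g =ᵐ[S.weightedMeasure] F)
    (hF : ∀ z ∉ S.Ω₀, F z = 0) : ext g =ᵐ[volume] F := by
  filter_upwards [hS.ae_weighted_iff.1 h] with z hz
  by_cases hzΩ : z ∈ S.Ω₀
  · rw [ext, indicator_of_mem hzΩ, hz hzΩ]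
  · rw [ext, indicator_of_notMem hzΩ, hF z hzΩ]

lemma ext_add (g h : S.H) : ext (g + h) =ᵐ[volume] fun z => ext g z + ext h z := by
  filter_upwards [hS.ae_weighted_iff.1 (Lp.coeFn_add g h)] with z hz
  by_cases hzΩ : z ∈ S.Ω₀
  · simp only [ext, indicator_of_mem hzΩ, hz hzΩ, Pi.add_apply]
  · simp only [ext, indicator_of_notMem hzΩ, add_zero]

lemma ext_smul (c : ℝ) (g : S.H) : ext (c • g) =ᵐ[volume] fun z => c * ext g z := by
  filter_upwards [hS.ae_weighted_iff.1 (Lp.coeFn_smul c g)] with z hz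
  by_cases hzΩ : z ∈ S.Ω₀
  · simp only [ext, indicator_of_mem hzΩ, hz hzΩ, Pi.smul_apply, smul_eq_mul]
  · simp only [ext, indicator_of_notMem hzΩ, mul_zero]

/-! ### The flux -/

lemma stronglyMeasurable_ext (g : S.H) : StronglyMeasurable (ext g) :=
  (Lp.stronglyMeasurable g).indicator hS.measurableSet_Ω₀

lemma stronglyMeasurable_J (g : S.H) : StronglyMeasurable (S.J g) := by
  have h1 : StronglyMeasurable fun z : PlanarPhase => z.2.1 * ext g z :=
    (by fun_prop : Measurable fun z : PlanarPhase => z.2.1).stronglyMeasurable.mul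
      (hS.stronglyMeasurable_ext g)
  exact h1.integral_prod_right'

omit hS in
lemma ae_ae_of_ae {P : PlanarPhase → Prop} (h : ∀ᵐ z, P z) :
    ∀ᵐ x : ℝ, ∀ᵐ v : ℝ × (ℝ × ℝ), P (x, v) :=
  Measure.ae_ae_of_ae_prod (by rwa [Measure.volume_eq_prod] at h)

omit hS in
lemma J_eq_of_ae {g : S.H} {F : PlanarPhase → ℝ} (h : ext g =ᵐ[volume] F) :
    ∀ᵐ x, S.J g x = ∫ v : ℝ × (ℝ × ℝ), v.1 * F (x, v) := by
  filter_upwards [ae_ae_of_ae h] with x hx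
  refine integral_congr_ae ?_
  filter_upwards [hx] with v hv
  rw [← hv]; rfl

lemma J_add (g h : S.H) : S.J (g + h) =ᵐ[volume] fun x => S.J g x + S.J h x := by
  have i : ∀ u : S.H, ∀ᵐ x, Integrable fun v : ℝ × (ℝ × ℝ) => v.1 * ext u (x, v) := fun u => by
    have := hS.integrable_velocity_mul_ext u
    rw [Measure.volume_eq_prod] at this
    exact this.prod_right_ae
  filter_upwards [J_eq_of_ae (hS.ext_add g h), i g, i h] with x hx h1 h2
  rw [hx]
  simp only [mul_add]
  exact integral_add h1 h2

lemma J_smul (c : ℝ) (g : S.H) : S.J (c • g) =ᵐ[volume] fun x => c * S.J g x := by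
  filter_upwards [J_eq_of_ae (hS.ext_smul c g)] with x hx
  rw [hx, J, ← integral_const_mul]
  congr 1; funext v
  simp only [ext]; ring

/-- The Cauchy-Schwarz inequality for the flux. -/
lemma enorm_J_sq_le (g : S.H) (x : ℝ) : ‖S.J g x‖ₑ ^ 2 ≤ ENNReal.ofReal (S.ρ₀ x)
    * ∫⁻ v : ℝ × (ℝ × ℝ), ENNReal.ofReal (S.slope (x, v))⁻¹ * ‖g (x, v)‖ₑ ^ 2 := by
  have hsm : Measurable fun v : ℝ × (ℝ × ℝ) => S.slope (x, v) :=
    hS.measurable_slope.comp measurable_prodMk_left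
  have hgm : Measurable fun v : ℝ × (ℝ × ℝ) => g (x, v) :=
    (Lp.stronglyMeasurable g).measurable.comp measurable_prodMk_left
  -- The integrand is split as `(|v₁| √|φ'|) (|g| / √|φ'|)`, so that the first factor produces `∫
  -- v₁² |φ'| dv`.
  set f : ℝ × (ℝ × ℝ) → ENNReal := fun v => ‖v.1‖ₑ * ENNReal.ofReal √(S.slope (x, v)) with hf
  set k : ℝ × (ℝ × ℝ) → ENNReal :=
    fun v => ENNReal.ofReal √((S.slope (x, v))⁻¹) * ‖g (x, v)‖ₑ with hk
  have hfm : Measurable f := measurable_fst.enorm.mul hsm.sqrt.ennreal_ofReal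
  have hkm : Measurable k := hsm.inv.sqrt.ennreal_ofReal.mul hgm.enorm
  have h1 : ‖S.J g x‖ₑ ≤ ∫⁻ v, (f * k) v := by
    refine (enorm_integral_le_lintegral_enorm _).trans (lintegral_mono fun v => ?_)
    by_cases hz : (x, v) ∈ S.Ω₀
    · have hp := hS.slope_pos hz
      have e : ENNReal.ofReal √(S.slope (x, v)) * ENNReal.ofReal √((S.slope (x, v))⁻¹) = 1 := by
        rw [← ENNReal.ofReal_mul (Real.sqrt_nonneg _), ← Real.sqrt_mul hp.le,
          mul_inv_cancel₀ hp.ne', Real.sqrt_one, ENNReal.ofReal_one]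
      simp only [Pi.mul_apply, hf, hk, indicator_of_mem hz, enorm_mul]
      calc ‖v.1‖ₑ * ‖g (x, v)‖ₑ = ‖v.1‖ₑ * ‖g (x, v)‖ₑ
            * (ENNReal.ofReal √(S.slope (x, v)) * ENNReal.ofReal √((S.slope (x, v))⁻¹)) := by
              rw [e, mul_one]
        _ ≤ _ := le_of_eq (by ring)
    · simp [indicator_of_notMem hz]
  have h2 := ENNReal.lintegral_mul_le_Lp_mul_Lq volume Real.HolderConjugate.two_two
    hfm.aemeasurable hkm.aemeasurable
  have h3 : ∀ v, f v ^ (2 : ℝ) = ‖v.1‖ₑ ^ 2 * ENNReal.ofReal (S.slope (x, v)) := fun v => by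
    rw [ENNReal.rpow_two, hf]
    simp only
    rw [mul_pow, ← ENNReal.ofReal_pow (Real.sqrt_nonneg _), Real.sq_sqrt (hS.slope_nonneg _)]
  have h4 : ∀ v, k v ^ (2 : ℝ) = ENNReal.ofReal (S.slope (x, v))⁻¹ * ‖g (x, v)‖ₑ ^ 2 := fun v => by
    rw [ENNReal.rpow_two, hk]
    simp only
    rw [mul_pow, ← ENNReal.ofReal_pow (Real.sqrt_nonneg _),
      Real.sq_sqrt (inv_nonneg.2 (hS.slope_nonneg _))]
  simp only [h3, h4] at h2
  calc ‖S.J g x‖ₑ ^ 2 ≤ ((∫⁻ v : ℝ × (ℝ × ℝ), ‖v.1‖ₑ ^ 2 * ENNReal.ofReal (S.slope (x, v)))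
        ^ (1 / 2 : ℝ) * (∫⁻ v : ℝ × (ℝ × ℝ), ENNReal.ofReal (S.slope (x, v))⁻¹
          * ‖g (x, v)‖ₑ ^ 2) ^ (1 / 2 : ℝ)) ^ 2 := by
        gcongr
        exact h1.trans h2
    _ = (∫⁻ v : ℝ × (ℝ × ℝ), ‖v.1‖ₑ ^ 2 * ENNReal.ofReal (S.slope (x, v)))
        * ∫⁻ v : ℝ × (ℝ × ℝ), ENNReal.ofReal (S.slope (x, v))⁻¹ * ‖g (x, v)‖ₑ ^ 2 := by
        rw [mul_pow, ← ENNReal.rpow_natCast, ← ENNReal.rpow_natCast, ← ENNReal.rpow_mul,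
          ← ENNReal.rpow_mul]
        norm_num
    _ ≤ _ := by
        gcongr
        exact hS.lintegral_sq_mul_slope_le x

/-- The density is kept inside the integral instead of being bounded by `ρ₀(0)`: the coercivity
estimate supplies exactly `4π ρ₀(x)` to compensate it. -/
lemma lintegral_J_sq_le (g : S.H) : ∫⁻ x, ‖S.J g x‖ₑ ^ 2
    ≤ ∫⁻ z, ENNReal.ofReal (S.ρ₀ z.1) * ‖g z‖ₑ ^ 2 ∂S.weightedMeasure := by
  have hm : Measurable fun z : PlanarPhase => ENNReal.ofReal (S.slope z)⁻¹
      * (ENNReal.ofReal (S.ρ₀ z.1) * ‖g z‖ₑ ^ 2) :=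
    hS.measurable_ofReal_inv_slope.mul
      ((hS.continuous_ρ₀.measurable.comp measurable_fst).ennreal_ofReal.mul
        ((Lp.stronglyMeasurable g).measurable.enorm.pow_const 2))
  rw [hS.lintegral_weighted, Measure.volume_eq_prod, lintegral_prod _ hm.aemeasurable]
  refine lintegral_mono fun x => (hS.enorm_J_sq_le g x).trans (le_of_eq ?_)
  rw [← lintegral_const_mul' _ _ ENNReal.ofReal_ne_top]
  refine lintegral_congr fun v => ?_
  ring

lemma integrable_ρ₀_mul_sq (g : S.H) :
    Integrable (fun z => S.ρ₀ z.1 * g z ^ 2) S.weightedMeasure :=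
  (Lp.memLp g).integrable_sq.bdd_mul (c := S.ρ₀ 0)
    (hS.continuous_ρ₀.comp continuous_fst).aestronglyMeasurable
    (Eventually.of_forall fun z => by
      rw [Real.norm_of_nonneg (hS.ρ₀_nonneg _)]; exact hS.ρ₀_le _)

lemma lintegral_J_sq_le_const (g : S.H) : ∫⁻ x, ‖S.J g x‖ₑ ^ 2
    ≤ ENNReal.ofReal (∫ z, S.ρ₀ z.1 * g z ^ 2 ∂S.weightedMeasure) := by
  rw [ofReal_integral_eq_lintegral_ofReal (hS.integrable_ρ₀_mul_sq g)
    (Eventually.of_forall fun z => mul_nonneg (hS.ρ₀_nonneg _) (sq_nonneg _))]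
  refine (hS.lintegral_J_sq_le g).trans (le_of_eq (lintegral_congr fun z => ?_))
  rw [ENNReal.ofReal_mul (hS.ρ₀_nonneg _), ← ofReal_norm, ← ENNReal.ofReal_pow (norm_nonneg _),
    Real.norm_eq_abs, sq_abs]

lemma memLp_J (g : S.H) : MemLp (S.J g) 2 volume := by
  rw [memLp_two_iff_integrable_sq (hS.stronglyMeasurable_J g).aestronglyMeasurable]
  refine ⟨((hS.stronglyMeasurable_J g).pow 2).aestronglyMeasurable, ?_⟩
  rw [HasFiniteIntegral]
  simp only [enorm_pow]
  exact (hS.lintegral_J_sq_le_const g).trans_lt ENNReal.ofReal_lt_top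

lemma integral_J_sq_le (g : S.H) :
    ∫ x, S.J g x ^ 2 ≤ ∫ z, S.ρ₀ z.1 * g z ^ 2 ∂S.weightedMeasure := by
  rw [integral_eq_lintegral_of_nonneg_ae (Eventually.of_forall fun z => sq_nonneg _)
    ((hS.stronglyMeasurable_J g).pow 2).aestronglyMeasurable]
  refine ENNReal.toReal_le_of_le_ofReal (integral_nonneg fun z =>
    mul_nonneg (hS.ρ₀_nonneg _) (sq_nonneg _)) ?_
  refine le_trans (le_of_eq (lintegral_congr fun x => ?_)) (hS.lintegral_J_sq_le_const g)
  rw [← ofReal_norm, ← ENNReal.ofReal_pow (norm_nonneg _), Real.norm_eq_abs, sq_abs]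

omit hS in
lemma norm_sq_eq (g : S.H) : ‖g‖ ^ 2 = ∫ z, g z ^ 2 ∂S.weightedMeasure := by
  rw [← real_inner_self_eq_norm_sq, inner_eq]
  simp only [sq]

lemma integral_J_sq_le_norm (g : S.H) : ∫ x, S.J g x ^ 2 ≤ S.ρ₀ 0 * ‖g‖ ^ 2 := by
  refine (hS.integral_J_sq_le g).trans ?_
  rw [norm_sq_eq, ← integral_const_mul]
  refine integral_mono (hS.integrable_ρ₀_mul_sq g) ((Lp.memLp g).integrable_sq.const_mul _)
    fun z => mul_le_mul_of_nonneg_right (hS.ρ₀_le _) (sq_nonneg _)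

/-- The flux `J` as a bounded operator. -/
def flux : S.H →L[ℝ] Lp ℝ 2 (volume : Measure ℝ) :=
  LinearMap.mkContinuous
    { toFun := fun g => (hS.memLp_J g).toLp
      map_add' := fun g h => by
        rw [← MemLp.toLp_add]
        exact MemLp.toLp_congr _ _ (hS.J_add g h)
      map_smul' := fun c g => by
        rw [RingHom.id_apply, ← MemLp.toLp_const_smul]
        exact MemLp.toLp_congr _ _ (hS.J_smul c g) } √(S.ρ₀ 0) fun g => by
    refine le_of_sq_le_sq ?_ (by positivity)
    rw [mul_pow, Real.sq_sqrt (hS.ρ₀_nonneg 0), ← real_inner_self_eq_norm_sq, L2.inner_def]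
    refine le_trans (le_of_eq (integral_congr_ae ?_)) (hS.integral_J_sq_le_norm g)
    filter_upwards [(hS.memLp_J g).coeFn_toLp] with x hx
    simp only [LinearMap.coe_mk, AddHom.coe_mk, hx]
    simp [sq]

lemma coeFn_flux (g : S.H) : hS.flux g =ᵐ[volume] S.J g := (hS.memLp_J g).coeFn_toLp

lemma inner_flux (g h : S.H) : ⟪hS.flux g, hS.flux h⟫ = ∫ x, S.J g x * S.J h x := by
  rw [L2.inner_def]
  refine integral_congr_ae ?_
  filter_upwards [hS.coeFn_flux g, hS.coeFn_flux h] with x h1 h2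
  rw [h1, h2]
  simp [mul_comm]

lemma norm_flux_sq (g : S.H) : ‖hS.flux g‖ ^ 2 = ∫ x, S.J g x ^ 2 := by
  rw [← real_inner_self_eq_norm_sq, inner_flux]
  simp only [sq]

/-! ### The operator `B` -/

lemma B_ae_eq (g : S.H) : S.B g =ᵐ[S.weightedMeasure]
    fun z => 4 * π * S.slope z * z.2.1 * S.J g z.1 :=
  hS.ae_weighted_iff.2 (Eventually.of_forall fun z hz => by rw [B, hS.abs_φ' hz])

lemma memLp_B (g : S.H) : MemLp (S.B g) 2 S.weightedMeasure := by
  refine (memLp_congr_ae (hS.B_ae_eq g)).2 ?_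
  have hJm : Measurable fun z : PlanarPhase => S.J g z.1 :=
    (hS.stronglyMeasurable_J g).measurable.comp measurable_fst
  have hm : Measurable fun z : PlanarPhase => 4 * π * S.slope z * z.2.1 * S.J g z.1 :=
    ((hS.measurable_slope.const_mul _).mul (by fun_prop)).mul hJm
  rw [memLp_two_iff_integrable_sq hm.aestronglyMeasurable]
  refine ⟨(hm.pow_const 2).aestronglyMeasurable, ?_⟩
  rw [HasFiniteIntegral, hS.lintegral_weighted]
  have e : ∀ z : PlanarPhase, ENNReal.ofReal (S.slope z)⁻¹
      * ‖(4 * π * S.slope z * z.2.1 * S.J g z.1) ^ 2‖ₑ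
      = ENNReal.ofReal ((4 * π) ^ 2) *
        (‖S.J g z.1‖ₑ ^ 2 * (‖z.2.1‖ₑ ^ 2 * ENNReal.ofReal (S.slope z))) := by
    intro z
    by_cases hz : z ∈ S.Ω₀
    · have hp := hS.slope_pos hz
      rw [← ofReal_norm, ← ofReal_norm, ← ofReal_norm, ← ENNReal.ofReal_pow (norm_nonneg _),
        ← ENNReal.ofReal_pow (norm_nonneg _), ← ENNReal.ofReal_mul (by positivity),
        ← ENNReal.ofReal_mul (by positivity), ← ENNReal.ofReal_mul (by positivity),
        ← ENNReal.ofReal_mul (by positivity)]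
      congr 1
      simp only [Real.norm_eq_abs, sq_abs, abs_pow]
      field_simp
    · simp [slope_of_notMem hz]
  have hm2 : Measurable fun z : PlanarPhase => ENNReal.ofReal ((4 * π) ^ 2) *
        (‖S.J g z.1‖ₑ ^ 2 * (‖z.2.1‖ₑ ^ 2 * ENNReal.ofReal (S.slope z))) :=
    measurable_const.mul ((hJm.enorm.pow_const 2).mul
      (((by fun_prop : Measurable fun z : PlanarPhase => z.2.1).enorm.pow_const 2).mul
        hS.measurable_slope.ennreal_ofReal))
  simp only [e]
  rw [Measure.volume_eq_prod, lintegral_prod _ hm2.aemeasurable]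
  calc ∫⁻ x, ∫⁻ v : ℝ × (ℝ × ℝ), ENNReal.ofReal ((4 * π) ^ 2) *
        (‖S.J g x‖ₑ ^ 2 * (‖v.1‖ₑ ^ 2 * ENNReal.ofReal (S.slope (x, v))))
      ≤ ∫⁻ x, ENNReal.ofReal ((4 * π) ^ 2) * ENNReal.ofReal (S.ρ₀ 0) * ‖S.J g x‖ₑ ^ 2 := by
        refine lintegral_mono fun x => ?_
        simp only
        rw [lintegral_const_mul' _ _ ENNReal.ofReal_ne_top,
          lintegral_const_mul' _ _ (by simp), mul_assoc, mul_comm (ENNReal.ofReal (S.ρ₀ 0))]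
        gcongr
        exact (hS.lintegral_sq_mul_slope_le x).trans (ENNReal.ofReal_le_ofReal (hS.ρ₀_le x))
    _ < ⊤ := by
        rw [lintegral_const_mul' _ _ (by finiteness)]
        exact ENNReal.mul_lt_top (by finiteness)
          ((hS.lintegral_J_sq_le_const g).trans_lt ENNReal.ofReal_lt_top)

/-- In other words `B` is `4π` times the adjoint of the flux composed with the flux. Linearity,
symmetry and parity of `B` are all read off from this identity. -/
lemma inner_B (g h : S.H) : ⟪S.toH (S.B g), h⟫ = 4 * π * ⟪hS.flux g, hS.flux h⟫ := by
  have e0 : (fun z => h z * S.B g z) =ᵐ[S.weightedMeasure]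
      fun z => h z * (4 * π * S.slope z * z.2.1 * S.J g z.1) := by
    filter_upwards [hS.B_ae_eq g] with z hz
    rw [hz]
  have e1 : ∀ z, (S.slope z)⁻¹ * (h z * (4 * π * S.slope z * z.2.1 * S.J g z.1))
      = 4 * π * (S.J g z.1 * (z.2.1 * ext h z)) := fun z => by
    by_cases hz : z ∈ S.Ω₀
    · have := hS.slope_pos hz
      rw [ext, indicator_of_mem hz]; field_simp
    · rw [ext, indicator_of_notMem hz, slope_of_notMem hz]; simp
  have hi : Integrable (fun z => h z * S.B g z) S.weightedMeasure :=
    (Lp.memLp h).integrable_mul (hS.memLp_B g)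
  rw [integrable_congr e0, hS.integrable_weighted] at hi
  simp only [e1] at hi
  rw [real_inner_comm, inner_toH _ (hS.memLp_B g), integral_congr_ae e0, hS.integral_weighted,
    integral_congr_ae (Eventually.of_forall e1), Measure.volume_eq_prod, integral_prod _ hi,
    inner_flux, ← integral_const_mul]
  congr 1; funext x
  simp only
  rw [integral_const_mul, integral_const_mul]
  rfl

/-! ### The induced field -/

lemma inducedField_eq (h : S.H) (x : ℝ) : S.inducedField h x
    = ∫ z : PlanarPhase, (2 * π * if z.1 ≤ x then 1 else -1) * ext h z := by
  obtain ⟨R, hR, hR'⟩ := hS.exists_radius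
  have hint : Integrable (ext h) (volume.prod volume) := by
    have := hS.integrable_ext h
    rwa [Measure.volume_eq_prod] at this
  have hρ : Integrable (S.inducedDensity h) := hint.integral_prod_left
  have hρ0 : ∀ y, R < |y| → S.inducedDensity h y = 0 := fun y hy => by
    refine integral_eq_zero_of_ae (Eventually.of_forall fun v => indicator_of_notMem ?_ _)
    intro hz
    have h1 := (hS.mem_Ω₀.1 hz).1
    simp only [depth, energy] at h1
    exact not_lt.2 (hR' y (by nlinarith [sq_nonneg v.1])) hy
  have hx : Integrable fun y => |x - y| * S.inducedDensity h y := by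
    refine (hρ.norm.const_mul (|x| + R)).mono'
      ((by fun_prop : Continuous fun y => |x - y|).aestronglyMeasurable.mul hρ.1)
      (Eventually.of_forall fun y => ?_)
    rcases le_or_gt |y| R with hy | hy
    · rw [norm_mul, Real.norm_eq_abs, abs_abs]
      exact mul_le_mul_of_nonneg_right ((abs_sub _ _).trans (by linarith)) (norm_nonneg _)
    · simp [hρ0 y hy]
  have hm : Measurable fun z : PlanarPhase => 2 * π * if z.1 ≤ x then (1 : ℝ) else -1 :=
    (Measurable.ite (measurableSet_le measurable_fst measurable_const)
      measurable_const measurable_const).const_mul _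
  have hker := hS.integrable_mul_ext h hm (C := 2 * π) fun z _ => by
    rw [abs_mul, abs_of_pos (by positivity)]
    split_ifs <;> simp
  rw [inducedField, (hasDerivAt_planarPotential hρ hx).deriv]
  rw [Measure.volume_eq_prod] at hker ⊢
  rw [integral_prod _ hker, ← integral_indicator measurableSet_Iic, ← integral_const_mul 2,
    ← integral_sub ((hρ.indicator measurableSet_Iic).const_mul 2) hρ, ← integral_const_mul]
  congr 1; funext y
  refine Eq.trans ?_ (integral_const_mul (2 * π * if y ≤ x then (1 : ℝ) else -1)
    fun v : ℝ × (ℝ × ℝ) => ext h (y, v)).symm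
  change _ = _ * S.inducedDensity h y
  simp only [indicator, mem_Iic]
  split_ifs <;> ring

/-- The derivative of the kernel is bounded, so convergence in `H` implies convergence of the fields
at every point. -/
lemma inducedField_eq_inner (h : S.H) (x : ℝ) : S.inducedField h x
    = ⟪h, S.toH fun z => (2 * π * if z.1 ≤ x then 1 else -1) * S.slope z⟫ := by
  have hm : Measurable fun z : PlanarPhase => 2 * π * if z.1 ≤ x then (1 : ℝ) else -1 :=
    (Measurable.ite (measurableSet_le measurable_fst measurable_const)
      measurable_const measurable_const).const_mul _
  rw [hS.inducedField_eq, hS.inner_mul_slope h hm (C := 2 * π) fun z _ => by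
    rw [abs_mul, abs_of_pos (by positivity)]
    split_ifs <;> simp]

/-- The continuity equation: the `v₁`-derivative in `D ξ` integrates to zero, and the
`x`-derivative, integrated against the sign kernel, leaves twice the value at `x`. -/
lemma inducedField_test {ξ : PlanarPhase → ℝ} (hξ : S.IsTest ξ) :
    S.inducedField (S.toH (S.classicalTransport ξ)) =ᵐ[volume]
      fun x => 4 * π * S.J (S.toH ξ) x := by
  have hz : ∀ {F : PlanarPhase → ℝ}, tsupport F ⊆ S.Ω₀ → ∀ z ∉ S.Ω₀, F z = 0 := fun hF z hzΩ =>
    image_eq_zero_of_notMem_tsupport fun h => hzΩ (hF h)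
  filter_upwards [J_eq_of_ae (hS.ae_ext_eq (coeFn_toH (hS.memLp_test hξ)) (hz hξ.subset))]
    with x hx
  rw [hx, hS.inducedField_eq]
  have hae := hS.ae_ext_eq (coeFn_toH (hS.memLp_transport hξ)) (hz hξ.transport_subset)
  set σ : ℝ → ℝ := fun y => 2 * π * if y ≤ x then 1 else -1 with hσ
  have hσm : Measurable σ :=
    (Measurable.ite measurableSet_Iic measurable_const measurable_const).const_mul _
  have hσb : ∀ y, ‖σ y‖ ≤ 2 * π := fun y => by
    rw [Real.norm_eq_abs, hσ]
    simp only
    rw [abs_mul, abs_of_pos (by positivity)]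
    split_ifs <;> simp
  have e1 : ∫ z : PlanarPhase, (2 * π * if z.1 ≤ x then 1 else -1)
      * ext (S.toH (S.classicalTransport ξ)) z
      = ∫ z : PlanarPhase, (σ z.1 * (z.2.1 * fderiv ℝ ξ z (1, 0, 0))
        + (-(σ z.1 * deriv S.U₀ z.1)) * fderiv ℝ ξ z (0, 1, 0)) := by
    refine integral_congr_ae ?_
    filter_upwards [hae] with z hz
    rw [hz]
    have : S.field z = z.2.1 • ((1, 0, 0) : PlanarPhase)
        + (-deriv S.U₀ z.1) • ((0, 1, 0) : PlanarPhase) := by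
      simp [field]
    rw [classicalTransport_eq, this, map_add, map_smul, map_smul]
    simp only [smul_eq_mul, hσ]
    ring
  have hdc : ∀ v, Continuous fun z => fderiv ℝ ξ z v := fun v =>
    (hξ.contDiff.continuous_fderiv one_ne_zero).clm_apply continuous_const
  have hds : ∀ v, HasCompactSupport fun z => fderiv ℝ ξ z v := fun v =>
    hξ.compact.fderiv_apply ℝ v
  have i1 : Integrable fun z : PlanarPhase => σ z.1 * (z.2.1 * fderiv ℝ ξ z (1, 0, 0)) :=
    (((by fun_prop : Continuous fun z : PlanarPhase => z.2.1).mul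
      (hdc _)).integrable_of_hasCompactSupport (μ := volume) (hds _).mul_left).bdd_mul (c := 2 * π)
      (hσm.comp measurable_fst).aestronglyMeasurable (Eventually.of_forall fun z => hσb _)
  have i2' : ∀ F : PlanarPhase → ℝ, Continuous F → HasCompactSupport F →
      Integrable fun z : PlanarPhase => (-(σ z.1 * deriv S.U₀ z.1)) * F z := fun F hF hFc => by
    have := (((hS.continuous_deriv_U₀.comp continuous_fst).mul
      hF).integrable_of_hasCompactSupport (μ := volume) hFc.mul_left).bdd_mul (c := 2 * π)
      (hσm.comp measurable_fst).aestronglyMeasurable (Eventually.of_forall fun z => hσb _)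
    refine this.neg.congr (Eventually.of_forall fun z => ?_)
    simp only [Pi.neg_apply, Pi.mul_apply, Function.comp]; ring
  have z2 : ∫ z : PlanarPhase, (-(σ z.1 * deriv S.U₀ z.1)) * fderiv ℝ ξ z (0, 1, 0) = 0 :=
    integral_eq_zero_of_hasLineDerivAt
      (f := fun z => (-(σ z.1 * deriv S.U₀ z.1)) * ξ z) (v := ((0, 1, 0) : PlanarPhase))
      (i2' _ hξ.contDiff.continuous hξ.compact) (i2' _ (hdc _) (hds _))
      fun z => hasLineDerivAt_mul_of_const (c := fun z => -(σ z.1 * deriv S.U₀ z.1))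
        (hξ.differentiable z) (by simp)
  rw [e1, integral_add i1 (i2' _ (hdc _) (hds _)), z2, add_zero]
  rw [Measure.volume_eq_prod] at i1 ⊢
  rw [integral_prod_symm _ i1, ← integral_const_mul]
  congr 1; funext v
  simp only
  have hcomp : ContDiff ℝ 1 fun y : ℝ => ξ (y, v) := hξ.contDiff.comp (by fun_prop)
  have hcs : HasCompactSupport fun y : ℝ => ξ (y, v) := by
    obtain ⟨R, hR⟩ := hS.exists_bound_of_mem_Ω₀
    refine HasCompactSupport.intro (isCompact_closedBall (0 : ℝ) R) fun y hy => ?_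
    refine hz hξ.subset _ fun h => hy ?_
    have := hR _ h
    rw [mem_closedBall_zero_iff] at this ⊢
    exact (norm_fst_le _).trans this
  have hd : ∀ y, fderiv ℝ ξ (y, v) (1, 0, 0) = deriv (fun y : ℝ => ξ (y, v)) y := fun y => by
    have h1 : HasDerivAt (fun y : ℝ => ((y, v) : PlanarPhase)) (1, 0, 0) y :=
      (hasDerivAt_id y).prodMk (hasDerivAt_const y v)
    exact ((hξ.differentiable (y, v)).hasFDerivAt.comp_hasDerivAt y h1).deriv.symm
  have hdi : Integrable (deriv fun y : ℝ => ξ (y, v)) :=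
    (hcomp.continuous_deriv le_rfl).integrable_of_hasCompactSupport hcs.deriv
  have e3 : ∫ y, σ y * (v.1 * fderiv ℝ ξ (y, v) (1, 0, 0))
      = 2 * π * v.1 * (2 * (∫ y in Iic x, deriv (fun y : ℝ => ξ (y, v)) y)
        - ∫ y, deriv (fun y : ℝ => ξ (y, v)) y) := by
    rw [← integral_indicator measurableSet_Iic, ← integral_const_mul 2,
      ← integral_sub ((hdi.indicator measurableSet_Iic).const_mul 2) hdi, ← integral_const_mul]
    congr 1; funext y
    simp only [hd, hσ, indicator, mem_Iic]
    split_ifs <;> ring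
  rw [e3, hcs.integral_Iic_deriv_eq hcomp x]
  have e4 : ∫ y, deriv (fun y : ℝ => ξ (y, v)) y = 0 := by
    rw [integral_of_hasDerivAt_of_tendsto (m := 0) (n := 0)
      (fun y => (hcomp.differentiable one_ne_zero y).hasDerivAt) hdi
      (hcs.is_zero_at_infty.mono_left (by rw [cocompact_eq_atBot_atTop]; exact le_sup_left))
      (hcs.is_zero_at_infty.mono_left (by rw [cocompact_eq_atBot_atTop]; exact le_sup_right))]
    ring
  rw [e4]
  ring

/-- The field induced by `D g` is the flux of `g`. -/
theorem inducedField_transport {g h : S.H} (H : S.HasTransport g h) :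
    S.inducedField h =ᵐ[volume] fun x => 4 * π * S.J g x := by
  obtain ⟨ξ, hξ, hg, hh⟩ := hS.exists_seq_test H
  have h1 : Tendsto (fun n => hS.flux (S.toH (ξ n))) atTop (𝓝 (hS.flux g)) :=
    (hS.flux.continuous.tendsto _).comp hg
  -- The fluxes converge in `L²`, hence a.e. along a subsequence, whereas the fields converge at
  -- every point; this identifies the limits.
  obtain ⟨ns, hns, hae⟩ := (tendstoInMeasure_of_tendsto_Lp h1).exists_seq_tendsto_ae
  have h2 : ∀ᵐ x, ∀ n, hS.flux (S.toH (ξ n)) x = S.J (S.toH (ξ n)) x :=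
    ae_all_iff.2 fun n => hS.coeFn_flux _
  have h3 : ∀ᵐ x, ∀ n, S.inducedField (S.toH (S.classicalTransport (ξ n))) x
      = 4 * π * S.J (S.toH (ξ n)) x := ae_all_iff.2 fun n => hS.inducedField_test (hξ n)
  filter_upwards [hae, h2, h3, hS.coeFn_flux g] with x hx h2 h3 h4
  have k1 : Tendsto (fun i => S.inducedField (S.toH (S.classicalTransport (ξ (ns i)))) x) atTop
      (𝓝 (S.inducedField h x)) := by
    simp only [hS.inducedField_eq_inner]
    exact (hh.comp hns.tendsto_atTop).inner tendsto_const_nhds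
  refine tendsto_nhds_unique k1 ?_
  simp only [h3, ← h2]
  rw [← h4]
  exact hx.const_mul _

lemma memLp_inducedField {g h : S.H} (H : S.HasTransport g h) :
    MemLp (S.inducedField h) 2 volume :=
  (memLp_congr_ae (hS.inducedField_transport H)).2 ((hS.memLp_J g).const_mul _)

lemma antonovForm_eq {g h : S.H} (H : S.HasTransport g h) :
    S.antonovForm h = ‖h‖ ^ 2 - 4 * π * ‖hS.flux g‖ ^ 2 := by
  have e : ∫ x, S.inducedField h x ^ 2 = (4 * π) ^ 2 * ‖hS.flux g‖ ^ 2 := by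
    rw [norm_flux_sq, ← integral_const_mul]
    refine integral_congr_ae ?_
    filter_upwards [hS.inducedField_transport H] with x hx
    rw [hx]; ring
  rw [antonovForm, e]
  field_simp

end IsSteadyState
end PlanarData

/-! ### The Riccati inequality and coercivity on odd test functions. -/

namespace PlanarData
variable {S : PlanarData}

lemma classicalTransport_sub {f g : PlanarPhase → ℝ} {z : PlanarPhase}
    (hf : DifferentiableAt ℝ f z) (hg : DifferentiableAt ℝ g z) :
    S.classicalTransport (fun z => f z - g z) z
      = S.classicalTransport f z - S.classicalTransport g z := by
  rw [classicalTransport_eq, fderiv_fun_sub hf hg]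
  simp [classicalTransport_eq]

lemma transport_comp_position {F : ℝ → ℝ} {F' : ℝ} {z : PlanarPhase} (hF : HasDerivAt F F' z.1) :
    S.classicalTransport (fun z => F z.1) z = F' * z.2.1 := by
  have h := hF.comp_hasFDerivAt z
    (hasFDerivAt_fst (𝕜 := ℝ) (E := ℝ) (F := ℝ × (ℝ × ℝ)) (p := z))
  refine (congrArg (fun L : PlanarPhase →L[ℝ] ℝ => L (S.field z)) h.fderiv).trans ?_
  simp [field]

lemma transport_comp_velocity {F : ℝ → ℝ} {F' : ℝ} {z : PlanarPhase}
    (hF : HasDerivAt F F' z.2.1) :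
    S.classicalTransport (fun z => F z.2.1) z = -(F' * deriv S.U₀ z.1) := by
  have h2 : HasFDerivAt (fun z : PlanarPhase => z.2.1)
    ((ContinuousLinearMap.fst ℝ ℝ (ℝ × ℝ)).comp (ContinuousLinearMap.snd ℝ ℝ (ℝ × (ℝ × ℝ)))) z :=
    hasFDerivAt_fst.comp z hasFDerivAt_snd
  have h := hF.comp_hasFDerivAt z h2
  refine (congrArg (fun L : PlanarPhase →L[ℝ] ℝ => L (S.field z)) h.fderiv).trans ?_
  simp [field]

/-- `t ↦ t / (t² + ε)`, a regularisation of `1 / t`. -/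
def regInv (ε t : ℝ) : ℝ := t / (t ^ 2 + ε)

lemma hasDerivAt_regInv {ε : ℝ} (hε : 0 < ε) (t : ℝ) :
    HasDerivAt (regInv ε) ((ε - t ^ 2) / (t ^ 2 + ε) ^ 2) t := by
  have h := (hasDerivAt_id t).div ((hasDerivAt_pow 2 t).add_const ε) (by positivity)
  convert! h using 1
  simp
  ring

lemma contDiff_regInv {ε : ℝ} (hε : 0 < ε) : ContDiff ℝ 1 (regInv ε) :=
  contDiff_id.div ((contDiff_id.pow 2).add contDiff_const) fun t => by
    have : 0 < t ^ 2 + ε := by positivity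
    exact this.ne'

/-- The regularised logarithmic derivative along the flow of the positive function `x v₁`. -/
def regLogDeriv (S : PlanarData) (ε : ℝ) (z : PlanarPhase) : ℝ :=
  regInv ε z.1 * z.2.1 - deriv S.U₀ z.1 * regInv ε z.2.1

/-- A lower bound of the potential in the Riccati inequality of `regLogDeriv`. -/
def riccati (S : PlanarData) (c ε : ℝ) (z : PlanarPhase) : ℝ :=
  4 * π * S.ρ₀ z.1 * (z.2.1 ^ 2 / (z.2.1 ^ 2 + ε))
    + c * (z.1 ^ 2 / (z.1 ^ 2 + ε)) * (1 + 2 * (z.2.1 ^ 2 / (z.2.1 ^ 2 + ε)))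
    - z.2.1 ^ 2 * (ε / (z.1 ^ 2 + ε) ^ 2) - deriv S.U₀ z.1 ^ 2 * (ε / (z.2.1 ^ 2 + ε) ^ 2)

namespace IsSteadyState
variable (hS : S.IsSteadyState)
include hS

lemma contDiff_regLogDeriv {ε : ℝ} (hε : 0 < ε) : ContDiff ℝ 1 (S.regLogDeriv ε) := by
  have h1 := contDiff_regInv hε
  have h2 := hS.contDiff_deriv_U₀
  unfold regLogDeriv
  fun_prop

lemma transport_regLogDeriv {ε : ℝ} (hε : 0 < ε) (z : PlanarPhase) :
    S.classicalTransport (S.regLogDeriv ε) z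
      = (ε - z.1 ^ 2) / (z.1 ^ 2 + ε) ^ 2 * z.2.1 ^ 2 - regInv ε z.1 * deriv S.U₀ z.1
        - 4 * π * S.ρ₀ z.1 * z.2.1 * regInv ε z.2.1
        + deriv S.U₀ z.1 ^ 2 * ((ε - z.2.1 ^ 2) / (z.2.1 ^ 2 + ε) ^ 2) := by
  have d1 : Differentiable ℝ fun z : PlanarPhase => regInv ε z.1 :=
    ((contDiff_regInv hε).comp (contDiff_fst (𝕜 := ℝ) (E := ℝ)
      (F := ℝ × (ℝ × ℝ)))).differentiable one_ne_zero
  have d2 : Differentiable ℝ fun z : PlanarPhase => z.2.1 := by fun_prop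
  have d3 : Differentiable ℝ fun z : PlanarPhase => deriv S.U₀ z.1 :=
    (hS.contDiff_deriv_U₀.comp (contDiff_fst (𝕜 := ℝ) (E := ℝ)
      (F := ℝ × (ℝ × ℝ)))).differentiable one_ne_zero
  have d4 : Differentiable ℝ fun z : PlanarPhase => regInv ε z.2.1 :=
    ((contDiff_regInv hε).comp (by fun_prop : ContDiff ℝ 1
      fun z : PlanarPhase => z.2.1)).differentiable one_ne_zero
  have e : S.regLogDeriv ε = fun z => regInv ε z.1 * z.2.1 - deriv S.U₀ z.1 * regInv ε z.2.1 := rfl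
  rw [e, classicalTransport_sub ((d1 z).fun_mul (d2 z)) ((d3 z).fun_mul (d4 z)),
    classicalTransport_mul (d1 z) (d2 z), classicalTransport_mul (d3 z) (d4 z),
    transport_comp_position (hasDerivAt_regInv hε z.1),
    transport_comp_position (hS.hasDerivAt_deriv_U₀ z.1),
    transport_comp_velocity (hasDerivAt_regInv hε z.2.1),
    transport_comp_velocity (F := fun t => t) (hasDerivAt_id z.2.1)]
  ring

/-- For `ε = 0` the squares `v² / x²` and `U₀'² / v²` cancel between `D q` and `q²`, and the mixed
terms add up to `-3 U₀' / x`. The regularisation leaves two error terms with numerator `ε`. -/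
lemma riccati_le {c ε : ℝ} (hε : 0 < ε) {z : PlanarPhase}
    (hc : c * z.1 ^ 2 ≤ z.1 * deriv S.U₀ z.1) :
    S.riccati c ε z ≤ -(S.classicalTransport (S.regLogDeriv ε) z + S.regLogDeriv ε z ^ 2) := by
  rw [hS.transport_regLogDeriv hε, riccati, regLogDeriv, regInv, regInv]
  set x := z.1
  set v := z.2.1
  set U := deriv S.U₀ x
  have hx : 0 < x ^ 2 + ε := by positivity
  have hv : 0 < v ^ 2 + ε := by positivity
  have h1 : -(((ε - x ^ 2) / (x ^ 2 + ε) ^ 2 * v ^ 2 - x / (x ^ 2 + ε) * U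
        - 4 * π * S.ρ₀ x * v * (v / (v ^ 2 + ε)) + U ^ 2 * ((ε - v ^ 2) / (v ^ 2 + ε) ^ 2))
        + (x / (x ^ 2 + ε) * v - U * (v / (v ^ 2 + ε))) ^ 2)
      = 4 * π * S.ρ₀ x * (v ^ 2 / (v ^ 2 + ε))
        + (x * U) / (x ^ 2 + ε) * (1 + 2 * (v ^ 2 / (v ^ 2 + ε)))
        - v ^ 2 * (ε / (x ^ 2 + ε) ^ 2) - U ^ 2 * (ε / (v ^ 2 + ε) ^ 2) := by
    field_simp
    ring
  rw [h1]
  have h2 : c * (x ^ 2 / (x ^ 2 + ε)) ≤ (x * U) / (x ^ 2 + ε) := by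
    rw [← mul_div_assoc]
    gcongr
  have h3 : 0 ≤ 1 + 2 * (v ^ 2 / (v ^ 2 + ε)) := by positivity
  have := mul_le_mul_of_nonneg_right h2 h3
  linarith

lemma measurable_riccati (c ε : ℝ) : Measurable (S.riccati c ε) := by
  have h1 := hS.continuous_ρ₀.measurable
  have h2 := hS.continuous_deriv_U₀.measurable
  unfold riccati
  fun_prop

/-- The coercivity estimate for test functions that are odd in `x` and in `v₁`. -/
lemma coercive_test {c : ℝ} (hc0 : 0 < c)
    (hc : ∀ x, S.U₀ x < S.E₀ → c * x ^ 2 ≤ x * deriv S.U₀ x)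
    {ξ : PlanarPhase → ℝ} (hξ : S.IsTest ξ) (hx : ∀ z : PlanarPhase, ξ (-z.1, z.2) = -ξ z)
    (hv : ∀ z : PlanarPhase, ξ (z.1, -z.2.1, z.2.2) = -ξ z) :
    4 * π * ‖hS.flux (S.toH ξ)‖ ^ 2 + 3 * c * ‖S.toH ξ‖ ^ 2
      ≤ ‖S.toH (S.classicalTransport ξ)‖ ^ 2 := by
  obtain ⟨Λ, hΛ⟩ := hξ.contDiff.lipschitzWith_of_hasCompactSupport hξ.compact one_ne_zero
  -- Oddness makes `ξ` vanish at `x = 0`, and likewise at `v₁ = 0` in `hbv`. The resulting Lipschitz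
  -- bounds control the error terms of `riccati` uniformly in `ε`.
  have hbx : ∀ z : PlanarPhase, ξ z ^ 2 ≤ Λ ^ 2 * z.1 ^ 2 := fun z => by
    have h0 : ξ (0, z.2) = 0 := by
      have := hx (0, z.2)
      simp only [neg_zero] at this
      linarith
    have h1 := hΛ.dist_le_mul z (0, z.2)
    rw [h0, Real.dist_eq, sub_zero, dist_eq_norm] at h1
    have h2 : ‖z - (0, z.2)‖ = |z.1| := by
      simp [Prod.norm_def]
    rw [h2] at h1
    have := pow_le_pow_left₀ (abs_nonneg _) h1 2
    rwa [mul_pow, sq_abs, sq_abs] at this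
  have hbv : ∀ z : PlanarPhase, ξ z ^ 2 ≤ Λ ^ 2 * z.2.1 ^ 2 := fun z => by
    have h0 : ξ (z.1, 0, z.2.2) = 0 := by
      have := hv (z.1, 0, z.2.2)
      simp only [neg_zero] at this
      linarith
    have h1 := hΛ.dist_le_mul z (z.1, 0, z.2.2)
    rw [h0, Real.dist_eq, sub_zero, dist_eq_norm] at h1
    have h2 : ‖z - (z.1, 0, z.2.2)‖ = |z.2.1| := by
      simp [Prod.norm_def]
    rw [h2] at h1
    have := pow_le_pow_left₀ (abs_nonneg _) h1 2
    rwa [mul_pow, sq_abs, sq_abs] at this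
  have hξ0 : ∀ z ∉ tsupport ξ, ξ z = 0 := fun z hz => image_eq_zero_of_notMem_tsupport hz
  have hFc : Continuous fun z : PlanarPhase => 4 * π * S.ρ₀ z.1 * ξ z ^ 2 + 3 * c * ξ z ^ 2
      + Λ ^ 2 * z.2.1 ^ 2 + Λ ^ 2 * deriv S.U₀ z.1 ^ 2 := by
    have h1 := hS.continuous_ρ₀
    have h2 := hS.continuous_deriv_U₀
    have h3 := hξ.contDiff.continuous
    fun_prop
  obtain ⟨M, hM⟩ := hξ.compact.isCompact.exists_bound_of_continuousOn hFc.continuousOn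
  have hbound : ∀ ε, 0 < ε → ∀ z,
      ‖ξ z ^ 2 * S.riccati c ε z‖ ≤ (tsupport ξ).indicator (fun _ => M) z := by
    intro ε hε z
    by_cases hz : z ∈ tsupport ξ
    · rw [indicator_of_mem hz]
      refine le_trans ?_ ((le_abs_self _).trans (hM z hz))
      rw [riccati]
      set x := z.1
      set v := z.2.1
      set U := deriv S.U₀ x
      have r1 : v ^ 2 / (v ^ 2 + ε) ≤ 1 := div_le_one_of_le₀ (by linarith) (by positivity)
      have r2 : x ^ 2 / (x ^ 2 + ε) ≤ 1 := div_le_one_of_le₀ (by linarith) (by positivity)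
      have r1' : 0 ≤ v ^ 2 / (v ^ 2 + ε) := by positivity
      have r2' : 0 ≤ x ^ 2 / (x ^ 2 + ε) := by positivity
      have r3 : ∀ t : ℝ, t ^ 2 * (ε / (t ^ 2 + ε) ^ 2) ≤ 1 := fun t => by
        rw [← mul_div_assoc, div_le_one (by positivity)]
        nlinarith [sq_nonneg t, sq_nonneg (t ^ 2), sq_nonneg (t ^ 2 + ε)]
      have r3' : ∀ t : ℝ, 0 ≤ ε / (t ^ 2 + ε) ^ 2 := fun t => by positivity
      have hρ := hS.ρ₀_nonneg x
      have s1 : 0 ≤ ξ z ^ 2 * (4 * π * S.ρ₀ x * (v ^ 2 / (v ^ 2 + ε))) := by positivity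
      have s1' : ξ z ^ 2 * (4 * π * S.ρ₀ x * (v ^ 2 / (v ^ 2 + ε))) ≤ 4 * π * S.ρ₀ x * ξ z ^ 2 := by
        have := mul_le_mul_of_nonneg_left r1 (show 0 ≤ 4 * π * S.ρ₀ x * ξ z ^ 2 by positivity)
        linarith
      have s2 : 0 ≤ ξ z ^ 2 * (c * (x ^ 2 / (x ^ 2 + ε)) * (1 + 2 * (v ^ 2 / (v ^ 2 + ε)))) := by
        positivity
      have s2' : ξ z ^ 2 * (c * (x ^ 2 / (x ^ 2 + ε)) * (1 + 2 * (v ^ 2 / (v ^ 2 + ε))))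
          ≤ 3 * c * ξ z ^ 2 := by
        have : x ^ 2 / (x ^ 2 + ε) * (1 + 2 * (v ^ 2 / (v ^ 2 + ε))) ≤ 1 * 3 :=
          mul_le_mul r2 (by linarith) (by positivity) one_pos.le
        have := mul_le_mul_of_nonneg_left this (show 0 ≤ c * ξ z ^ 2 by positivity)
        linarith
      have s3 : 0 ≤ ξ z ^ 2 * (v ^ 2 * (ε / (x ^ 2 + ε) ^ 2)) := by positivity
      have s3' : ξ z ^ 2 * (v ^ 2 * (ε / (x ^ 2 + ε) ^ 2)) ≤ Λ ^ 2 * v ^ 2 := by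
        have h1 := mul_le_mul_of_nonneg_right (hbx z)
          (show 0 ≤ v ^ 2 * (ε / (x ^ 2 + ε) ^ 2) by positivity)
        have h2 := mul_le_mul_of_nonneg_left (r3 x)
          (show (0 : ℝ) ≤ Λ ^ 2 * v ^ 2 by positivity)
        simp only [x, v] at *
        linarith
      have s4 : 0 ≤ ξ z ^ 2 * (U ^ 2 * (ε / (v ^ 2 + ε) ^ 2)) := by positivity
      have s4' : ξ z ^ 2 * (U ^ 2 * (ε / (v ^ 2 + ε) ^ 2)) ≤ Λ ^ 2 * U ^ 2 := by
        have h1 := mul_le_mul_of_nonneg_right (hbv z)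
          (show 0 ≤ U ^ 2 * (ε / (v ^ 2 + ε) ^ 2) by positivity)
        have h2 := mul_le_mul_of_nonneg_left (r3 v)
          (show (0 : ℝ) ≤ Λ ^ 2 * U ^ 2 by positivity)
        simp only [U, x, v] at *
        linarith
      rw [Real.norm_eq_abs, abs_le, mul_sub, mul_sub, mul_add]
      constructor <;> linarith
    · rw [indicator_of_notMem hz, hξ0 z hz]
      simp
  have hfin := hS.weightedMeasure_lt_top hξ.compact.isCompact hξ.subset
  have hind : Integrable ((tsupport ξ).indicator fun _ => M) S.weightedMeasure :=
    (integrable_indicator_iff (isClosed_tsupport ξ).measurableSet).2 (integrableOn_const hfin.ne)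
  have hmeas : ∀ ε, AEStronglyMeasurable (fun z => ξ z ^ 2 * S.riccati c ε z)
      S.weightedMeasure := fun ε =>
    ((hξ.contDiff.continuous.measurable.pow_const 2).mul
      (hS.measurable_riccati c ε)).aestronglyMeasurable
  -- With `q = regLogDeriv` one has `0 ≤ (D ξ - q ξ)² = (D ξ)² - D (q ξ²) + (D q + q²) ξ²`, and the
  -- middle term has vanishing weighted mean.
  have hle : ∀ ε, 0 < ε → ∫ z, ξ z ^ 2 * S.riccati c ε z ∂S.weightedMeasure
      ≤ ‖S.toH (S.classicalTransport ξ)‖ ^ 2 := by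
    intro ε hε
    have hq := hS.contDiff_regLogDeriv hε
    have hqξ : S.IsTest fun z => S.regLogDeriv ε z * ξ z * ξ z :=
      hξ.mul_left (ζ := fun z => S.regLogDeriv ε z * ξ z) fun z _ =>
        (hq.mul hξ.contDiff).contDiffAt
    have hDi : Integrable (S.classicalTransport fun z => S.regLogDeriv ε z * ξ z * ξ z)
        S.weightedMeasure := by
      rw [hS.integrable_weighted]
      exact hS.integrable_mul hS.continuousOn_inv_slope (hS.continuous_transport hqξ.contDiff)
        hqξ.transport_compact hqξ.transport_subset
    have hD2 := (hS.memLp_transport hξ).integrable_sq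
    rw [norm_toH_sq (hS.memLp_transport hξ), ← sub_zero (∫ z, S.classicalTransport ξ z ^ 2
      ∂S.weightedMeasure), ← hS.integral_transport_eq_zero hqξ, ← integral_sub hD2 hDi]
    refine integral_mono_ae (hind.mono' (hmeas ε) (Eventually.of_forall (hbound ε hε)))
      (hD2.sub hDi) (hS.ae_weighted_iff.2 (Eventually.of_forall fun z hz => ?_))
    have hU : S.U₀ z.1 < S.E₀ := by
      have h1 := (hS.mem_Ω₀.1 hz).1
      simp only [depth, energy] at h1
      nlinarith [sq_nonneg z.2.1]
    have hr := hS.riccati_le hε (hc z.1 hU)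
    have hqd := hq.differentiable one_ne_zero z
    have hξd := hξ.differentiable z
    simp only
    rw [classicalTransport_mul (hqd.fun_mul hξd) hξd, classicalTransport_mul hqd hξd]
    have := mul_le_mul_of_nonneg_left hr (sq_nonneg (ξ z))
    nlinarith [sq_nonneg (S.classicalTransport ξ z - S.regLogDeriv ε z * ξ z)]
  have hlim : Tendsto (fun n : ℕ => ∫ z, ξ z ^ 2 * S.riccati c (1 / (n + 1)) z
      ∂S.weightedMeasure) atTop
      (𝓝 (∫ z, ξ z ^ 2 * (4 * π * S.ρ₀ z.1 + 3 * c) ∂S.weightedMeasure)) := by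
    refine tendsto_integral_of_dominated_convergence _ (fun n => hmeas _) hind
      (fun n => Eventually.of_forall (hbound _ (by positivity))) ?_
    have hx0 : ∀ᵐ z : PlanarPhase, z.1 ≠ 0 := by
      rw [Measure.volume_eq_prod]
      exact Measure.quasiMeasurePreserving_fst.ae
        (p := fun x : ℝ => x ≠ 0) (compl_mem_ae_iff.2 (measure_singleton 0))
    have hv0 : ∀ᵐ z : PlanarPhase, z.2.1 ≠ 0 := by
      have h1 : ∀ᵐ y : ℝ × (ℝ × ℝ), y.1 ≠ 0 := by
        rw [Measure.volume_eq_prod]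
        exact Measure.quasiMeasurePreserving_fst.ae
          (p := fun x : ℝ => x ≠ 0) (compl_mem_ae_iff.2 (measure_singleton 0))
      rw [Measure.volume_eq_prod]
      exact Measure.quasiMeasurePreserving_snd.ae h1
    refine hS.weightedMeasure_absolutelyContinuous.ae_le ?_
    filter_upwards [hx0, hv0] with z hx0 hv0
    have hε : Tendsto (fun n : ℕ => 1 / ((n : ℝ) + 1)) atTop (𝓝 0) :=
      tendsto_one_div_add_atTop_nhds_zero_nat
    -- Off the null sets `x = 0` and `v₁ = 0` the expression is continuous down to `ε = 0`, where
    -- the error terms vanish and the fractions equal `1`.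
    have hcont : ContinuousAt (fun ε => ξ z ^ 2 * S.riccati c ε z) 0 := by
      unfold riccati
      have k1 : z.1 ^ 2 + 0 ≠ 0 := by simpa using hx0
      have k2 : z.2.1 ^ 2 + 0 ≠ 0 := by simpa using hv0
      have k3 : (z.1 ^ 2 + 0) ^ 2 ≠ 0 := pow_ne_zero _ k1
      have k4 : (z.2.1 ^ 2 + 0) ^ 2 ≠ 0 := pow_ne_zero _ k2
      fun_prop (disch := assumption)
    have h3 := hcont.tendsto.comp hε
    have e : S.riccati c 0 z = 4 * π * S.ρ₀ z.1 + 3 * c := by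
      rw [riccati]
      field_simp
      ring
    rw [e] at h3
    exact h3
  have hfinal := le_of_tendsto' hlim fun n => hle _ (by positivity)
  refine le_trans ?_ hfinal
  have i1 := hS.integrable_ρ₀_mul_sq (S.toH ξ)
  have i2 := (Lp.memLp (S.toH ξ)).integrable_sq
  have e : ∫ z, ξ z ^ 2 * (4 * π * S.ρ₀ z.1 + 3 * c) ∂S.weightedMeasure
      = 4 * π * (∫ z, S.ρ₀ z.1 * S.toH ξ z ^ 2 ∂S.weightedMeasure)
        + 3 * c * ∫ z, S.toH ξ z ^ 2 ∂S.weightedMeasure := by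
    rw [← integral_const_mul, ← integral_const_mul,
      ← integral_add (i1.const_mul _) (i2.const_mul _)]
    refine integral_congr_ae ?_
    filter_upwards [coeFn_toH (hS.memLp_test hξ)] with z hz
    rw [hz]; ring
  rw [e, norm_flux_sq, norm_sq_eq]
  -- The term `4π ρ₀` absorbs the flux, and `3 * c` is left over.
  have := hS.integral_J_sq_le (S.toH ξ)
  gcongr

end IsSteadyState
end PlanarData

/-! ### Reflections, parity and coercivity on odd functions. -/

namespace PlanarData

/-- The reflection `x ↦ -x`. -/
def reflX : PlanarPhase ≃L[ℝ] PlanarPhase :=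
  (ContinuousLinearEquiv.neg ℝ (M := ℝ)).prodCongr (ContinuousLinearEquiv.refl ℝ (ℝ × (ℝ × ℝ)))

/-- The reflection `v₁ ↦ -v₁`. -/
def reflV : PlanarPhase ≃L[ℝ] PlanarPhase :=
  (ContinuousLinearEquiv.refl ℝ ℝ).prodCongr
    ((ContinuousLinearEquiv.neg ℝ (M := ℝ)).prodCongr (ContinuousLinearEquiv.refl ℝ (ℝ × ℝ)))

lemma reflX_apply (z : PlanarPhase) : reflX z = (-z.1, z.2) := rfl

lemma reflV_apply (z : PlanarPhase) : reflV z = (z.1, -z.2.1, z.2.2) := rfl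

/-- A linear involution that preserves the steady state and reverses the characteristic flow. -/
structure IsReversal (S : PlanarData) (σ : PlanarPhase ≃L[ℝ] PlanarPhase) : Prop where
  involutive : ∀ z, σ (σ z) = z
  preserving : MeasurePreserving σ S.weightedMeasure S.weightedMeasure
  mem : ∀ z ∈ S.Ω₀, σ z ∈ S.Ω₀
  field : ∀ z, S.field (σ z) = -σ (S.field z)

variable {S : PlanarData}

lemma measurePreserving_reflX : MeasurePreserving reflX (volume : Measure PlanarPhase) volume :=
  (Measure.measurePreserving_neg (volume : Measure ℝ)).prod (MeasurePreserving.id volume)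

lemma measurePreserving_neg_fst :
    MeasurePreserving (Prod.map Neg.neg id : ℝ × (ℝ × ℝ) → ℝ × (ℝ × ℝ)) volume volume :=
  (Measure.measurePreserving_neg (volume : Measure ℝ)).prod (MeasurePreserving.id volume)

lemma measurePreserving_reflV : MeasurePreserving reflV (volume : Measure PlanarPhase) volume :=
  (MeasurePreserving.id (volume : Measure ℝ)).prod measurePreserving_neg_fst

namespace IsReversal

variable {σ : PlanarPhase ≃L[ℝ] PlanarPhase} (hσ : S.IsReversal σ)
include hσ

lemma notMem {z : PlanarPhase} (hz : z ∉ S.Ω₀) : σ z ∉ S.Ω₀ := fun h =>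
  hz (hσ.involutive z ▸ hσ.mem _ h)

lemma isTest {ξ : PlanarPhase → ℝ} (hξ : S.IsTest ξ) : S.IsTest fun z => ξ (σ z) where
  contDiff := hξ.contDiff.comp σ.contDiff
  compact := hξ.compact.comp_homeomorph σ.toHomeomorph
  subset := by
    have h := tsupport_comp_eq_preimage ξ σ.toHomeomorph
    intro z hz
    have hz' : z ∈ tsupport (ξ ∘ σ.toHomeomorph) := hz
    rw [h] at hz'
    rw [← hσ.involutive z]
    exact hσ.mem _ (hξ.subset hz')

lemma transport_comp {ξ : PlanarPhase → ℝ} (hξ : S.IsTest ξ) (z : PlanarPhase) :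
    S.classicalTransport (fun z => ξ (σ z)) z = -S.classicalTransport ξ (σ z) := by
  have h : HasFDerivAt (fun z => ξ (σ z))
      ((fderiv ℝ ξ (σ z)).comp (σ : PlanarPhase →L[ℝ] PlanarPhase)) z :=
    (hξ.differentiable (σ z)).hasFDerivAt.comp z σ.hasFDerivAt
  rw [classicalTransport_eq, classicalTransport_eq, h.fderiv, hσ.field, map_neg, neg_neg]
  rfl

/-- The action of a reversal on `H`. -/
def act : S.H →ₗᵢ[ℝ] S.H := Lp.compMeasurePreservingₗᵢ ℝ σ hσ.preserving

lemma coeFn_act (g : S.H) : hσ.act g =ᵐ[S.weightedMeasure] fun z => g (σ z) :=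
  Lp.coeFn_compMeasurePreserving g hσ.preserving

lemma act_act (g : S.H) : hσ.act (hσ.act g) = g := by
  refine Lp.ext ?_
  filter_upwards [hσ.coeFn_act (hσ.act g),
    hσ.preserving.quasiMeasurePreserving.ae (hσ.coeFn_act g)] with z h1 h2
  rw [h1, h2, hσ.involutive]

lemma inner_act (g u : S.H) : ⟪hσ.act g, u⟫ = ⟪g, hσ.act u⟫ := by
  rw [← hσ.act.inner_map_map g (hσ.act u), hσ.act_act]

lemma act_toH {F : PlanarPhase → ℝ} (hF : MemLp F 2 S.weightedMeasure) :
    hσ.act (S.toH F) = S.toH fun z => F (σ z) := by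
  have h : MemLp (fun z => F (σ z)) 2 S.weightedMeasure :=
    hF.comp_measurePreserving hσ.preserving
  refine Lp.ext ?_
  filter_upwards [hσ.coeFn_act (S.toH F), coeFn_toH h,
    hσ.preserving.quasiMeasurePreserving.ae (coeFn_toH hF)] with z h1 h2 h3
  rw [h1, h2, h3]

lemma act_eq_neg_iff {g : S.H} :
    hσ.act g = -g ↔ ∀ᵐ z ∂S.weightedMeasure, g z = -g (σ z) := by
  constructor
  · intro h
    have h1 := hσ.coeFn_act g
    rw [h] at h1
    filter_upwards [h1, Lp.coeFn_neg g] with z h1 h2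
    rw [← h1, h2, Pi.neg_apply, neg_neg]
  · intro h
    refine Lp.ext ?_
    filter_upwards [hσ.coeFn_act g, Lp.coeFn_neg g, h] with z h1 h2 h3
    rw [h1, h2, Pi.neg_apply, h3, neg_neg]

/-- The projection onto the `σ`-odd functions. -/
def oddPart : S.H →L[ℝ] S.H :=
  (1 / 2 : ℝ) • (ContinuousLinearMap.id ℝ S.H - hσ.act.toContinuousLinearMap)

/-- The projection onto the `σ`-even functions. -/
def evenPart : S.H →L[ℝ] S.H :=
  (1 / 2 : ℝ) • (ContinuousLinearMap.id ℝ S.H + hσ.act.toContinuousLinearMap)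

lemma oddPart_apply (g : S.H) : hσ.oddPart g = (1 / 2 : ℝ) • (g - hσ.act g) := rfl

lemma evenPart_apply (g : S.H) : hσ.evenPart g = (1 / 2 : ℝ) • (g + hσ.act g) := rfl

lemma oddPart_eq_self {g : S.H} (h : hσ.act g = -g) : hσ.oddPart g = g := by
  rw [oddPart_apply, h]; module

lemma evenPart_eq_self {g : S.H} (h : hσ.act g = g) : hσ.evenPart g = g := by
  rw [evenPart_apply, h]; module

lemma inner_oddPart (g u : S.H) : ⟪hσ.oddPart g, u⟫ = ⟪g, hσ.oddPart u⟫ := by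
  simp only [oddPart_apply, inner_smul_left, inner_smul_right, inner_sub_left, inner_sub_right,
    hσ.inner_act]
  rfl

lemma inner_evenPart (g u : S.H) : ⟪hσ.evenPart g, u⟫ = ⟪g, hσ.evenPart u⟫ := by
  simp only [evenPart_apply, inner_smul_left, inner_smul_right, inner_add_left, inner_add_right,
    hσ.inner_act]
  rfl

lemma isTest_odd {ξ : PlanarPhase → ℝ} (hξ : S.IsTest ξ) :
    S.IsTest fun z => 1 / 2 * (ξ z + -1 * ξ (σ z)) :=
  (hξ.add ((hσ.isTest hξ).const_mul (-1))).const_mul (1 / 2)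

lemma toH_odd (hS : S.IsSteadyState) {ξ : PlanarPhase → ℝ} (hξ : S.IsTest ξ) :
    S.toH (fun z => 1 / 2 * (ξ z + -1 * ξ (σ z))) = hσ.oddPart (S.toH ξ) := by
  have h1 := hS.memLp_test hξ
  have h2 := (hσ.isTest hξ).const_mul (-1)
  rw [toH_const_mul _ (hS.memLp_test (hξ.add h2)), toH_add h1 (hS.memLp_test h2),
    toH_const_mul _ (hS.memLp_test (hσ.isTest hξ)), ← hσ.act_toH h1, oddPart_apply]
  module

/-- Composition with a reversal changes the sign of `D`. Consequently `D` maps odd functions to even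
ones and even functions to odd ones, for each reflection separately. -/
lemma hasTransport_act (hS : S.IsSteadyState) {g h : S.H} (H : S.HasTransport g h) :
    S.HasTransport (hσ.act g) (-hσ.act h) := by
  rw [hS.hasTransport_iff] at H ⊢
  intro ξ hξ
  have h1 := H _ (hσ.isTest hξ)
  have e : S.classicalTransport (fun z => ξ (σ z))
      = fun z => -1 * S.classicalTransport ξ (σ z) := by
    funext z; rw [hσ.transport_comp hξ, neg_one_mul]
  have hm : MemLp (fun z => S.classicalTransport ξ (σ z)) 2 S.weightedMeasure :=
    (hS.memLp_transport hξ).comp_measurePreserving hσ.preserving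
  rw [e, toH_const_mul _ hm,
    ← hσ.act_toH (hS.memLp_transport hξ), ← hσ.act_toH (hS.memLp_test hξ), inner_smul_right] at h1
  rw [hσ.inner_act, inner_neg_left, hσ.inner_act]
  linarith

end IsReversal

namespace IsSteadyState
variable (hS : S.IsSteadyState)
include hS

lemma hasTransport_add {g h g' h' : S.H} (H : S.HasTransport g h) (H' : S.HasTransport g' h') :
    S.HasTransport (g + g') (h + h') := by
  rw [hS.hasTransport_iff] at H H' ⊢
  intro ξ hξ
  rw [inner_add_left, inner_add_left, H ξ hξ, H' ξ hξ]; ring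

lemma hasTransport_smul (c : ℝ) {g h : S.H} (H : S.HasTransport g h) :
    S.HasTransport (c • g) (c • h) := by
  rw [hS.hasTransport_iff] at H ⊢
  intro ξ hξ
  rw [inner_smul_left, inner_smul_left, H ξ hξ]; simp

lemma hasTransport_neg {g h : S.H} (H : S.HasTransport g h) : S.HasTransport (-g) (-h) := by
  simpa using hS.hasTransport_smul (-1) H

lemma hasTransport_odd {σ : PlanarPhase ≃L[ℝ] PlanarPhase} (hσ : S.IsReversal σ) {g h : S.H}
    (H : S.HasTransport g h) : S.HasTransport (hσ.oddPart g) (hσ.evenPart h) := by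
  have := hS.hasTransport_smul (1 / 2)
    (hS.hasTransport_add H (hS.hasTransport_neg (hσ.hasTransport_act hS H)))
  rwa [neg_neg, ← sub_eq_add_neg] at this

lemma act_transport_of_odd {σ : PlanarPhase ≃L[ℝ] PlanarPhase} (hσ : S.IsReversal σ) {g h : S.H}
    (H : S.HasTransport g h) (hg : hσ.act g = -g) : hσ.act h = h := by
  have h1 := hσ.hasTransport_act hS H
  rw [hg] at h1
  exact neg_injective (hS.hasTransport_unique h1 (hS.hasTransport_neg H))

lemma act_transport_of_even {σ : PlanarPhase ≃L[ℝ] PlanarPhase} (hσ : S.IsReversal σ) {g h : S.H}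
    (H : S.HasTransport g h) (hg : hσ.act g = g) : hσ.act h = -h := by
  have h1 := hσ.hasTransport_act hS H
  rw [hg] at h1
  exact neg_eq_iff_eq_neg.1 (hS.hasTransport_unique h1 H)

lemma slope_reflX (z : PlanarPhase) : S.slope (reflX z) = S.slope z := by
  obtain ⟨x, v, w⟩ := z
  rw [reflX_apply, hS.slope_eq, hS.slope_eq, hS.U₀_neg]

lemma slope_reflV (z : PlanarPhase) : S.slope (reflV z) = S.slope z := by
  obtain ⟨x, v, w⟩ := z
  rw [reflV_apply, hS.slope_eq, hS.slope_eq]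
  simp [indicator]

lemma isReversal_of_slope {σ : PlanarPhase ≃L[ℝ] PlanarPhase} (h1 : ∀ z, σ (σ z) = z)
    (h2 : MeasurePreserving σ (volume : Measure PlanarPhase) volume)
    (h3 : ∀ z, S.slope (σ z) = S.slope z) (h4 : ∀ z, S.field (σ z) = -σ (S.field z)) :
    S.IsReversal σ where
  involutive := h1
  preserving := by
    refine ⟨h2.measurable, ?_⟩
    ext s hs
    rw [Measure.map_apply h2.measurable hs, hS.weightedMeasure_eq,
      withDensity_apply _ (h2.measurable hs), withDensity_apply _ hs,
      ← h2.setLIntegral_comp_preimage hs hS.measurable_ofReal_inv_slope]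
    simp only [h3]
  mem z hz := by
    by_contra h
    have := hS.slope_pos hz
    rw [← h3, slope_of_notMem h] at this
    exact this.false
  field := h4

lemma isReversal_reflX : S.IsReversal reflX :=
  hS.isReversal_of_slope (fun z => by simp [reflX_apply]) measurePreserving_reflX hS.slope_reflX
    fun z => by
      simp only [reflX_apply, field, hS.deriv_U₀_neg]
      ext <;> simp

lemma isReversal_reflV : S.IsReversal reflV :=
  hS.isReversal_of_slope (fun z => by simp [reflV_apply]) measurePreserving_reflV hS.slope_reflV
    fun z => by
      simp only [reflV_apply, field]
      ext <;> simp

lemma mem_Hodd_iff {g : S.H} : g ∈ S.Hodd ↔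
    hS.isReversal_reflX.act g = -g ∧ hS.isReversal_reflV.act g = -g := by
  rw [IsReversal.act_eq_neg_iff, IsReversal.act_eq_neg_iff, ← eventually_and]
  rfl

/-- The projection onto the functions that are odd in `x` and in `v₁`. -/
def oddOdd : S.H →L[ℝ] S.H := hS.isReversal_reflX.oddPart ∘L hS.isReversal_reflV.oddPart

/-- The projection onto the functions that are even in `x` and in `v₁`. -/
def evenEven : S.H →L[ℝ] S.H := hS.isReversal_reflX.evenPart ∘L hS.isReversal_reflV.evenPart

lemma oddOdd_of_mem {g : S.H} (hg : g ∈ S.Hodd) : hS.oddOdd g = g := by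
  rw [hS.mem_Hodd_iff] at hg
  rw [oddOdd, ContinuousLinearMap.comp_apply, IsReversal.oddPart_eq_self _ hg.2,
    IsReversal.oddPart_eq_self _ hg.1]

lemma evenEven_of_mem {g h : S.H} (hg : g ∈ S.Hodd) (H : S.HasTransport g h) :
    hS.evenEven h = h := by
  rw [hS.mem_Hodd_iff] at hg
  rw [evenEven, ContinuousLinearMap.comp_apply,
    IsReversal.evenPart_eq_self _ (hS.act_transport_of_odd _ H hg.2),
    IsReversal.evenPart_eq_self _ (hS.act_transport_of_odd _ H hg.1)]

lemma inner_oddOdd {g : S.H} (hg : g ∈ S.Hodd) (u : S.H) : ⟪g, hS.oddOdd u⟫ = ⟪g, u⟫ := by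
  rw [hS.mem_Hodd_iff] at hg
  rw [oddOdd, ContinuousLinearMap.comp_apply, ← IsReversal.inner_oddPart,
    IsReversal.oddPart_eq_self _ hg.1, ← IsReversal.inner_oddPart,
    IsReversal.oddPart_eq_self _ hg.2]

lemma inner_evenEven {g h : S.H} (hg : g ∈ S.Hodd) (H : S.HasTransport g h) (u : S.H) :
    ⟪h, hS.evenEven u⟫ = ⟪h, u⟫ := by
  rw [hS.mem_Hodd_iff] at hg
  rw [evenEven, ContinuousLinearMap.comp_apply, ← IsReversal.inner_evenPart,
    IsReversal.evenPart_eq_self _ (hS.act_transport_of_odd _ H hg.1), ← IsReversal.inner_evenPart,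
    IsReversal.evenPart_eq_self _ (hS.act_transport_of_odd _ H hg.2)]

/-- The odd part of a test function. -/
lemma exists_test_odd {ξ : PlanarPhase → ℝ} (hξ : S.IsTest ξ) : ∃ ζ, S.IsTest ζ ∧
    (∀ z, ζ (-z.1, z.2) = -ζ z) ∧ (∀ z, ζ (z.1, -z.2.1, z.2.2) = -ζ z) ∧
    S.toH ζ = hS.oddOdd (S.toH ξ) ∧
    S.toH (S.classicalTransport ζ) = hS.evenEven (S.toH (S.classicalTransport ξ)) := by
  have t1 := hS.isReversal_reflV.isTest_odd hξ
  have t2 := hS.isReversal_reflX.isTest_odd t1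
  have e : S.toH _ = hS.oddOdd (S.toH ξ) :=
    (hS.isReversal_reflX.toH_odd hS t1).trans
      (congrArg _ (hS.isReversal_reflV.toH_odd hS hξ))
  refine ⟨_, t2, fun z => ?_, fun z => ?_, e, ?_⟩
  · simp only [reflX_apply, reflV_apply, neg_neg]; ring
  · simp only [reflX_apply, reflV_apply, neg_neg]; ring
  · have h := hS.hasTransport_toH t2
    rw [e] at h
    exact hS.hasTransport_unique h (hS.hasTransport_odd hS.isReversal_reflX
      (hS.hasTransport_odd hS.isReversal_reflV (hS.hasTransport_toH hξ)))

lemma mem_Hodd_toH {ξ : PlanarPhase → ℝ} (hξ : S.IsTest ξ) (hx : ∀ z, ξ (-z.1, z.2) = -ξ z)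
    (hv : ∀ z, ξ (z.1, -z.2.1, z.2.2) = -ξ z) : S.toH ξ ∈ S.Hodd := by
  rw [hS.mem_Hodd_iff, IsReversal.act_toH _ (hS.memLp_test hξ),
    IsReversal.act_toH _ (hS.memLp_test hξ)]
  have e : S.toH (fun z => -1 * ξ z) = -S.toH ξ := by
    rw [toH_const_mul _ (hS.memLp_test hξ), neg_one_smul]
  simp only [reflX_apply, reflV_apply, hx, hv, ← e, neg_one_mul, and_self]

/-- Coercivity of the quadratic form on the odd functions. -/
theorem coercive {c : ℝ} (hc0 : 0 < c) (hc : ∀ x, S.U₀ x < S.E₀ → c * x ^ 2 ≤ x * deriv S.U₀ x)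
    {g h : S.H} (hg : g ∈ S.Hodd) (H : S.HasTransport g h) :
    4 * π * ‖hS.flux g‖ ^ 2 + 3 * c * ‖g‖ ^ 2 ≤ ‖h‖ ^ 2 := by
  -- The approximating test functions need not be odd. Projecting them by `oddOdd` projects their
  -- transports by `evenEven`, and both projections are continuous and fix the limits.
  obtain ⟨ξ, hξ, h1, h2⟩ := hS.exists_seq_test H
  choose ζ hζ hx hv e1 e2 using fun n => hS.exists_test_odd (hξ n)
  have l1 : Tendsto (fun n => S.toH (ζ n)) atTop (𝓝 g) := by
    simp only [e1]
    have := (hS.oddOdd.continuous.tendsto g).comp h1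
    rwa [hS.oddOdd_of_mem hg] at this
  have l2 : Tendsto (fun n => S.toH (S.classicalTransport (ζ n))) atTop (𝓝 h) := by
    simp only [e2]
    have := (hS.evenEven.continuous.tendsto h).comp h2
    rwa [hS.evenEven_of_mem hg H] at this
  have l3 := (hS.flux.continuous.tendsto g).comp l1
  exact le_of_tendsto_of_tendsto' (((l3.norm.pow 2).const_mul _).add ((l1.norm.pow 2).const_mul _))
    (l2.norm.pow 2) fun n => hS.coercive_test hc0 hc (hζ n) (hx n) (hv n)

lemma ext_act {σ : PlanarPhase ≃L[ℝ] PlanarPhase} (hσ : S.IsReversal σ) (g : S.H) :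
    ext (hσ.act g) =ᵐ[volume] fun z => ext g (σ z) := by
  refine hS.ae_ext_eq ?_ fun z hz => ?_
  · refine (hσ.coeFn_act g).trans (hS.ae_weighted_iff.2 (Eventually.of_forall fun z hz => ?_))
    exact (indicator_of_mem (hσ.mem z hz) _).symm
  · rw [ext, indicator_of_notMem (hσ.notMem hz)]

lemma J_reflX (g : S.H) : ∀ᵐ x, S.J (hS.isReversal_reflX.act g) x = S.J g (-x) := by
  filter_upwards [J_eq_of_ae (hS.ext_act hS.isReversal_reflX g)] with x hx
  rw [hx]; rfl

lemma J_reflV (g : S.H) : ∀ᵐ x, S.J (hS.isReversal_reflV.act g) x = -S.J g x := by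
  filter_upwards [J_eq_of_ae (hS.ext_act hS.isReversal_reflV g)] with x hx
  have e : MeasurableEmbedding (Prod.map Neg.neg id : ℝ × (ℝ × ℝ) → ℝ × (ℝ × ℝ)) :=
    ((MeasurableEquiv.neg ℝ).prodCongr (MeasurableEquiv.refl (ℝ × ℝ))).measurableEmbedding
  rw [hx, ← measurePreserving_neg_fst.integral_comp e, J, ← integral_neg]
  congr 1; funext v
  simp only [reflV_apply, Prod.map_fst, Prod.map_snd, id, neg_neg, neg_mul]
  rfl

lemma inner_flux_reflX (g u : S.H) : ⟪hS.flux (hS.isReversal_reflX.act g), hS.flux u⟫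
    = ⟪hS.flux g, hS.flux (hS.isReversal_reflX.act u)⟫ := by
  rw [hS.inner_flux, hS.inner_flux, ← integral_neg_eq_self (μ := volume)]
  refine integral_congr_ae ?_
  filter_upwards [(Measure.measurePreserving_neg volume).quasiMeasurePreserving.ae (hS.J_reflX g),
    hS.J_reflX u] with x h1 h2
  rw [h1, h2, neg_neg]

lemma inner_flux_reflV (g u : S.H) : ⟪hS.flux (hS.isReversal_reflV.act g), hS.flux u⟫
    = ⟪hS.flux g, hS.flux (hS.isReversal_reflV.act u)⟫ := by
  rw [hS.inner_flux, hS.inner_flux]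
  refine integral_congr_ae ?_
  filter_upwards [hS.J_reflV g, hS.J_reflV u] with x h1 h2
  rw [h1, h2]; ring

/-- By `inner_B` it suffices that the flux pairing is symmetric under the reflection. -/
lemma act_B_of_odd {σ : PlanarPhase ≃L[ℝ] PlanarPhase} (hσ : S.IsReversal σ)
    (hσJ : ∀ g u, ⟪hS.flux (hσ.act g), hS.flux u⟫ = ⟪hS.flux g, hS.flux (hσ.act u)⟫)
    {g : S.H} (hg : hσ.act g = -g) : hσ.act (S.toH (S.B g)) = -S.toH (S.B g) := by
  refine ext_inner_right ℝ fun u => ?_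
  rw [hσ.inner_act, inner_neg_left, hS.inner_B, hS.inner_B, ← hσJ, hg, map_neg, inner_neg_left]
  ring

lemma B_mem_Hodd {g : S.H} (hg : g ∈ S.Hodd) : S.toH (S.B g) ∈ S.Hodd := by
  rw [hS.mem_Hodd_iff] at hg ⊢
  exact ⟨hS.act_B_of_odd _ hS.inner_flux_reflX hg.1, hS.act_B_of_odd _ hS.inner_flux_reflV hg.2⟩

lemma transport_transport_mem_Hodd {g h k : S.H} (hg : g ∈ S.Hodd) (H : S.HasTransport g h)
    (H' : S.HasTransport h k) : k ∈ S.Hodd := by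
  rw [hS.mem_Hodd_iff] at hg ⊢
  exact ⟨hS.act_transport_of_even _ H' (hS.act_transport_of_odd _ H hg.1),
    hS.act_transport_of_even _ H' (hS.act_transport_of_odd _ H hg.2)⟩

end IsSteadyState
end PlanarData

/-! ### The operator `A`, its solvability below the gap, and its spectrum. -/

namespace PlanarData
variable {S : PlanarData}
namespace IsSteadyState
variable (hS : S.IsSteadyState)
include hS

lemma hasAntonov_iff {g f : S.H} : S.HasAntonov g f ↔
    ∃ h k, S.HasTransport g h ∧ S.HasTransport h k ∧ f = -k - S.toH (S.B g) := by
  refine exists_congr fun h => exists_congr fun k => and_congr_right fun _ =>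
    and_congr_right fun _ => ?_
  have e : ∀ᵐ z ∂S.weightedMeasure, (-k - S.toH (S.B g) : S.H) z = -k z - S.B g z := by
    filter_upwards [Lp.coeFn_sub (-k) (S.toH (S.B g)), Lp.coeFn_neg k,
      coeFn_toH (hS.memLp_B g)] with z h1 h2 h3
    rw [h1, Pi.sub_apply, h2, Pi.neg_apply, h3]
  constructor
  · intro h
    refine Lp.ext ?_
    filter_upwards [h, e] with z h1 h2
    rw [h1, h2]
  · rintro rfl
    exact e

/-- Skew-symmetry applied to the pairs `(g, h)` and `(h, k)` gives `⟪k, g⟫ = -‖h‖²`. -/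
lemma inner_antonov {g h k : S.H} (H : S.HasTransport g h) (H' : S.HasTransport h k) :
    ⟪-k - S.toH (S.B g), g⟫ = ‖h‖ ^ 2 - 4 * π * ‖hS.flux g‖ ^ 2 := by
  have h1 := hS.inner_add_inner_eq_zero H H'
  rw [inner_sub_left, inner_neg_left, hS.inner_B, real_inner_self_eq_norm_sq]
  rw [real_inner_self_eq_norm_sq] at h1
  linarith

lemma le_inner_antonov {c : ℝ} (hc0 : 0 < c)
    (hc : ∀ x, S.U₀ x < S.E₀ → c * x ^ 2 ≤ x * deriv S.U₀ x) {g f : S.H} (hg : g ∈ S.Hodd)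
    (H : S.HasAntonov g f) : 3 * c * ‖g‖ ^ 2 ≤ ⟪f, g⟫ := by
  obtain ⟨h, k, H1, H2, rfl⟩ := hS.hasAntonov_iff.1 H
  rw [hS.inner_antonov H1 H2]
  linarith [hS.coercive hc0 hc hg H1]

lemma toH_B_sub (g g' : S.H) : S.toH (S.B (g - g')) = S.toH (S.B g) - S.toH (S.B g') := by
  refine ext_inner_right ℝ fun u => ?_
  rw [inner_sub_left, hS.inner_B, hS.inner_B, hS.inner_B, map_sub, inner_sub_left]
  ring

lemma hasTransport_sub {g h g' h' : S.H} (H : S.HasTransport g h) (H' : S.HasTransport g' h') :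
    S.HasTransport (g - g') (h - h') := by
  simpa only [sub_eq_add_neg] using hS.hasTransport_add H (hS.hasTransport_neg H')

lemma hasAntonov_sub {g f g' f' : S.H} (H : S.HasAntonov g f) (H' : S.HasAntonov g' f') :
    S.HasAntonov (g - g') (f - f') := by
  obtain ⟨h, k, H1, H2, rfl⟩ := hS.hasAntonov_iff.1 H
  obtain ⟨h', k', H1', H2', rfl⟩ := hS.hasAntonov_iff.1 H'
  refine hS.hasAntonov_iff.2 ⟨_, _, hS.hasTransport_sub H1 H1', hS.hasTransport_sub H2 H2', ?_⟩
  rw [hS.toH_B_sub]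
  abel

/-- The functions that are odd in `x` and in `v₁`. -/
def oddSubmodule : Submodule ℝ S.H where
  carrier := S.Hodd
  add_mem' {a b} ha hb := by
    rw [hS.mem_Hodd_iff] at *
    rw [map_add, map_add, ha.1, ha.2, hb.1, hb.2, neg_add]
    exact ⟨rfl, rfl⟩
  zero_mem' := by
    rw [hS.mem_Hodd_iff]
    simp
  smul_mem' c a ha := by
    rw [hS.mem_Hodd_iff] at *
    rw [map_smul, map_smul, ha.1, ha.2, smul_neg]
    exact ⟨rfl, rfl⟩

lemma isClosed_Hodd : IsClosed S.Hodd := by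
  have e : S.Hodd = {g | hS.isReversal_reflX.act g = -g} ∩ {g | hS.isReversal_reflV.act g = -g} :=
    Set.ext fun g => hS.mem_Hodd_iff
  rw [e]
  exact (isClosed_eq (LinearIsometry.continuous _) continuous_neg).inter
    (isClosed_eq (LinearIsometry.continuous _) continuous_neg)

/-- The graph of the transport operator on the functions that are odd in `x` and in `v₁`. -/
def oddGraph : Submodule ℝ (WithLp 2 (S.H × S.H)) where
  carrier := {p | p.fst ∈ S.Hodd ∧ S.HasTransport p.fst p.snd}
  add_mem' {_ _} ha hb := ⟨hS.oddSubmodule.add_mem ha.1 hb.1, hS.hasTransport_add ha.2 hb.2⟩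
  zero_mem' := ⟨hS.oddSubmodule.zero_mem, by
    rw [hS.hasTransport_iff]; intro ξ _
    simp⟩
  smul_mem' c _ ha := ⟨hS.oddSubmodule.smul_mem c ha.1, hS.hasTransport_smul c ha.2⟩

lemma isClosed_oddGraph : IsClosed (hS.oddGraph : Set (WithLp 2 (S.H × S.H))) := by
  have e : (hS.oddGraph : Set (WithLp 2 (S.H × S.H))) = {p | p.fst ∈ S.Hodd} ∩
      ⋂ ξ : {ξ // S.IsTest ξ}, {p | ⟪p.fst, S.toH (S.classicalTransport ξ)⟫
        = -⟪p.snd, S.toH ξ⟫} := by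
    ext p
    simp only [mem_inter_iff, mem_iInter, Subtype.forall]
    exact and_congr_right fun _ => hS.hasTransport_iff
  have c1 : Continuous fun p : WithLp 2 (S.H × S.H) => p.fst :=
    continuous_fst.comp (WithLp.prod_continuous_ofLp 2 _ _)
  have c2 : Continuous fun p : WithLp 2 (S.H × S.H) => p.snd :=
    continuous_snd.comp (WithLp.prod_continuous_ofLp 2 _ _)
  rw [e]
  exact (hS.isClosed_Hodd.preimage c1).inter (isClosed_iInter fun ξ =>
    isClosed_eq (c1.inner continuous_const) (c2.inner continuous_const).neg)

instance : CompleteSpace hS.oddGraph := hS.isClosed_oddGraph.completeSpace_coe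

/-- The function component of an element of the graph. -/
def graphFst : hS.oddGraph →L[ℝ] S.H := WithLp.fstL 2 ℝ S.H S.H ∘L hS.oddGraph.subtypeL

/-- The transport component of an element of the graph. -/
def graphSnd : hS.oddGraph →L[ℝ] S.H := WithLp.sndL 2 ℝ S.H S.H ∘L hS.oddGraph.subtypeL

/-- The form of `A - l`. -/
def shiftedForm (l : ℝ) : hS.oddGraph →L[ℝ] hS.oddGraph →L[ℝ] ℝ :=
  (innerSL ℝ).bilinearComp hS.graphSnd hS.graphSnd
    - (4 * π) • (innerSL ℝ).bilinearComp (hS.flux ∘L hS.graphFst) (hS.flux ∘L hS.graphFst)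
    - l • (innerSL ℝ).bilinearComp hS.graphFst hS.graphFst

lemma shiftedForm_apply (l : ℝ) (p q : hS.oddGraph) : hS.shiftedForm l p q =
    ⟪p.1.snd, q.1.snd⟫ - 4 * π * ⟪hS.flux p.1.fst, hS.flux q.1.fst⟫
      - l * ⟪p.1.fst, q.1.fst⟫ := rfl

lemma isCoercive_shiftedForm {c l : ℝ} (hl : l < c)
    (hc : ∀ g ∈ S.Hodd, ∀ h, S.HasTransport g h →
      4 * π * ‖hS.flux g‖ ^ 2 + c * ‖g‖ ^ 2 ≤ ‖h‖ ^ 2) : IsCoercive (hS.shiftedForm l) := by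
  set M := 4 * π * S.ρ₀ 0 with hM
  have hM0 : 0 ≤ M := by have := hS.ρ₀_zero_pos; positivity
  set d := c - l with hd
  have hd0 : 0 < d := sub_pos.2 hl
  have hD : 0 < d + M + |l| := by positivity
  -- The form is split with weights `1 - θ` and `θ`. The first part yields `(1 - θ) d ‖g‖²`; the
  -- second retains `θ ‖D g‖²` at the cost of `θ (M + |l|) ‖g‖²`. This `θ` keeps the total loss at
  -- `d / 4`.
  set θ := d / (4 * (d + M + |l|)) with hθ
  have hθ0 : 0 < θ := by positivity
  have hθD : θ * (d + M + |l|) = d / 4 := by rw [hθ]; field_simp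
  have hθ1 : θ ≤ 1 / 4 := by
    rw [hθ, div_le_iff₀ (by positivity)]
    linarith [abs_nonneg l]
  refine ⟨min θ (d / 2), lt_min hθ0 (by linarith), fun p => ?_⟩
  have hp : ‖p‖ * ‖p‖ = ‖p.1.fst‖ ^ 2 + ‖p.1.snd‖ ^ 2 := by
    rw [← sq, Submodule.coe_norm, WithLp.prod_norm_sq_eq_of_L2]
  have h1 := hc _ p.2.1 _ p.2.2
  have h2 : 4 * π * ‖hS.flux p.1.fst‖ ^ 2 ≤ M * ‖p.1.fst‖ ^ 2 := by
    rw [hS.norm_flux_sq, hM]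
    linarith [mul_le_mul_of_nonneg_left (hS.integral_J_sq_le_norm p.1.fst)
      (show 0 ≤ 4 * π by positivity)]
  rw [mul_assoc, hp, hS.shiftedForm_apply, real_inner_self_eq_norm_sq, real_inner_self_eq_norm_sq,
    real_inner_self_eq_norm_sq]
  set N := ‖p.1.fst‖ ^ 2
  set X := ‖p.1.snd‖ ^ 2
  set F := 4 * π * ‖hS.flux p.1.fst‖ ^ 2
  have hN : 0 ≤ N := sq_nonneg _
  have hX : 0 ≤ X := sq_nonneg _
  have k1 : min θ (d / 2) * X ≤ θ * X := mul_le_mul_of_nonneg_right (min_le_left _ _) hX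
  have k2 : min θ (d / 2) * N ≤ d / 2 * N := mul_le_mul_of_nonneg_right (min_le_right _ _) hN
  have k3 : (1 - θ) * (d * N) ≤ (1 - θ) * (X - F - l * N) :=
    mul_le_mul_of_nonneg_left (by rw [hd]; linarith) (by linarith)
  have k4 : θ * (F + l * N) ≤ θ * ((M + |l|) * N) :=
    mul_le_mul_of_nonneg_left (by
      linarith [mul_le_mul_of_nonneg_right (le_abs_self l) hN]) hθ0.le
  have k5 : θ * (d + M + |l|) * N = d / 4 * N := by rw [hθD]
  have k6 : 0 ≤ d * N := by positivity
  linarith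

/-- Solvability of `A g = f + l g` in the odd functions, for `l` below the spectrum. -/
lemma exists_antonov_eq {l : ℝ} (hl : IsCoercive (hS.shiftedForm l)) {f : S.H} (hf : f ∈ S.Hodd) :
    ∃ g ∈ S.Hodd, S.HasAntonov g (f + l • g) := by
  -- The Lax-Milgram solution of the variational problem with right-hand side `f`.
  set p := hl.continuousLinearEquivOfBilin.symm
    ((InnerProductSpace.toDual ℝ hS.oddGraph).symm ((innerSL ℝ f) ∘L hS.graphFst))
  have hp : ∀ q : hS.oddGraph, hS.shiftedForm l p q = ⟪f, q.1.fst⟫ := by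
    intro q
    rw [← hl.continuousLinearEquivOfBilin_apply, ContinuousLinearEquiv.apply_symm_apply,
      InnerProductSpace.toDual_symm_apply]
    rfl
  obtain ⟨hg, H⟩ := p.2
  refine ⟨p.1.fst, hg, hS.hasAntonov_iff.2 ⟨p.1.snd,
    -(f + l • p.1.fst + S.toH (S.B p.1.fst)), H, ?_, by abel⟩⟩
  rw [hS.hasTransport_iff]
  intro ξ hξ
  -- The variational identity is available only for odd-odd test functions. All elements paired with
  -- `ξ` are odd-odd, and `D g` is even-even, so the projections drop out and the identity holds for
  -- every `ξ`. It states that `D g` has a weak transport, which puts `g` into `D(D²)`.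
  obtain ⟨ζ, hζ, hx, hv, e1, e2⟩ := hS.exists_test_odd hξ
  have h1 := hp ⟨WithLp.toLp 2 (S.toH ζ, S.toH (S.classicalTransport ζ)),
    hS.mem_Hodd_toH hζ hx hv, hS.hasTransport_toH hζ⟩
  rw [hS.shiftedForm_apply] at h1
  simp only [WithLp.toLp_fst, WithLp.toLp_snd] at h1
  rw [← hS.inner_B, e1, e2, hS.inner_evenEven hg H, hS.inner_oddOdd hg, hS.inner_oddOdd hf,
    hS.inner_oddOdd (hS.B_mem_Hodd hg)] at h1
  rw [inner_neg_left, neg_neg, inner_add_left, inner_add_left, inner_smul_left]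
  simp only [conj_trivial]
  linarith

omit hS in
lemma mul_norm_le_of_antonov {c : ℝ}
    (hc : ∀ g ∈ S.Hodd, ∀ f, S.HasAntonov g f → c * ‖g‖ ^ 2 ≤ ⟪f, g⟫) {l : ℝ} {g f : S.H}
    (hg : g ∈ S.Hodd) (H : S.HasAntonov g (f + l • g)) : (c - l) * ‖g‖ ≤ ‖f‖ := by
  have h1 := hc g hg _ H
  rw [inner_add_left, inner_smul_left, real_inner_self_eq_norm_sq] at h1
  simp only [conj_trivial] at h1
  have h2 := real_inner_le_norm f g
  rcases (norm_nonneg g).eq_or_lt with h0 | h0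
  · rw [← h0, mul_zero]; exact norm_nonneg f
  · refine le_of_mul_le_mul_right ?_ h0
    linarith

/-- For `l < c` existence comes from the Lax-Milgram theorem; uniqueness and the bound `(c - l)⁻¹`
of the inverse come from the lower bound of the form. -/
lemma operatorSpectrum_subset {c : ℝ} (hc1 : ∀ g ∈ S.Hodd, ∀ h, S.HasTransport g h →
      4 * π * ‖hS.flux g‖ ^ 2 + c * ‖g‖ ^ 2 ≤ ‖h‖ ^ 2)
    (hc : ∀ g ∈ S.Hodd, ∀ f, S.HasAntonov g f → c * ‖g‖ ^ 2 ≤ ⟪f, g⟫) :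
    operatorSpectrum S.Hodd S.HasAntonov ⊆ Ici c := by
  intro l hl
  by_contra hlc
  have hlc : l < c := not_le.1 hlc
  have hd : 0 < c - l := sub_pos.2 hlc
  refine hl ⟨fun f hf => ?_, (c - l)⁻¹, fun g hg f _ H => ?_⟩
  · obtain ⟨g, hg, H⟩ := hS.exists_antonov_eq (hS.isCoercive_shiftedForm hlc hc1) hf
    refine ⟨g, ⟨hg, H⟩, fun g' ⟨hg', H'⟩ => ?_⟩
    have hs := hS.hasAntonov_sub H' H
    have e : f + l • g' - (f + l • g) = 0 + l • (g' - g) := by module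
    rw [e] at hs
    have := mul_norm_le_of_antonov hc (hS.oddSubmodule.sub_mem hg' hg) hs
    rw [norm_zero] at this
    have h0 : ‖g' - g‖ ≤ 0 := nonpos_of_mul_nonpos_right this hd
    exact sub_eq_zero.1 (norm_le_zero_iff.1 h0)
  · rw [← div_eq_inv_mul, le_div_iff₀ hd, mul_comm]
    exact mul_norm_le_of_antonov hc hg H

lemma exists_antonov {g : S.H} (hg : g ∈ S.Hodd) (hg2 : g ∈ S.domSq) :
    ∃ f ∈ S.Hodd, ∀ f' : S.H, S.HasAntonov g f' ↔ f' = f := by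
  obtain ⟨h, k, H1, H2⟩ := hg2
  refine ⟨-k - S.toH (S.B g), hS.oddSubmodule.sub_mem
    (hS.oddSubmodule.neg_mem (hS.transport_transport_mem_Hodd hg H1 H2)) (hS.B_mem_Hodd hg),
    fun f' => ⟨fun H => ?_, fun e => hS.hasAntonov_iff.2 ⟨h, k, H1, H2, e⟩⟩⟩
  obtain ⟨h', k', H1', H2', rfl⟩ := hS.hasAntonov_iff.1 H
  obtain rfl := hS.hasTransport_unique H1 H1'
  rw [hS.hasTransport_unique H2 H2']

end IsSteadyState
end PlanarData

end

theorem theorem7p8 (S : PlanarData) (hS : S.IsSteadyState) :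
    -- the operator `A : D(D²) ∩ Hodd → Hodd` is well-defined
    (∀ g ∈ S.Hodd, g ∈ S.domSq → ∃ f ∈ S.Hodd, ∀ f' : S.H, S.HasAntonov g f' ↔ f' = f) ∧
    ∃ c : ℝ, 0 < c ∧
      -- `⟨A g, g⟩ ≥ c ‖g‖²` for `g ∈ D(D) ∩ Hodd`, where `h = D g`
      (∀ g ∈ S.Hodd, ∀ h : S.H, S.HasTransport g h →
        MemLp (S.inducedField h) 2 volume ∧ c * ‖g‖ ^ 2 ≤ S.antonovForm h) ∧
      -- the kernel of the restricted operator is trivial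
      (∀ g ∈ S.Hodd, S.HasAntonov g 0 → g = 0) ∧
      -- the spectrum of the restricted operator is bounded away from zero
      operatorSpectrum S.Hodd S.HasAntonov ⊆ Set.Ici c := by
  obtain ⟨c, hc0, hc⟩ := hS.exists_mul_sq_le
  refine ⟨fun g hg hg2 => hS.exists_antonov hg hg2, 3 * c, by positivity, fun g hg h H => ?_,
    fun g hg H => ?_, ?_⟩
  · refine ⟨hS.memLp_inducedField H, ?_⟩
    rw [hS.antonovForm_eq H]
    linarith [hS.coercive hc0 hc hg H]
  · have h1 := hS.le_inner_antonov hc0 hc hg H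
    rw [inner_zero_left] at h1
    have h2 : ‖g‖ ^ 2 = 0 := le_antisymm (nonpos_of_mul_nonpos_right h1 (by positivity))
      (sq_nonneg _)
    exact norm_eq_zero.1 (pow_eq_zero_iff two_ne_zero |>.1 h2)
  · exact hS.operatorSpectrum_subset (fun g hg h H => hS.coercive hc0 hc hg H)
      fun g hg f H => hS.le_inner_antonov hc0 hc hg H
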